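/- Let $k$ be an algebraically closed field of characteristic zero and let $n_R \ge 4$. Let $\Sigma = (X, \mathcal R, \mathcal D)$ be a genus zero super Riemann surface over $k$ with $n_R$ labelled Ramond punctures. That is: $X$ is a smooth proper connected superscheme over $k$ of dimension $(1|1)$ ($\Omega^1_X$ is locally free of rank $(1|1)$) whose bosonic reduction $X_{\mathrm{bos}}$ has genus zero, i.e. $H^1(X_{\mathrm{bos}}, \mathcal O_{X_{\mathrm{bos}}})=0$; $\mathcal R\subset X$ is an effective Cartier divisor of degree $n_R$, unramified over $k$ (its bosonic reduction is unramified over $k$), whose components (the Ramond punctures) are labelled by $1,\dots,n_R$; and $\mathcal D \subset \mathcal T_X$ is a rank-$(0|1)$ subbundle such that the supercommutator $\mathcal D^{\otimes 2} \to \mathcal T_X/\mathcal D$ is an isomorphism onto $(\mathcal T_X/\mathcal D)(-\mathcal R)$. Let $\mathrm{Aut}(\Sigma)$ be the group of automorphisms of the superscheme $X$ over $k$ that preserve $\mathcal R$ together with the labelling of its components and preserve $\mathcal D$. Then $\mathrm{Aut}(\Sigma) \cong \mathbb Z/2\mathbb Z$, and its nontrivial element is the parity automorphism, which is the identity on the underlying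 space and on even functions and multiplication by $-1$ on odd functions (in local coordinates $(z\,|\,\zeta)$: $z\mapsto z$, $\zeta\mapsto-\zeta$). -/

import Mathlib

open CategoryTheory AlgebraicGeometry TopologicalSpace Opposite

universe u

noncomputable section

/-! ## Supercommutative rings

A supercommutative ring `A = A⁺ ⊕ A⁻` is the same thing as a commutative ring `R = A⁺`, an
`R`-module `M = A⁻`, and an alternating `R`-bilinear product `M × M → R` with `(xy)z = x(yz)`. -/

/-- The product of odd elements in a supercommutative ring with even part `R` and odd part `M`.
Since `x y = - y x` for odd `x, y`, it is alternating; as even elements are central,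
associativity `(x y) z = x (y z)` reads `(x y) • z = (y z) • x`. -/
structure OddMul (R M : Type*) [CommRing R] [AddCommGroup M] [Module R M] where
  mul : M →ₗ[R] M →ₗ[R] R
  mul_self : ∀ x, mul x x = 0
  mul_smul : ∀ x y z, mul x y • z = mul y z • x

/-- The supercommutative ring `R ⊕ M`. -/
@[ext]
structure SuperRing {R M : Type*} [CommRing R] [AddCommGroup M] [Module R M]
    (μ : OddMul R M) where
  /-- the even component -/
  ev : R
  /-- the odd component -/
  od : M

namespace SuperRing

variable {R M : Type*} [CommRing R] [AddCommGroup M] [Module R M] {μ : OddMul R M}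

instance : Zero (SuperRing μ) := ⟨⟨0, 0⟩⟩
instance : One (SuperRing μ) := ⟨⟨1, 0⟩⟩
instance : Add (SuperRing μ) := ⟨fun a b => ⟨a.ev + b.ev, a.od + b.od⟩⟩
instance : Neg (SuperRing μ) := ⟨fun a => ⟨-a.ev, -a.od⟩⟩
instance : Mul (SuperRing μ) :=
  ⟨fun a b => ⟨a.ev * b.ev + μ.mul a.od b.od, a.ev • b.od + b.ev • a.od⟩⟩

@[simp] theorem zero_ev : (0 : SuperRing μ).ev = 0 := rfl
@[simp] theorem zero_od : (0 : SuperRing μ).od = 0 := rfl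
@[simp] theorem one_ev : (1 : SuperRing μ).ev = 1 := rfl
@[simp] theorem one_od : (1 : SuperRing μ).od = 0 := rfl
@[simp] theorem add_ev (a b : SuperRing μ) : (a + b).ev = a.ev + b.ev := rfl
@[simp] theorem add_od (a b : SuperRing μ) : (a + b).od = a.od + b.od := rfl
@[simp] theorem neg_ev (a : SuperRing μ) : (-a).ev = -a.ev := rfl
@[simp] theorem neg_od (a : SuperRing μ) : (-a).od = -a.od := rfl
@[simp] theorem mul_ev (a b : SuperRing μ) :
    (a * b).ev = a.ev * b.ev + μ.mul a.od b.od := rfl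
@[simp] theorem mul_od (a b : SuperRing μ) :
    (a * b).od = a.ev • b.od + b.ev • a.od := rfl

instance : Ring (SuperRing μ) where
  add_assoc a b c := by ext <;> simp [add_assoc]
  zero_add a := by ext <;> simp
  add_zero a := by ext <;> simp
  add_comm a b := by ext <;> simp [add_comm]
  neg_add_cancel a := by ext <;> simp
  left_distrib a b c := by
    ext
    · simp [mul_add]; abel
    · simp [add_smul]; abel
  right_distrib a b c := by
    ext
    · simp [add_mul]; abel
    · simp [add_smul]; abel
  zero_mul a := by ext <;> simp
  mul_zero a := by ext <;> simp
  one_mul a := by ext <;> simp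
  mul_one a := by ext <;> simp
  mul_assoc a b c := by
    ext
    · simp only [mul_ev, mul_od, map_add, map_smul, LinearMap.add_apply, LinearMap.smul_apply,
        smul_eq_mul]
      ring
    · simp only [mul_ev, mul_od, add_smul, smul_add, mul_smul, μ.mul_smul a.od b.od c.od,
        smul_comm c.ev a.ev b.od, smul_comm c.ev b.ev a.od]
      abel
  nsmul := nsmulRec
  zsmul := zsmulRec

/-- The inclusion of the even part. -/
def ofEven (μ : OddMul R M) : R →+* SuperRing μ where
  toFun r := ⟨r, 0⟩
  map_zero' := rfl
  map_one' := rfl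
  map_add' a b := by ext <;> simp
  map_mul' a b := by ext <;> simp

/-- The parity involution `γ`: it is `1` on even and `-1` on odd elements. -/
def parity (μ : OddMul R M) : SuperRing μ →+* SuperRing μ where
  toFun a := ⟨a.ev, -a.od⟩
  map_zero' := by ext <;> simp
  map_one' := by ext <;> simp
  map_add' a b := by ext <;> simp [add_comm]
  map_mul' a b := by ext <;> simp [add_comm]

theorem parity_apply (a : SuperRing μ) : parity μ a = ⟨a.ev, -a.od⟩ := rfl

/-- `a` is homogeneous of even parity. -/
def IsEven (a : SuperRing μ) : Prop := a.od = 0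

/-- `a` is homogeneous of odd parity. -/
def IsOdd (a : SuperRing μ) : Prop := a.ev = 0

/-! ### Kähler differentials of a superalgebra

For a superalgebra `A = SuperRing μ` over `k` (with structure map `c : k → A⁺`), the module
`Ω_{A/k}` is the left `A`-module generated by symbols `da` subject to additivity, `d(c t) = 0` and
`d(ab) = a db + (-1)^{|a||b|} b da` for homogeneous `a, b` (i.e. `d(ab) = (da) b + a db`). -/

/-- The relations defining the Kähler differentials. -/
def kaehlerRelations {k : Type*} [CommRing k] (c : k →+* R) (μ : OddMul R M) :
    Submodule (SuperRing μ) (SuperRing μ →₀ SuperRing μ) :=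
  Submodule.span (SuperRing μ)
    ({ω | ∃ a b : SuperRing μ, ω = Finsupp.single (a + b) 1 - Finsupp.single a 1 - Finsupp.single b 1} ∪
     {ω | ∃ t : k, ω = Finsupp.single (ofEven μ (c t)) 1} ∪
     {ω | ∃ a b : SuperRing μ, ((IsEven a ∧ IsEven b) ∨ (IsEven a ∧ IsOdd b) ∨ (IsOdd a ∧ IsEven b)) ∧
        ω = Finsupp.single (a * b) 1 - a • Finsupp.single b 1 - b • Finsupp.single a 1} ∪
     {ω | ∃ a b : SuperRing μ, IsOdd a ∧ IsOdd b ∧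
        ω = Finsupp.single (a * b) 1 - a • Finsupp.single b 1 + b • Finsupp.single a 1})

/-- The module of Kähler differentials of the superalgebra `SuperRing μ` over `k`. -/
abbrev Kaehler {k : Type*} [CommRing k] (c : k →+* R) (μ : OddMul R M) : Type _ :=
  (SuperRing μ →₀ SuperRing μ) ⧸ kaehlerRelations c μ

/-- The universal derivation. -/
def dif {k : Type*} [CommRing k] (c : k →+* R) (μ : OddMul R M) (a : SuperRing μ) :
    Kaehler c μ :=
  (kaehlerRelations c μ).mkQ (Finsupp.single a 1)

/-- The even differentials: sums of `a db` with `a, b` of equal parity. -/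
def evenDifferentials {k : Type*} [CommRing k] (c : k →+* R) (μ : OddMul R M) :
    AddSubgroup (Kaehler c μ) :=
  AddSubgroup.closure
    {ω | ∃ a b : SuperRing μ, ((IsEven a ∧ IsEven b) ∨ (IsOdd a ∧ IsOdd b)) ∧ ω = a • dif c μ b}

/-- The odd differentials: sums of `a db` with `a, b` of opposite parity. -/
def oddDifferentials {k : Type*} [CommRing k] (c : k →+* R) (μ : OddMul R M) :
    AddSubgroup (Kaehler c μ) :=
  AddSubgroup.closure
    {ω | ∃ a b : SuperRing μ, ((IsEven a ∧ IsOdd b) ∨ (IsOdd a ∧ IsEven b)) ∧ ω = a • dif c μ b}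

/-- The module of Kähler differentials is free of rank `(1|1)`: it has a homogeneous basis
consisting of one even and one odd element. -/
def KaehlerFreeOneOne {k : Type*} [CommRing k] (c : k →+* R) (μ : OddMul R M) : Prop :=
  ∃ e₀ ∈ evenDifferentials c μ, ∃ e₁ ∈ oddDifferentials c μ,
    Function.Bijective fun p : SuperRing μ × SuperRing μ => p.1 • e₀ + p.2 • e₁

end SuperRing

/-! ## Superschemes -/

/-- A superscheme over `k`: a scheme `(X, 𝒪_X⁺)` over `k`, a quasi-coherent `𝒪_X⁺`-module `𝒪_X⁻`,
and a multiplication `𝒪_X⁻ × 𝒪_X⁻ → 𝒪_X⁺` making `𝒪_X = 𝒪_X⁺ ⊕ 𝒪_X⁻` a sheaf of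
supercommutative `k`-algebras. -/
structure SuperScheme (k : Type u) [Field k] where
  /-- the scheme `(X, 𝒪_X⁺)` -/
  even : Scheme.{u}
  /-- the structure morphism -/
  toBase : even ⟶ Spec (.of k)
  /-- the sheaf `𝒪_X⁻` of odd functions -/
  odd : even.Modules
  isQuasicoherent : SheafOfModules.IsQuasicoherent (R := even.ringCatSheaf) odd
  /-- the product of odd functions -/
  oddMul : ∀ U : even.Opens, OddMul Γ(even, U) Γ(odd, U)
  map_oddMul : ∀ (U V : even.Opens) (h : V ≤ U) (x y : Γ(odd, U)),
    (oddMul V).mul (odd.presheaf.map (homOfLE h).op x) (odd.presheaf.map (homOfLE h).op y) =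
      even.presheaf.map (homOfLE h).op ((oddMul U).mul x y)

namespace SuperScheme

variable {k : Type u} [Field k]

/-- The superring `𝒪_X(U)`. -/
abbrev Fun (X : SuperScheme k) (U : X.even.Opens) : Type u := SuperRing (X.oddMul U)

/-- The constants `k → 𝒪_X⁺(U)`. -/
def const (X : SuperScheme k) (U : X.even.Opens) : k →+* Γ(X.even, U) :=
  (X.toBase.appLE ⊤ U le_top).hom.comp (Scheme.ΓSpecIso (.of k)).inv.hom

/-- Morphisms of superschemes over `k`: a morphism `base` of schemes `(X, 𝒪_X⁺) → (Y, 𝒪_Y⁺)` over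
`k`, together with a compatible map `𝒪_Y⁻ → base_* 𝒪_X⁻`; the latter is recorded through the
induced maps `𝒪_Y⁻(U) → 𝒪_X⁻(V)` for `V ⊆ base⁻¹(U)`. -/
structure Hom (X Y : SuperScheme k) where
  /-- the underlying map, on even functions -/
  base : X.even ⟶ Y.even
  base_toBase : base ≫ Y.toBase = X.toBase
  /-- the pullback of odd functions -/
  odd : ∀ (U : Y.even.Opens) (V : X.even.Opens), V ≤ base ⁻¹ᵁ U → (Γ(Y.odd, U) →+ Γ(X.odd, V))
  map_odd : ∀ (U : Y.even.Opens) (V V' : X.even.Opens) (h : V ≤ base ⁻¹ᵁ U) (h' : V' ≤ V)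
    (x : Γ(Y.odd, U)),
    X.odd.presheaf.map (homOfLE h').op (odd U V h x) = odd U V' (h'.trans h) x
  odd_map : ∀ (U U' : Y.even.Opens) (V : X.even.Opens) (h : V ≤ base ⁻¹ᵁ U) (h' : U ≤ U')
    (x : Γ(Y.odd, U')),
    odd U V h (Y.odd.presheaf.map (homOfLE h').op x) =
      odd U' V (h.trans (base.preimage_mono h')) x
  odd_smul : ∀ (U : Y.even.Opens) (V : X.even.Opens) (h : V ≤ base ⁻¹ᵁ U) (r : Γ(Y.even, U))
    (x : Γ(Y.odd, U)), odd U V h (r • x) = base.appLE U V h r • odd U V h x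
  odd_oddMul : ∀ (U : Y.even.Opens) (V : X.even.Opens) (h : V ≤ base ⁻¹ᵁ U)
    (x y : Γ(Y.odd, U)),
    (X.oddMul V).mul (odd U V h x) (odd U V h y) = base.appLE U V h ((Y.oddMul U).mul x y)

theorem Hom.ext {X Y : SuperScheme k} {f g : Hom X Y} (hb : f.base = g.base)
    (ho : ∀ U V h h' x, f.odd U V h x = g.odd U V h' x) : f = g := by
  obtain ⟨f, _, fo, _, _, _, _⟩ := f
  obtain ⟨g, _, go, _, _, _, _⟩ := g
  obtain rfl : f = g := hb
  obtain rfl : fo = go := by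
    funext U V h
    ext x
    exact ho U V h h x
  rfl

theorem odd_map_map (X : SuperScheme k) {U V W : X.even.Opens} (h : V ≤ U) (h' : W ≤ V)
    (x : Γ(X.odd, U)) :
    X.odd.presheaf.map (homOfLE h').op (X.odd.presheaf.map (homOfLE h).op x) =
      X.odd.presheaf.map (homOfLE (h'.trans h)).op x := by
  rw [← ConcreteCategory.comp_apply, ← Functor.map_comp]
  rfl

theorem odd_map_self (X : SuperScheme k) {U : X.even.Opens} (h : U ≤ U) (x : Γ(X.odd, U)) :
    X.odd.presheaf.map (homOfLE h).op x = x := by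
  have : (homOfLE h).op = 𝟙 (op U) := rfl
  rw [this, X.odd.presheaf.map_id]
  rfl

/-- The identity morphism. -/
def Hom.id (X : SuperScheme k) : Hom X X where
  base := 𝟙 _
  base_toBase := Category.id_comp _
  odd U V h := (X.odd.presheaf.map (homOfLE h).op).hom
  map_odd U V V' h h' x := X.odd_map_map _ _ _
  odd_map U V V' h h' x := X.odd_map_map _ _ _
  odd_smul U V h r x := by
    simp only [Scheme.Hom.appLE, Scheme.Hom.id_app]
    erw [Scheme.Modules.map_smul]
    rfl
  odd_oddMul U V h x y := by
    simp only [Scheme.Hom.appLE, Scheme.Hom.id_app]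
    exact X.map_oddMul U V h x y

/-- Composition of morphisms. -/
def Hom.comp {X Y Z : SuperScheme k} (f : Hom X Y) (g : Hom Y Z) : Hom X Z where
  base := f.base ≫ g.base
  base_toBase := by rw [Category.assoc, g.base_toBase, f.base_toBase]
  odd U V h := (f.odd (g.base ⁻¹ᵁ U) V h).comp (g.odd U (g.base ⁻¹ᵁ U) le_rfl)
  map_odd U V V' h h' x := f.map_odd _ _ _ _ _ _
  odd_map U U' V h h' x := by
    have h₁ : V ≤ f.base ⁻¹ᵁ (g.base ⁻¹ᵁ U) := h
    have h₂ : g.base ⁻¹ᵁ U ≤ g.base ⁻¹ᵁ U' := g.base.preimage_mono h'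
    change f.odd _ V h₁ (g.odd U (g.base ⁻¹ᵁ U) le_rfl _) =
      f.odd _ V (h₁.trans (f.base.preimage_mono h₂)) (g.odd U' (g.base ⁻¹ᵁ U') le_rfl x)
    rw [g.odd_map, ← g.map_odd U' (g.base ⁻¹ᵁ U') (g.base ⁻¹ᵁ U) le_rfl h₂, f.odd_map]
  odd_smul U V h r x := by
    have h₁ : V ≤ f.base ⁻¹ᵁ (g.base ⁻¹ᵁ U) := h
    change f.odd _ V h₁ (g.odd U (g.base ⁻¹ᵁ U) le_rfl _) =
      _ • f.odd _ V h₁ (g.odd U (g.base ⁻¹ᵁ U) le_rfl x)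
    rw [g.odd_smul, f.odd_smul, ← Scheme.Hom.appLE_comp_appLE f.base g.base U _ V le_rfl h₁]
    rfl
  odd_oddMul U V h x y := by
    have h₁ : V ≤ f.base ⁻¹ᵁ (g.base ⁻¹ᵁ U) := h
    change (X.oddMul V).mul (f.odd _ V h₁ (g.odd U (g.base ⁻¹ᵁ U) le_rfl x))
      (f.odd _ V h₁ (g.odd U (g.base ⁻¹ᵁ U) le_rfl y)) = _
    rw [f.odd_oddMul, g.odd_oddMul,
      ← Scheme.Hom.appLE_comp_appLE f.base g.base U _ V le_rfl h₁]
    rfl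

instance : Category (SuperScheme k) where
  Hom := Hom
  id := Hom.id
  comp := Hom.comp
  id_comp f := Hom.ext (Category.id_comp _) fun U V h h' x => f.map_odd _ _ _ _ _ _
  comp_id {X Y} f := Hom.ext (Category.comp_id _) fun U V h h' x => by
    exact congrArg (f.odd U V h') (Y.odd_map_self le_rfl x)
  assoc f g h := Hom.ext (Category.assoc _ _ _) fun U V h h' x => rfl

/-- The pullback of functions `𝒪_Y(U) → 𝒪_X(V)` along a morphism `f : X → Y`,
for `V ⊆ f⁻¹(U)`. -/
def Hom.pull {X Y : SuperScheme k} (f : X ⟶ Y) (U : Y.even.Opens) (V : X.even.Opens)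
    (h : V ≤ f.base ⁻¹ᵁ U) : Y.Fun U →+* X.Fun V where
  toFun a := ⟨f.base.appLE U V h a.ev, f.odd U V h a.od⟩
  map_zero' := by ext <;> simp
  map_one' := by ext <;> simp
  map_add' a b := by ext <;> simp
  map_mul' a b := by ext <;> simp [f.odd_smul, f.odd_oddMul]

/-- Restriction of functions. -/
def res (X : SuperScheme k) {U V : X.even.Opens} (h : V ≤ U) : X.Fun U →+* X.Fun V :=
  Hom.pull (𝟙 X) U V h

theorem res_apply (X : SuperScheme k) {U V : X.even.Opens} (h : V ≤ U) (a : X.Fun U) :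
    X.res h a = ⟨X.even.presheaf.map (homOfLE h).op a.ev,
      X.odd.presheaf.map (homOfLE h).op a.od⟩ := by
  ext
  · change (Scheme.Hom.appLE (𝟙 X.even) U V h) a.ev = _
    simp only [Scheme.Hom.appLE, Scheme.Hom.id_app]
    rfl
  · rfl

theorem Hom.pull_comp {X Y Z : SuperScheme k} (f : X ⟶ Y) (g : Y ⟶ Z) {U V W}
    (h : V ≤ g.base ⁻¹ᵁ U) (h' : W ≤ f.base ⁻¹ᵁ V) (h'' : W ≤ (f ≫ g).base ⁻¹ᵁ U)
    (a : Z.Fun U) : Hom.pull f V W h' (Hom.pull g U V h a) = Hom.pull (f ≫ g) U W h'' a := by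
  ext
  · change f.base.appLE V W h' (g.base.appLE U V h a.ev) =
      (f.base ≫ g.base).appLE U W h'' a.ev
    rw [← Scheme.Hom.appLE_comp_appLE f.base g.base U V W h h']
    rfl
  · change f.odd V W h' (g.odd U V h a.od) =
      f.odd (g.base ⁻¹ᵁ U) W h'' (g.odd U (g.base ⁻¹ᵁ U) le_rfl a.od)
    rw [← g.map_odd U (g.base ⁻¹ᵁ U) V le_rfl h, f.odd_map]

theorem Hom.pull_congr {X Y : SuperScheme k} {f g : X ⟶ Y} (hfg : f = g) {U V}
    (h : V ≤ f.base ⁻¹ᵁ U) (h' : V ≤ g.base ⁻¹ᵁ U) (a : Y.Fun U) :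
    Hom.pull f U V h a = Hom.pull g U V h' a := by
  subst hfg; rfl

theorem Hom.res_pull {X Y : SuperScheme k} (f : X ⟶ Y) {U V W} (h : V ≤ f.base ⁻¹ᵁ U)
    (h' : W ≤ V) (a : Y.Fun U) :
    X.res h' (Hom.pull f U V h a) = Hom.pull f U W (h'.trans h) a :=
  (Hom.pull_comp (𝟙 X) f h h' (h'.trans h) a).trans
    (Hom.pull_congr (Category.id_comp f) _ _ a)

theorem Hom.pull_res {X Y : SuperScheme k} (f : X ⟶ Y) {U U' V} (h : V ≤ f.base ⁻¹ᵁ U)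
    (h' : U ≤ U') (a : Y.Fun U') :
    Hom.pull f U V h (Y.res h' a) =
      Hom.pull f U' V (h.trans (f.base.preimage_mono h')) a :=
  (Hom.pull_comp f (𝟙 Y) h' h (h.trans (f.base.preimage_mono h')) a).trans
    (Hom.pull_congr (Category.comp_id f) _ _ a)

theorem res_res (X : SuperScheme k) {U V W : X.even.Opens} (h : V ≤ U) (h' : W ≤ V)
    (a : X.Fun U) : X.res h' (X.res h a) = X.res (h'.trans h) a :=
  Hom.res_pull (𝟙 X) h h' a

theorem res_self (X : SuperScheme k) {U : X.even.Opens} (h : U ≤ U) (a : X.Fun U) :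
    X.res h a = a := by
  rw [res_apply]
  ext
  · have : (homOfLE h).op = 𝟙 (op U) := rfl
    simp only [this, X.even.presheaf.map_id]
    rfl
  · exact X.odd_map_self h _

/-- The canonical automorphism of a superscheme: the identity on the underlying space and on even
functions, and multiplication by `-1` on odd functions. In local coordinates `(z | ζ)` it is
`z ↦ z`, `ζ ↦ -ζ`. -/
def parityHom (X : SuperScheme k) : X ⟶ X where
  base := 𝟙 _
  base_toBase := Category.id_comp _
  odd U V h := -(X.odd.presheaf.map (homOfLE h).op).hom
  map_odd U V V' h h' x :=
    (map_neg (X.odd.presheaf.map (homOfLE h').op).hom _).trans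
      (congrArg Neg.neg (X.odd_map_map h h' x))
  odd_map U V V' h h' x := congrArg Neg.neg (X.odd_map_map _ _ _)
  odd_smul U V h r x :=
    (congrArg Neg.neg ((Hom.id X).odd_smul U V h r x)).trans (smul_neg _ _).symm
  odd_oddMul U V h x y := by
    refine Eq.trans ?_ ((Hom.id X).odd_oddMul U V h x y)
    change (X.oddMul V).mul (-(Hom.id X).odd U V h x) (-(Hom.id X).odd U V h y) = _
    rw [map_neg, map_neg, LinearMap.neg_apply, neg_neg]

theorem parityHom_comp_self (X : SuperScheme k) : X.parityHom ≫ X.parityHom = 𝟙 X :=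
  Hom.ext (Category.id_comp _) fun U V h h' x => by
    change -(X.odd.presheaf.map (homOfLE _).op (-(X.odd.presheaf.map (homOfLE _).op x))) =
      X.odd.presheaf.map (homOfLE _).op x
    rw [map_neg, neg_neg]
    exact X.odd_map_map le_rfl h' x

/-- The canonical (parity) automorphism `ζ ↦ -ζ`, as an element of the automorphism group. -/
def parityAut (X : SuperScheme k) : Aut X :=
  ⟨X.parityHom, X.parityHom, X.parityHom_comp_self, X.parityHom_comp_self⟩

/-! ### Bosonic reduction, genus, supercurves -/

/-- The ideal sheaf `(𝒪_X⁻)² ⊆ 𝒪_X⁺`, i.e. the even part of the ideal generated by `𝒪_X⁻`. -/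
def oddSq (X : SuperScheme k) : X.even.IdealSheafData :=
  Scheme.IdealSheafData.ofIdeals fun U =>
    Ideal.span {r | ∃ x y : Γ(X.odd, U.1), r = (X.oddMul U.1).mul x y}

/-- The bosonic reduction `X_bos = (X, 𝒪_X⁺ / (𝒪_X⁻)²)`. -/
def bos (X : SuperScheme k) : Scheme.{u} := X.oddSq.subscheme

/-- The structure sheaf of a scheme as a sheaf of abelian groups. -/
def structureAbSheaf (C : Scheme.{u}) :
    Sheaf (Opens.grothendieckTopology C) AddCommGrpCat.{u} :=
  (sheafCompose _ (forget₂ RingCat.{u} AddCommGrpCat.{u})).obj C.ringCatSheaf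

/-- `X` has genus zero: `H¹(X_bos, 𝒪_{X_bos}) = 0`. -/
def IsGenusZero (X : SuperScheme k) : Prop :=
  Subsingleton (Sheaf.H (structureAbSheaf X.bos) 1)

/-- A supercurve over `k`: a smooth proper connected superscheme of dimension `(1|1)`; smooth of
dimension `(1|1)` means that `Ω¹_X` is locally free of rank `(1|1)`. Superschemes being Noetherian,
`𝒪_X⁻` is required to be coherent. -/
structure IsSupercurve (X : SuperScheme k) : Prop where
  proper : IsProper X.toBase
  connected : ConnectedSpace X.even
  coherent : ∀ U : X.even.Opens, IsAffineOpen U → Module.Finite Γ(X.even, U) Γ(X.odd, U)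
  smooth : ∀ x : X.even, ∃ U : X.even.Opens, IsAffineOpen U ∧ x ∈ U ∧
    SuperRing.KaehlerFreeOneOne (X.const U) (X.oddMul U)

/-! ### Vector fields -/

/-- An additive endomorphism of the sheaf `𝒪_X|_U`. -/
@[ext]
structure SheafEnd (X : SuperScheme k) (U : X.even.Opens) where
  app : ∀ V : X.even.Opens, V ≤ U → (X.Fun V →+ X.Fun V)
  res_app : ∀ (V W : X.even.Opens) (hV : V ≤ U) (hW : W ≤ V) (a : X.Fun V),
    X.res hW (app V hV a) = app W (hW.trans hV) (X.res hW a)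

namespace SheafEnd

variable {X : SuperScheme k} {U : X.even.Opens}

instance : Zero (SheafEnd X U) := ⟨⟨fun _ _ => 0, by intros; simp⟩⟩
instance : Add (SheafEnd X U) :=
  ⟨fun δ ε => ⟨fun V h => δ.app V h + ε.app V h, by intros; simp [δ.res_app, ε.res_app]⟩⟩
instance : Neg (SheafEnd X U) :=
  ⟨fun δ => ⟨fun V h => -δ.app V h, by intros; simp [δ.res_app]⟩⟩

@[simp] theorem zero_app (V : X.even.Opens) (h : V ≤ U) : (0 : SheafEnd X U).app V h = 0 := rfl
@[simp] theorem add_app (δ ε : SheafEnd X U) (V : X.even.Opens) (h : V ≤ U) :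
    (δ + ε).app V h = δ.app V h + ε.app V h := rfl
@[simp] theorem neg_app (δ : SheafEnd X U) (V : X.even.Opens) (h : V ≤ U) :
    (-δ).app V h = -δ.app V h := rfl

instance : AddCommGroup (SheafEnd X U) where
  add_assoc a b c := by ext V h b : 4; simp [add_assoc]
  zero_add a := by ext V h b : 4; simp
  add_zero a := by ext V h b : 4; simp
  add_comm a b := by ext V h b : 4; simp [add_comm]
  neg_add_cancel a := by ext V h b : 4; simp
  nsmul := nsmulRec
  zsmul := zsmulRec

/-- The left `𝒪_X(U)`-module structure `(a δ)(b) = a δ(b)`. -/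
instance : SMul (X.Fun U) (SheafEnd X U) :=
  ⟨fun a δ => ⟨fun V h => (AddMonoidHom.mulLeft (X.res h a)).comp (δ.app V h), by
    intros; simp [δ.res_app, res_res]⟩⟩

@[simp] theorem smul_app (a : X.Fun U) (δ : SheafEnd X U) (V : X.even.Opens) (h : V ≤ U)
    (b : X.Fun V) : (a • δ).app V h b = X.res h a * δ.app V h b := rfl

instance : Module (X.Fun U) (SheafEnd X U) where
  one_smul δ := by ext V h b : 4; simp
  mul_smul a b δ := by ext V h c : 4; simp [mul_assoc]
  smul_zero a := by ext V h c : 4; simp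
  smul_add a δ ε := by ext V h c : 4; simp [mul_add]
  add_smul a b δ := by ext V h c : 4; simp [add_mul]
  zero_smul δ := by ext V h c : 4; simp

/-- Composition of endomorphisms. -/
def comp (δ ε : SheafEnd X U) : SheafEnd X U :=
  ⟨fun V h => (δ.app V h).comp (ε.app V h), by intros; simp [δ.res_app, ε.res_app]⟩

/-- Restriction to a smaller open set. -/
def restrict (δ : SheafEnd X U) {V : X.even.Opens} (h : V ≤ U) : SheafEnd X V :=
  ⟨fun W hW => δ.app W (hW.trans h), fun V' W hV hW a => δ.res_app V' W (hV.trans h) hW a⟩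

/-- `δ` is an even vector field: a parity preserving `k`-linear endomorphism with
`δ(ab) = δ(a) b + a δ(b)`. (Such an additive map is `k`-linear iff it kills the constants.) -/
structure IsEvenField (δ : SheafEnd X U) : Prop where
  const : ∀ V h (t : k), δ.app V h (SuperRing.ofEven _ (X.const V t)) = 0
  parity : ∀ V h (a : X.Fun V),
    δ.app V h (SuperRing.parity _ a) = SuperRing.parity _ (δ.app V h a)
  leibniz : ∀ V h (a b : X.Fun V), δ.app V h (a * b) = δ.app V h a * b + a * δ.app V h b

/-- `δ` is an odd vector field: a parity reversing `k`-linear endomorphism with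
`δ(ab) = δ(a) b + (-1)^{|a|} a δ(b)`. -/
structure IsOddField (δ : SheafEnd X U) : Prop where
  const : ∀ V h (t : k), δ.app V h (SuperRing.ofEven _ (X.const V t)) = 0
  parity : ∀ V h (a : X.Fun V),
    δ.app V h (SuperRing.parity _ a) = -SuperRing.parity _ (δ.app V h a)
  leibniz : ∀ V h (a b : X.Fun V),
    δ.app V h (a * b) = δ.app V h a * b + SuperRing.parity _ a * δ.app V h b

/-- The supercommutator `[δ, ε] = δ ε + ε δ` of two odd vector fields. -/
def oddBracket (δ ε : SheafEnd X U) : SheafEnd X U := comp δ ε + comp ε δ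

end SheafEnd

/-- The tangent sheaf `𝒯_X`: its sections over `U` are the vector fields on `U`, i.e. the sums of
an even and an odd vector field. -/
def tangent (X : SuperScheme k) (U : X.even.Opens) : Set (SheafEnd X U) :=
  {δ | ∃ δ₀ δ₁ : SheafEnd X U, δ₀.IsEvenField ∧ δ₁.IsOddField ∧ δ = δ₀ + δ₁}

/-- `(E, D)` is a frame of `𝒯_X` over `U`, with `E` even and `D` odd. -/
structure IsFrame (X : SuperScheme k) {U : X.even.Opens} (E D : SheafEnd X U) : Prop where
  even : E.IsEvenField
  odd : D.IsOddField
  basis : ∀ (V : X.even.Opens) (h : V ≤ U), ∀ δ ∈ X.tangent V,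
    ∃! p : X.Fun V × X.Fun V, δ = p.1 • E.restrict h + p.2 • D.restrict h

/-- A rank-`(0|1)` subbundle `𝒟 ⊆ 𝒯_X`: a subsheaf of `𝒪_X`-modules which is locally generated by
the odd member `D` of a frame `(E, D)` of `𝒯_X`. -/
structure OddDistribution (X : SuperScheme k) where
  /-- the sections of `𝒟` over `U` -/
  sections : ∀ U : X.even.Opens, Submodule (X.Fun U) (SheafEnd X U)
  le_tangent : ∀ U, ∀ δ ∈ sections U, δ ∈ X.tangent U
  restrict_mem : ∀ (U V : X.even.Opens) (h : V ≤ U), ∀ δ ∈ sections U, δ.restrict h ∈ sections V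
  mem_of_local : ∀ (U : X.even.Opens) (δ : SheafEnd X U), δ ∈ X.tangent U →
    (∀ x ∈ U, ∃ (V : X.even.Opens) (h : V ≤ U), x ∈ V ∧ δ.restrict h ∈ sections V) →
      δ ∈ sections U
  locally_generated : ∀ x : X.even, ∃ U : X.even.Opens, x ∈ U ∧ ∃ E D : SheafEnd X U,
    X.IsFrame E D ∧ ∀ (V : X.even.Opens) (h : V ≤ U),
      sections V = Submodule.span (X.Fun V) {D.restrict h}

/-- Transport of vector fields along an automorphism `φ`:
`φ^* δ = φ^# ∘ δ ∘ (φ^#)⁻¹` on `φ⁻¹(U)`. -/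
def pullField {X : SuperScheme k} (φ : Aut X) {U : X.even.Opens} (δ : SheafEnd X U) :
    SheafEnd X (φ.hom.base ⁻¹ᵁ U) where
  app W hW :=
    have e : φ.hom.base ⁻¹ᵁ (φ.inv.base ⁻¹ᵁ W) = W :=
      congrArg (fun f : X ⟶ X => f.base ⁻¹ᵁ W) φ.hom_inv_id
    have e' : φ.inv.base ⁻¹ᵁ (φ.hom.base ⁻¹ᵁ U) = U :=
      congrArg (fun f : X ⟶ X => f.base ⁻¹ᵁ U) φ.inv_hom_id
    ((Hom.pull φ.hom (φ.inv.base ⁻¹ᵁ W) W e.ge).toAddMonoidHom.comp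
      (δ.app (φ.inv.base ⁻¹ᵁ W) ((φ.inv.base.preimage_mono hW).trans e'.le))).comp
        (Hom.pull φ.inv W (φ.inv.base ⁻¹ᵁ W) le_rfl).toAddMonoidHom
  res_app V W hV hW a := by
    simp only [AddMonoidHom.comp_apply, RingHom.toAddMonoidHom_eq_coe, AddMonoidHom.coe_coe]
    rw [Hom.res_pull, Hom.pull_res, ← Hom.res_pull φ.inv le_rfl (φ.inv.base.preimage_mono hW),
      ← δ.res_app, Hom.pull_res]

/-- `𝒟` is preserved by the automorphism `φ`, i.e. `φ^* 𝒟 = 𝒟`. -/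
def OddDistribution.IsPreservedBy {X : SuperScheme k} (𝒟 : X.OddDistribution) (φ : Aut X) : Prop :=
  ∀ (U : X.even.Opens) (δ : SheafEnd X U),
    δ ∈ 𝒟.sections U ↔ pullField φ δ ∈ 𝒟.sections (φ.hom.base ⁻¹ᵁ U)

theorem OddDistribution.mem_congr {X : SuperScheme k} (𝒟 : X.OddDistribution)
    {U U' : X.even.Opens} (h : U = U') (δ : SheafEnd X U) (δ' : SheafEnd X U')
    (hd : ∀ V hV hV' a, δ.app V hV a = δ'.app V hV' a) :
    δ ∈ 𝒟.sections U ↔ δ' ∈ 𝒟.sections U' := by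
  subst h
  have : δ = δ' := by
    ext V hV a : 4
    exact hd V hV hV a
  rw [this]

theorem pullField_app {X : SuperScheme k} (φ : Aut X) {U : X.even.Opens} (δ : SheafEnd X U)
    (W : X.even.Opens) (hW : W ≤ φ.hom.base ⁻¹ᵁ U) (h₁ : W ≤ φ.hom.base ⁻¹ᵁ (φ.inv.base ⁻¹ᵁ W))
    (h₂ : φ.inv.base ⁻¹ᵁ W ≤ U) (a : X.Fun W) :
    (pullField φ δ).app W hW a = Hom.pull φ.hom (φ.inv.base ⁻¹ᵁ W) W h₁
      (δ.app (φ.inv.base ⁻¹ᵁ W) h₂ (Hom.pull φ.inv W (φ.inv.base ⁻¹ᵁ W) le_rfl a)) := rfl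

theorem preimage_hom_inv {X : SuperScheme k} (φ : Aut X) (W : X.even.Opens) :
    φ.hom.base ⁻¹ᵁ (φ.inv.base ⁻¹ᵁ W) = W :=
  congrArg (fun f : X ⟶ X => f.base ⁻¹ᵁ W) φ.hom_inv_id

theorem preimage_inv_hom {X : SuperScheme k} (φ : Aut X) (W : X.even.Opens) :
    φ.inv.base ⁻¹ᵁ (φ.hom.base ⁻¹ᵁ W) = W :=
  congrArg (fun f : X ⟶ X => f.base ⁻¹ᵁ W) φ.inv_hom_id

theorem pullField_mul {X : SuperScheme k} (φ ψ : Aut X) {U : X.even.Opens} (δ : SheafEnd X U) :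
    pullField (φ * ψ) δ = pullField ψ (pullField φ δ) := by
  ext W hW a : 4
  have e₁ := (preimage_hom_inv ψ W).ge
  have e₂ : ψ.inv.base ⁻¹ᵁ W ≤ φ.hom.base ⁻¹ᵁ U := by
    have := ψ.inv.base.preimage_mono hW
    exact this.trans (preimage_inv_hom ψ (φ.hom.base ⁻¹ᵁ U)).le
  have e₃ := (preimage_hom_inv φ (ψ.inv.base ⁻¹ᵁ W)).ge
  have e₄ : φ.inv.base ⁻¹ᵁ (ψ.inv.base ⁻¹ᵁ W) ≤ U :=
    (φ.inv.base.preimage_mono e₂).trans (preimage_inv_hom φ U).le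
  refine Eq.trans ?_ (pullField_app ψ (pullField φ δ) W hW e₁ e₂ a).symm
  rw [pullField_app φ δ _ _ e₃ e₄, Hom.pull_comp φ.inv, Hom.pull_comp ψ.hom]
  rfl

theorem OddDistribution.isPreservedBy_mul {X : SuperScheme k} {𝒟 : X.OddDistribution}
    {φ ψ : Aut X} (hφ : 𝒟.IsPreservedBy φ) (hψ : 𝒟.IsPreservedBy ψ) :
    𝒟.IsPreservedBy (φ * ψ) := fun U δ => by
  rw [hφ U δ, hψ _ (pullField φ δ), pullField_mul]
  rfl

theorem pullField_one_app {X : SuperScheme k} {U : X.even.Opens} (δ : SheafEnd X U)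
    (W : X.even.Opens) (hW hW') (a : X.Fun W) :
    (pullField (1 : Aut X) δ).app W hW a = δ.app W hW' a :=
  (X.res_self le_rfl _).trans (congrArg (δ.app W hW') (X.res_self le_rfl a))

theorem pullField_eq_one_app {X : SuperScheme k} {φ : Aut X} (hφ : φ = 1) {U : X.even.Opens}
    (δ : SheafEnd X U) (W : X.even.Opens) (hW hW') (a : X.Fun W) :
    (pullField φ δ).app W hW a = δ.app W hW' a := by
  subst hφ
  exact pullField_one_app δ W hW hW' a

theorem OddDistribution.isPreservedBy_one {X : SuperScheme k} (𝒟 : X.OddDistribution) :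
    𝒟.IsPreservedBy 1 := fun _ δ =>
  𝒟.mem_congr rfl _ _ fun W hW hW' a => (pullField_one_app δ W hW' hW a).symm

theorem OddDistribution.isPreservedBy_inv {X : SuperScheme k} {𝒟 : X.OddDistribution}
    {φ : Aut X} (hφ : 𝒟.IsPreservedBy φ) : 𝒟.IsPreservedBy φ⁻¹ := fun U δ => by
  rw [hφ _ (pullField φ⁻¹ δ)]
  exact 𝒟.mem_congr (preimage_hom_inv φ U).symm _ _ fun W hW hW' a =>
    (pullField_eq_one_app (inv_mul_cancel φ) δ W
      (hW.trans (preimage_hom_inv φ U).ge) hW a).symm.trans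
      (congrArg (fun ε : SheafEnd X _ => ε.app W hW' a) (pullField_mul φ⁻¹ φ δ))

end SuperScheme

/-! ## Super Riemann surfaces with Ramond punctures -/

/-- A super Riemann surface over an algebraically closed field `k` with `n` labelled Ramond
punctures: a supercurve `X`, an effective Cartier divisor `ℛ ⊂ X` of degree `n`, unramified over
`k`, with labelled components, and a rank-`(0|1)` subbundle `𝒟 ⊆ 𝒯_X` such that the supercommutator
induces an isomorphism `𝒟^{⊗2} ≅ (𝒯_X/𝒟)(-ℛ)` onto the submodule `(𝒯_X/𝒟)(-ℛ) ⊆ 𝒯_X/𝒟`. -/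
structure SuperRiemannSurface (k : Type u) [Field k] (n : ℕ) where
  /-- the underlying supercurve -/
  X : SuperScheme k
  isSupercurve : X.IsSupercurve
  /-- the ideal sheaf `𝒪_X(-ℛ)` of the Ramond divisor (its even part, which generates it) -/
  ramond : X.even.IdealSheafData
  /-- `ℛ` is an effective Cartier divisor: its ideal is locally generated by an even function that
  is not a zero divisor in `𝒪_X`. -/
  cartier : ∀ x : X.even, ∃ (U : X.even.Opens) (hU : IsAffineOpen U), x ∈ U ∧
    ∃ f : Γ(X.even, U), ramond.ideal ⟨U, hU⟩ = Ideal.span {f} ∧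
      (∀ r : Γ(X.even, U), f * r = 0 → r = 0) ∧ (∀ y : Γ(X.odd, U), f • y = 0 → y = 0)
  /-- `ℛ` is unramified: its bosonic reduction is unramified over `k`. -/
  unramified : FormallyUnramified ((ramond ⊔ X.oddSq).subschemeι ≫ X.toBase)
  /-- The components of `ℛ`, the Ramond punctures, labelled by `Fin n`. As `ℛ` is unramified over
  an algebraically closed field, its components are its points, each of multiplicity one, so that
  `ℛ` has degree `n`. -/
  puncture : Fin n → X.even
  puncture_injective : Function.Injective puncture
  range_puncture : Set.range puncture = (ramond.support : Set X.even)
  /-- the distribution `𝒟 ⊆ 𝒯_X` -/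
  distribution : X.OddDistribution
  /-- Let `(E, D)` be a local frame of `𝒯_X` with `D` generating `𝒟`, and `f` a local generator of
  `𝒪_X(-ℛ)`. Then `𝒟^{⊗2}` is free on `D ⊗ D` and `(𝒯_X/𝒟)(-ℛ)` is free on the class of `f E`;
  the supercommutator is an isomorphism between them iff `[D, D] ≡ u f E` modulo `𝒟` with an even
  unit `u`. -/
  commutator : ∀ x : X.even, ∃ (U : X.even.Opens) (hU : IsAffineOpen U), x ∈ U ∧
    ∃ E D : SuperScheme.SheafEnd X U, X.IsFrame E D ∧
      (∀ (V : X.even.Opens) (h : V ≤ U),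
        distribution.sections V = Submodule.span (X.Fun V) {D.restrict h}) ∧
      ∃ (f : Γ(X.even, U)) (u : Γ(X.even, U)ˣ), ramond.ideal ⟨U, hU⟩ = Ideal.span {f} ∧
        D.oddBracket D - SuperRing.ofEven (X.oddMul U) (u * f) • E ∈ distribution.sections U

namespace SuperRiemannSurface

variable {k : Type u} [Field k] {n : ℕ}

/-- The genus of a super Riemann surface is that of its bosonic reduction. -/
def IsGenusZero (S : SuperRiemannSurface k n) : Prop := S.X.IsGenusZero

/-- The automorphism group of a super Riemann surface `S`: the automorphisms of the underlying
supercurve over `k` which preserve the Ramond divisor with its labelling and the distribution. -/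
def autGroup (S : SuperRiemannSurface k n) : Subgroup (Aut S.X) where
  carrier := {φ | S.ramond.comap φ.hom.base = S.ramond ∧
    (∀ i, φ.hom.base (S.puncture i) = S.puncture i) ∧ S.distribution.IsPreservedBy φ}
  mul_mem' {φ ψ} hφ hψ := by
    refine ⟨?_, fun i => ?_, SuperScheme.OddDistribution.isPreservedBy_mul hφ.2.2 hψ.2.2⟩
    · change S.ramond.comap (ψ.hom.base ≫ φ.hom.base) = S.ramond
      rw [Scheme.IdealSheafData.comap_comp, hφ.1, hψ.1]
    · change (ψ.hom.base ≫ φ.hom.base) (S.puncture i) = S.puncture i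
      rw [Scheme.Hom.comp_apply, hψ.2.1, hφ.2.1]
  one_mem' := by
    refine ⟨?_, fun i => ?_, S.distribution.isPreservedBy_one⟩
    · exact Scheme.IdealSheafData.comap_id _
    · rfl
  inv_mem' {φ} hφ := by
    have e : φ.inv.base ≫ φ.hom.base = 𝟙 _ :=
      congrArg SuperScheme.Hom.base φ.inv_hom_id
    have e' : φ.hom.base ≫ φ.inv.base = 𝟙 _ :=
      congrArg SuperScheme.Hom.base φ.hom_inv_id
    refine ⟨?_, fun i => ?_, SuperScheme.OddDistribution.isPreservedBy_inv hφ.2.2⟩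
    · change S.ramond.comap φ.inv.base = S.ramond
      conv_lhs => rw [← hφ.1]
      rw [← Scheme.IdealSheafData.comap_comp, e, Scheme.IdealSheafData.comap_id]
    · change φ.inv.base (S.puncture i) = S.puncture i
      conv_lhs => rw [← hφ.2.1 i]
      rw [← Scheme.Hom.comp_apply, e']
      rfl

end SuperRiemannSurface

end

/-!
An automorphism of a genus zero super Riemann surface with at least three Ramond punctures is the
identity or the parity automorphism. The proof first shows that it is trivial on the underlying
curve, then that it acts on odd functions by a sign.

*The underlying curve.* As `Ω¹` is free of rank `(1|1)`, the odd functions are, locally, freely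
generated by one odd coordinate `ζ` (`SuperRing.KaehlerFreeOneOne.exists_basis`). Hence odd functions
multiply to zero and the bosonic reduction is the scheme `(X, 𝒪_X⁺)`. The differential dual to the
even basis element shows that its local rings at closed points are domains with principal maximal
ideal (`SuperRing.KaehlerFreeOneOne.isDomain_and_principal`), so the curve is integral.

That the curve is isomorphic to `ℙ¹` is not needed. Vanishing of `H¹(𝒪)` provides, for every closed
point `p`, a rational function with a simple pole at `p` and no other pole
(`SuperScheme.IsSupercurve.poleCurve`). If an automorphism fixes three points `p`, `q`, `r`, it fixes
the function with a simple pole at `p`, a zero at `q` and a given nonzero value at `r`. Such a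
function takes every value at most once, so the automorphism fixes all closed points
(`PoleCurve.perm_eq_self`) and is the identity (`SuperScheme.IsSupercurve.eq_id_of_fixed`). The
Ramond punctures are closed points fixed by the automorphisms in question.

*The odd functions.* An automorphism over the identity of `(X, 𝒪_X⁺)` maps `ζ` to `l ζ`. A local
generator of the distribution is `D = h ∂_ζ + d ζ`, with `h` an even function and `d` a derivation
of the even functions; preserving the distribution means that `(l⁻¹ h, l d)` is proportional to
`(h, d)`, that is, `l² = 1` where `h d ≠ 0`. The condition on `[D, D]`, whose action on even functions
is `2 h d`, gives `h d ≠ 0` generically (`SuperScheme.eq_or_neg_of_preserved`). So `l = ±1`, with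
the same sign everywhere, by irreducibility. Conversely, a distribution is locally generated by an
odd vector field, so it is preserved by the parity automorphism.
-/

noncomputable section

/-! ### Superalgebras with differentials free of rank `(1|1)` -/

namespace SuperRing

variable {R M : Type*} [CommRing R] [AddCommGroup M] [Module R M] {μ : OddMul R M}
  {k : Type*} [CommRing k] {c : k →+* R}

/-- The linear map on Kähler differentials induced by a superderivation. -/
theorem exists_kaehler_lift {N : Type*} [AddCommGroup N] [Module (SuperRing μ) N]
    (δ : SuperRing μ → N) (add : ∀ a b, δ (a + b) = δ a + δ b)
    (const : ∀ t, δ (ofEven μ (c t)) = 0)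
    (leibniz : ∀ a b, ((IsEven a ∧ IsEven b) ∨ (IsEven a ∧ IsOdd b) ∨ (IsOdd a ∧ IsEven b)) →
      δ (a * b) = a • δ b + b • δ a)
    (leibniz_odd : ∀ a b, IsOdd a → IsOdd b → δ (a * b) = a • δ b - b • δ a) :
    ∃ L : Kaehler c μ →ₗ[SuperRing μ] N, ∀ a, L (dif c μ a) = δ a := by
  refine ⟨(kaehlerRelations c μ).liftQ (Finsupp.linearCombination (SuperRing μ) δ) ?_, fun a => ?_⟩
  · refine Submodule.span_le.2 ?_
    rintro ω (((⟨a, b, rfl⟩ | ⟨t, rfl⟩) | ⟨a, b, h, rfl⟩) | ⟨a, b, ha, hb, rfl⟩)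
    · simp [add]
    · simp [const]
    · simp [leibniz a b h]
    · simp [leibniz_odd a b ha hb]
  · exact ((Finsupp.linearCombination_single _ _ _).trans (one_smul _ _) :
      Finsupp.linearCombination (SuperRing μ) δ (Finsupp.single a 1) = δ a)

theorem dif_add (a b : SuperRing μ) : dif c μ (a + b) = dif c μ a + dif c μ b := by
  rw [← sub_eq_zero, ← sub_sub]
  simp only [dif, ← map_sub]
  rw [Submodule.mkQ_apply, Submodule.Quotient.mk_eq_zero]
  exact Submodule.subset_span (.inl (.inl (.inl ⟨a, b, rfl⟩)))

theorem dif_const (t : k) : dif c μ (ofEven μ (c t)) = 0 := by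
  rw [dif, Submodule.mkQ_apply, Submodule.Quotient.mk_eq_zero]
  exact Submodule.subset_span (.inl (.inl (.inr ⟨t, rfl⟩)))

theorem dif_mul {a b : SuperRing μ}
    (h : (IsEven a ∧ IsEven b) ∨ (IsEven a ∧ IsOdd b) ∨ (IsOdd a ∧ IsEven b)) :
    dif c μ (a * b) = a • dif c μ b + b • dif c μ a := by
  rw [← sub_eq_zero, ← sub_sub]
  simp only [dif, ← map_smul, ← map_sub]
  rw [Submodule.mkQ_apply, Submodule.Quotient.mk_eq_zero]
  exact Submodule.subset_span (.inl (.inr ⟨a, b, h, rfl⟩))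

/-- The ideal of `R` generated by the products of odd elements. -/
def oddSqIdeal (μ : OddMul R M) : Ideal R :=
  Ideal.span {r | ∃ x y : M, r = μ.mul x y}

theorem oddSqIdeal_le_nilradical (μ : OddMul R M) : oddSqIdeal μ ≤ nilradical R := by
  refine Ideal.span_le.2 ?_
  rintro _ ⟨x, y, rfl⟩
  refine ⟨2, ?_⟩
  have h := μ.mul_smul x x y
  rw [μ.mul_self, zero_smul] at h
  rw [pow_two, ← smul_eq_mul, ← LinearMap.smul_apply, ← map_smul, ← h, map_zero,
    LinearMap.zero_apply]
  exact zero_mem _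

/-- Reduction modulo the products of odd elements kills the odd part, hence is a ring
homomorphism on the whole superring. -/
def toEvenQuot (μ : OddMul R M) : SuperRing μ →+* R ⧸ oddSqIdeal μ where
  toFun a := Ideal.Quotient.mk _ a.ev
  map_zero' := by simp
  map_one' := by simp
  map_add' a b := by simp
  map_mul' a b := by
    have : Ideal.Quotient.mk (oddSqIdeal μ) (μ.mul a.od b.od) = 0 :=
      Ideal.Quotient.eq_zero_iff_mem.2 (Ideal.subset_span ⟨_, _, rfl⟩)
    simp [this]

theorem eq_zero_of_mem_evenDifferentials {N : Type*} [AddCommGroup N] [Module (SuperRing μ) N]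
    (L : Kaehler c μ →ₗ[SuperRing μ] N)
    (h : ∀ a b : SuperRing μ, ((IsEven a ∧ IsEven b) ∨ (IsOdd a ∧ IsOdd b)) → a • L (dif c μ b) = 0)
    {ω : Kaehler c μ} (hω : ω ∈ evenDifferentials c μ) : L ω = 0 := by
  have : evenDifferentials c μ ≤ (AddMonoidHom.ker L.toAddMonoidHom) := by
    refine (AddSubgroup.closure_le _).2 ?_
    rintro _ ⟨a, b, hab, rfl⟩
    simpa using h a b hab
  exact this hω

theorem eq_zero_of_mem_oddDifferentials {N : Type*} [AddCommGroup N] [Module (SuperRing μ) N]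
    (L : Kaehler c μ →ₗ[SuperRing μ] N)
    (h : ∀ a b : SuperRing μ, ((IsEven a ∧ IsOdd b) ∨ (IsOdd a ∧ IsEven b)) → a • L (dif c μ b) = 0)
    {ω : Kaehler c μ} (hω : ω ∈ oddDifferentials c μ) : L ω = 0 := by
  have : oddDifferentials c μ ≤ (AddMonoidHom.ker L.toAddMonoidHom) := by
    refine (AddSubgroup.closure_le _).2 ?_
    rintro _ ⟨a, b, hab, rfl⟩
    simpa using h a b hab
  exact this hω

/-- The odd differential `e₁` generates the odd part modulo the products of odd elements:
`a ↦ a.od` is a superderivation into `M` modulo these products, and it kills `e₀`. -/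
theorem KaehlerFreeOneOne.exists_generator_mod (h : KaehlerFreeOneOne c μ) :
    ∃ ζ : M, ∀ x : M, ∃ r : R, x - r • ζ ∈ oddSqIdeal μ • (⊤ : Submodule R M) := by
  obtain ⟨e₀, he₀, e₁, he₁, hb⟩ := h
  let N := M ⧸ oddSqIdeal μ • (⊤ : Submodule R M)
  let q : M →ₗ[R] N := Submodule.mkQ _
  let : Module (SuperRing μ) N := Module.compHom N (toEvenQuot μ)
  have smul_def (a : SuperRing μ) (x : M) :
      a • q x = q (a.ev • x) := rfl
  obtain ⟨L, hL⟩ := exists_kaehler_lift (c := c) (N := N)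
    (fun a => q a.od) (fun a b => rfl) (fun t => rfl)
    (fun a b _ => by rw [smul_def, smul_def, mul_od, map_add])
    (fun a b ha hb => by
      rw [smul_def, smul_def, mul_od, ha, hb]
      simp)
  have h₀ : L e₀ = 0 := by
    refine eq_zero_of_mem_evenDifferentials L ?_ he₀
    rintro a b (⟨-, hb'⟩ | ⟨ha, -⟩)
    · rw [hL, smul_def, hb', smul_zero]; rfl
    · rw [hL, smul_def, ha, zero_smul]; rfl
  obtain ⟨ζ, hζ⟩ := Submodule.mkQ_surjective _ (L e₁)
  refine ⟨ζ, fun x => ?_⟩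
  obtain ⟨p, hp⟩ := hb.2 (dif c μ ⟨0, x⟩)
  refine ⟨p.2.ev, (Submodule.Quotient.eq _).1 ?_⟩
  have := congrArg L hp
  simp only [map_add, map_smul, h₀, smul_zero, zero_add, hL] at this
  change q x = q (p.2.ev • ζ)
  rw [← this, ← hζ, ← smul_def]

/-- A finite odd part is generated by one element, by Nakayama's lemma. -/
theorem KaehlerFreeOneOne.exists_generator (h : KaehlerFreeOneOne c μ) [Module.Finite R M] :
    ∃ ζ : M, ∀ x : M, ∃ r : R, x = r • ζ := by
  obtain ⟨ζ, hζ⟩ := h.exists_generator_mod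
  have key : (⊤ : Submodule R M) ≤ Submodule.span R {ζ} := by
    refine Submodule.le_of_le_smul_of_le_jacobson_bot (I := oddSqIdeal μ)
      Module.Finite.fg_top ?_ ?_
    · exact (oddSqIdeal_le_nilradical μ).trans
        ((nilradical_le_jacobson R).trans_eq Ideal.jacobson_bot.symm)
    · intro x _
      obtain ⟨r, hr⟩ := hζ x
      rw [← add_sub_cancel (r • ζ) x]
      exact Submodule.add_mem_sup (Submodule.smul_mem _ _ (Submodule.mem_span_singleton_self ζ)) hr
  refine ⟨ζ, fun x => ?_⟩
  obtain ⟨r, hr⟩ := Submodule.mem_span_singleton.1 (key (Submodule.mem_top (x := x)))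
  exact ⟨r, hr.symm⟩

/-- Odd elements multiply to zero, since the product is alternating and the odd part is cyclic. -/
theorem KaehlerFreeOneOne.mul_eq_zero (h : KaehlerFreeOneOne c μ) [Module.Finite R M] (x y : M) :
    μ.mul x y = 0 := by
  obtain ⟨ζ, hζ⟩ := h.exists_generator
  obtain ⟨r, rfl⟩ := hζ x
  obtain ⟨s, rfl⟩ := hζ y
  simp [μ.mul_self]

/-- The image of `e₀` generates the image of any derivation of the even part. -/
theorem KaehlerFreeOneOne.exists_derivation_generator (h : KaehlerFreeOneOne c μ)
    (hμ : ∀ x y, μ.mul x y = 0) {N : Type*} [AddCommGroup N] [Module R N] (δ : R → N)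
    (add : ∀ a b, δ (a + b) = δ a + δ b) (const : ∀ t, δ (c t) = 0)
    (leibniz : ∀ a b, δ (a * b) = a • δ b + b • δ a) :
    ∃ n : N, ∀ r, ∃ s : R, δ r = s • n := by
  obtain ⟨e₀, he₀, e₁, he₁, hb⟩ := h
  let ev : SuperRing μ →+* R :=
    { toFun := SuperRing.ev
      map_zero' := rfl
      map_one' := rfl
      map_add' := fun _ _ => rfl
      map_mul' := fun a b => by simp [hμ] }
  let : Module (SuperRing μ) N := Module.compHom N ev
  have smul_def (a : SuperRing μ) (x : N) : a • x = a.ev • x := rfl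
  have δ_zero : δ 0 = 0 := by simpa using add 0 0
  obtain ⟨L, hL⟩ := exists_kaehler_lift (μ := μ) (c := c) (N := N)
    (fun a => δ a.ev) (fun a b => add _ _) (fun t => const t)
    (fun a b _ => by simp only [smul_def, mul_ev, hμ, add_zero, leibniz])
    (fun a b ha hb => by
      simp only [smul_def]
      rw [mul_ev, ha, hb, hμ]
      simp [δ_zero])
  have h₁ : L e₁ = 0 := by
    refine eq_zero_of_mem_oddDifferentials L ?_ he₁
    rintro a b (⟨-, hb'⟩ | ⟨ha, -⟩)
    · rw [hL, smul_def, hb', δ_zero, smul_zero]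
    · rw [smul_def, ha, zero_smul]
  refine ⟨L e₀, fun r => ?_⟩
  obtain ⟨p, hp⟩ := hb.2 (dif c μ ⟨r, 0⟩)
  refine ⟨p.1.ev, ?_⟩
  have := congrArg L hp
  simp only [map_add, map_smul, h₁, smul_zero, add_zero, hL] at this
  rw [← this, smul_def]

/-- If odd elements multiply to zero, the terms `a db` with `a` odd do not contribute to the even
component of a linear functional on differentials. -/
theorem ev_mem_span_of_closure (hμ : ∀ x y, μ.mul x y = 0)
    (L : Kaehler c μ →ₗ[SuperRing μ] SuperRing μ) {S : Set R}
    {P : SuperRing μ → SuperRing μ → Prop}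
    (hP : ∀ a b, P a b → IsOdd a ∨ (L (dif c μ b)).ev ∈ S) {ω : Kaehler c μ}
    (hω : ω ∈ AddSubgroup.closure {ω | ∃ a b : SuperRing μ, P a b ∧ ω = a • dif c μ b}) :
    (L ω).ev ∈ Ideal.span S := by
  induction hω using AddSubgroup.closure_induction with
  | mem ω h =>
    obtain ⟨a, b, hab, rfl⟩ := h
    rw [map_smul, smul_eq_mul, mul_ev, hμ, add_zero]
    rcases hP a b hab with ha | hb
    · rw [ha, zero_mul]; exact zero_mem _
    · exact Ideal.mul_mem_left _ _ (Ideal.subset_span hb)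
  | zero => simp
  | add x y _ _ hx hy => rw [map_add, add_ev]; exact add_mem hx hy
  | neg x _ hx => rw [map_neg, neg_ev]; exact neg_mem hx

/-- The coordinates with respect to the basis `(e₀, e₁)` are linear. -/
theorem exists_coordinates {e₀ e₁ : Kaehler c μ}
    (hb : Function.Bijective fun p : SuperRing μ × SuperRing μ => p.1 • e₀ + p.2 • e₁) :
    ∃ L₀ L₁ : Kaehler c μ →ₗ[SuperRing μ] SuperRing μ, L₀ e₀ = 1 ∧ L₁ e₁ = 1 := by
  let F : (SuperRing μ × SuperRing μ) →ₗ[SuperRing μ] Kaehler c μ :=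
    (LinearMap.toSpanSingleton _ _ e₀).coprod (LinearMap.toSpanSingleton _ _ e₁)
  have hF : Function.Bijective F := hb
  let G := LinearEquiv.ofBijective F hF
  have h₀ : G.symm e₀ = (1, 0) := G.symm_apply_eq.2 (by simp [G, F])
  have h₁ : G.symm e₁ = (0, 1) := G.symm_apply_eq.2 (by simp [G, F])
  exact ⟨LinearMap.fst _ _ _ ∘ₗ G.symm.toLinearMap, LinearMap.snd _ _ _ ∘ₗ G.symm.toLinearMap,
    by simp [h₀], by simp [h₁]⟩

/-- The derivation of the even part dual to `e₀`. Its values generate the unit ideal because it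
takes the value `1` on `e₀`. -/
theorem KaehlerFreeOneOne.exists_derivation (h : KaehlerFreeOneOne c μ)
    (hμ : ∀ x y, μ.mul x y = 0) :
    ∃ δ : R → R, (∀ a b, δ (a + b) = δ a + δ b) ∧ (∀ t, δ (c t) = 0) ∧
      (∀ a b, δ (a * b) = a * δ b + b * δ a) ∧ (1 : R) ∈ Ideal.span (Set.range δ) := by
  obtain ⟨e₀, he₀, e₁, he₁, hb⟩ := h
  obtain ⟨L, -, hL, -⟩ := exists_coordinates hb
  refine ⟨fun r => (L (dif c μ ⟨r, 0⟩)).ev, fun a b => ?_, fun t => ?_, fun a b => ?_, ?_⟩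
  · rw [← add_ev, ← map_add, ← dif_add]
    exact congrArg (fun x => (L (dif c μ x)).ev) (SuperRing.ext rfl (add_zero 0).symm)
  · have := dif_const (μ := μ) (c := c) t
    change (L (dif c μ (ofEven μ (c t)))).ev = 0
    rw [this, map_zero, zero_ev]
  · have h := dif_mul (c := c) (a := (⟨a, 0⟩ : SuperRing μ)) (b := ⟨b, 0⟩) (.inl ⟨rfl, rfl⟩)
    have e : (⟨a * b, 0⟩ : SuperRing μ) = ⟨a, 0⟩ * ⟨b, 0⟩ := by ext <;> simp
    simp [e, h]
  · have := ev_mem_span_of_closure hμ L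
      (S := Set.range fun r => (L (dif c μ ⟨r, 0⟩)).ev)
      (P := fun a b => (IsEven a ∧ IsEven b) ∨ (IsOdd a ∧ IsOdd b)) (fun a b hab => ?_) he₀
    · rwa [hL, one_ev] at this
    · rcases hab with ⟨-, hb'⟩ | ⟨ha, -⟩
      · exact .inr ⟨b.ev, by rw [show b = ⟨b.ev, 0⟩ from SuperRing.ext rfl hb']⟩
      · exact .inl ha

/-- The functional on the odd part dual to `e₁`. Its values generate the unit ideal because it
takes the value `1` on `e₁`. -/
theorem KaehlerFreeOneOne.exists_functional (h : KaehlerFreeOneOne c μ)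
    (hμ : ∀ x y, μ.mul x y = 0) :
    ∃ D : M → R, (∀ (r : R) x, D (r • x) = r * D x) ∧ (1 : R) ∈ Ideal.span (Set.range D) := by
  obtain ⟨e₀, he₀, e₁, he₁, hb⟩ := h
  obtain ⟨-, L, -, hL⟩ := exists_coordinates hb
  refine ⟨fun x => (L (dif c μ ⟨0, x⟩)).ev, fun r x => ?_, ?_⟩
  · have h := dif_mul (c := c) (a := (⟨r, 0⟩ : SuperRing μ)) (b := ⟨0, x⟩) (.inr (.inl ⟨rfl, rfl⟩))
    have e : (⟨0, r • x⟩ : SuperRing μ) = ⟨r, 0⟩ * ⟨0, x⟩ := by ext <;> simp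
    simp [e, h, hμ]
  · have := ev_mem_span_of_closure hμ L
      (S := Set.range fun x => (L (dif c μ ⟨0, x⟩)).ev)
      (P := fun a b => (IsEven a ∧ IsOdd b) ∨ (IsOdd a ∧ IsEven b)) (fun a b hab => ?_) he₁
    · rwa [hL, one_ev] at this
    · rcases hab with ⟨-, hb'⟩ | ⟨ha, -⟩
      · exact .inr ⟨b.od, by rw [show b = ⟨0, b.od⟩ from SuperRing.ext hb' rfl]⟩
      · exact .inl ha

/-- The odd part is free of rank one over the even part: the functional dual to `e₁` takes a unit
value at a generator. -/
theorem KaehlerFreeOneOne.exists_basis (h : KaehlerFreeOneOne c μ) [Module.Finite R M] :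
    ∃ ζ : M, Function.Bijective fun r : R => r • ζ := by
  obtain ⟨ζ, hζ⟩ := h.exists_generator
  obtain ⟨D, hD, h1⟩ := h.exists_functional h.mul_eq_zero
  have hu : IsUnit (D ζ) := by
    rw [← Ideal.span_singleton_eq_top, Ideal.eq_top_iff_one]
    refine Ideal.span_le.2 ?_ h1
    rintro _ ⟨x, rfl⟩
    obtain ⟨r, rfl⟩ := hζ x
    rw [hD]
    exact Ideal.mul_mem_left _ _ (Ideal.mem_span_singleton_self _)
  refine ⟨ζ, fun r s hrs => ?_, fun x => ?_⟩
  · have := congrArg D hrs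
    simp only [hD] at this
    exact hu.mul_left_injective this
  · obtain ⟨r, hr⟩ := hζ x
    exact ⟨r, hr.symm⟩

end SuperRing

/-! ### Local rings with principal maximal ideal -/

/-- By Krull's intersection theorem every nonzero element is a unit times a power of `t`. -/
theorem isDomain_of_maximalIdeal_eq_span {A : Type*} [CommRing A] [IsLocalRing A]
    [IsNoetherianRing A] {t : A} (ht : IsLocalRing.maximalIdeal A = Ideal.span {t})
    (hn : ¬ IsNilpotent t) : IsDomain A := by
  have key (a : A) (ha : a ≠ 0) : ∃ n : ℕ, ∃ u : A, IsUnit u ∧ a = u * t ^ n := by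
    have h : ∃ n : ℕ, a ∉ IsLocalRing.maximalIdeal A ^ n := by
      by_contra! h
      have := Ideal.iInf_pow_eq_bot_of_isLocalRing (IsLocalRing.maximalIdeal A)
        (Ideal.IsPrime.ne_top inferInstance)
      exact ha (by rw [← Ideal.mem_bot, ← this]; exact (Ideal.mem_iInf).2 h)
    classical
    obtain ⟨n, hn⟩ : ∃ n, Nat.find h = n + 1 :=
      Nat.exists_eq_succ_of_ne_zero fun h0 => by simpa [h0] using Nat.find_spec h
    have h₁ := Nat.find_spec h
    have h₂ := Nat.find_min h (m := n) (by omega)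
    rw [hn] at h₁
    rw [not_not, ht, Ideal.span_singleton_pow, Ideal.mem_span_singleton'] at h₂
    obtain ⟨u, rfl⟩ := h₂
    refine ⟨n, u, ?_, rfl⟩
    by_contra hu
    have hu : u ∈ IsLocalRing.maximalIdeal A := hu
    refine h₁ ?_
    rw [pow_succ']
    refine Ideal.mul_mem_mul hu ?_
    rw [ht, Ideal.span_singleton_pow]
    exact Ideal.mem_span_singleton_self _
  have : NoZeroDivisors A := ⟨fun {a b} hab => by
    by_contra! h
    obtain ⟨n, u, hu, rfl⟩ := key a h.1
    obtain ⟨m, v, hv, rfl⟩ := key b h.2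
    refine hn ⟨n + m, (hu.mul hv).mul_right_eq_zero.1 ?_⟩
    rw [← hab]; ring⟩
  exact NoZeroDivisors.to_isDomain A

namespace SuperRing

variable {R M : Type*} [CommRing R] [AddCommGroup M] [Module R M] {μ : OddMul R M}
  {k : Type*} [Field k] {c : k →+* R}

/-- At a rational prime ideal `m`, the maximal ideal of the local ring is generated by one
element `t`, because the differentials of `R` are cyclic. The derivation dual to `e₀` takes a unit
value at `t`; so in characteristic zero `t` is not nilpotent and the local ring is a domain. -/
theorem KaehlerFreeOneOne.isDomain_and_principal [CharZero k] [IsNoetherianRing R]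
    (h : KaehlerFreeOneOne c μ) (hμ : ∀ x y, μ.mul x y = 0) (m : Ideal R) [m.IsPrime]
    (hm : ∀ r, ∃ s, r - c s ∈ m) (A : Type*) [CommRing A] [Algebra R A] [IsLocalization.AtPrime A m]
    [IsLocalRing A] :
    IsDomain A ∧ ∃ t : A, t ≠ 0 ∧ IsLocalRing.maximalIdeal A = Ideal.span {t} := by
  have hmap : IsLocalRing.maximalIdeal A = m.map (algebraMap R A) :=
    (IsLocalization.AtPrime.map_eq_maximalIdeal m A).symm
  have hinj (s : k) (hs : c s ∈ m) : s = 0 := by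
    by_contra h0
    exact (Ideal.IsPrime.ne_top (I := m) inferInstance)
      (Ideal.eq_top_of_isUnit_mem _ hs ((isUnit_iff_ne_zero.2 h0).map c))
  choose χ hχ using hm
  have huniq (r : R) (s : k) (hs : r - c s ∈ m) : χ r = s := by
    rw [← sub_eq_zero]
    refine hinj _ ?_
    rw [map_sub]
    convert sub_mem hs (hχ r) using 1
    ring
  -- The derivation `r ↦ r - r(m)` into the cotangent space generates it.
  obtain ⟨n, hn⟩ := h.exists_derivation_generator hμ (N := m.Cotangent)
    (fun r => m.toCotangent ⟨r - c (χ r), hχ r⟩)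
    (fun a b => by
      rw [← map_add]
      congr 1
      ext
      have : χ (a + b) = χ a + χ b := huniq _ _ (by
        rw [map_add]; convert add_mem (hχ a) (hχ b) using 1; ring)
      simp only [this, map_add, Submodule.coe_add]
      ring)
    (fun t => by
      rw [← map_zero m.toCotangent]
      congr 1
      ext
      have : χ (c t) = t := huniq _ _ (by rw [sub_self]; exact zero_mem _)
      simp [this])
    (fun a b => by
      rw [← map_smul, ← map_smul, ← map_add, Ideal.toCotangent_eq]
      have : χ (a * b) = χ a * χ b := huniq _ _ (by
        rw [map_mul]
        convert add_mem (m.mul_mem_left a (hχ b)) (m.mul_mem_right (c (χ b)) (hχ a)) using 1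
        ring)
      have h2 := neg_mem (Ideal.mul_mem_mul (hχ a) (hχ b))
      rw [← pow_two] at h2
      convert h2 using 1
      simp only [this, map_mul, Submodule.coe_add, Submodule.coe_smul, smul_eq_mul]
      ring)
  obtain ⟨⟨t, htm⟩, rfl⟩ := m.toCotangent_surjective n
  have ht (x : R) (hx : x ∈ m) : ∃ s, x - s * t ∈ m ^ 2 := by
    obtain ⟨s, hs⟩ := hn x
    rw [← map_smul, Ideal.toCotangent_eq] at hs
    have : χ x = 0 := huniq _ _ (by simpa using hx)
    exact ⟨s, by simpa [this] using hs⟩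
  obtain ⟨δ₀, hadd, hconst, hleib, hone⟩ := h.exists_derivation hμ
  let δ : Derivation ℤ R R := Derivation.mk' (AddMonoidHom.mk' δ₀ hadd).toIntLinearMap hleib
  have hδ (r : R) : δ r = δ₀ r := rfl
  have hδ2 (y : R) (hy : y ∈ m ^ 2) : δ y ∈ m := by
    rw [pow_two] at hy
    induction hy using Submodule.mul_induction_on' with
    | mem_mul_mem a ha b hb =>
      rw [δ.leibniz]
      exact add_mem (m.mul_mem_right _ ha) (m.mul_mem_right _ hb)
    | add x _ y _ hx hy => rw [map_add]; exact add_mem hx hy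
  -- If `δ t ∈ m`, then `δ` maps all of `R` into `m`, since `R = k + R t + m²`.
  have hδt : δ t ∉ m := by
    intro hc
    refine Ideal.IsPrime.ne_top (I := m) inferInstance ((Ideal.eq_top_iff_one _).2 ?_)
    refine Ideal.span_le.2 ?_ hone
    rintro _ ⟨b, rfl⟩
    obtain ⟨s, hs⟩ := ht _ (hχ b)
    have h1 := hδ2 _ hs
    rw [map_sub, map_sub, hδ (c _), hconst, sub_zero, δ.leibniz] at h1
    have h2 : s • δ t + t • δ s ∈ m := add_mem (m.mul_mem_left _ hc) (m.mul_mem_right _ htm)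
    have := add_mem h1 h2
    rwa [sub_add_cancel] at this
  have hcast (i : ℕ) : ((i + 1 : ℕ) : R) ∉ m := by
    intro hc
    rw [← map_natCast c] at hc
    exact Nat.cast_ne_zero.2 (Nat.succ_ne_zero i) (hinj _ hc)
  -- If `s t ^ (i + 1) = 0`, then `s² (i + 1) δ(t) t ^ i = 0`, where `(i + 1) δ(t) ∉ m`.
  have hpow (i : ℕ) : ∀ s ∉ m, s * t ^ i ≠ 0 := by
    induction i with
    | zero => rintro s hs h0; exact hs (by rw [pow_zero, mul_one] at h0; rw [h0]; exact zero_mem _)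
    | succ i ih =>
      intro s hs h0
      refine ih (s * (s * ((i + 1 : ℕ) * δ t))) ?_ ?_
      · have hp : m.IsPrime := inferInstance
        intro hc
        rcases hp.mem_or_mem hc with hc | hc
        · exact hs hc
        rcases hp.mem_or_mem hc with hc | hc
        · exact hs hc
        rcases hp.mem_or_mem hc with hc | hc
        · exact hcast i hc
        · exact hδt hc
      · have h1 := congrArg (fun x => s * δ x) h0
        simp only [δ.leibniz, δ.leibniz_pow, map_zero, mul_zero, smul_eq_mul, nsmul_eq_mul,
          Nat.add_sub_cancel] at h1
        linear_combination h1 - δ s * h0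
  have hnil : ¬ IsNilpotent (algebraMap R A t) := by
    rintro ⟨i, hi⟩
    rw [← map_pow, IsLocalization.map_eq_zero_iff m.primeCompl] at hi
    obtain ⟨⟨s, hs⟩, hs'⟩ := hi
    exact hpow i s hs hs'
  have : IsNoetherianRing A := IsLocalization.isNoetherianRing m.primeCompl A inferInstance
  -- Nakayama's lemma for the maximal ideal of `A`.
  have hspan : IsLocalRing.maximalIdeal A = Ideal.span {algebraMap R A t} := by
    refine le_antisymm ?_ ?_
    · refine Submodule.le_of_le_smul_of_le_jacobson_bot (I := IsLocalRing.maximalIdeal A)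
        (IsNoetherian.noetherian _) (IsLocalRing.jacobson_eq_maximalIdeal _ bot_ne_top).ge ?_
      rw [smul_eq_mul]
      conv_lhs => rw [hmap]
      refine Ideal.map_le_iff_le_comap.2 fun x hx => ?_
      obtain ⟨s, hs⟩ := ht x hx
      have := Ideal.mem_map_of_mem (algebraMap R A) hs
      rw [Ideal.map_pow, ← hmap, pow_two] at this
      rw [Ideal.mem_comap, ← add_sub_cancel (algebraMap R A (s * t)) (algebraMap R A x), ← map_sub]
      refine Submodule.add_mem_sup ?_ this
      rw [map_mul]
      exact Ideal.mul_mem_left _ _ (Ideal.mem_span_singleton_self _)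
    · rw [Ideal.span_singleton_le_iff_mem, hmap]
      exact Ideal.mem_map_of_mem _ htm
  exact ⟨isDomain_of_maximalIdeal_eq_span hspan hnil, _, fun h0 => hnil (by rw [h0]; exact .zero),
    hspan⟩

end SuperRing

/-! ### Function fields with simple poles at single points -/

/-- The birational data of a complete curve on which every point carries a function with a simple
pole there and no other pole: a field `K` over `k` and, for each point `p` in `P`, the subring
`O p` of functions regular at `p` with a uniformizer `t p` and residue field `k`, such that the
functions regular everywhere are the constants. -/
structure PoleCurve {k K : Type*} [Field k] [Field K] (c : k →+* K) (P : Type*) where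
  /-- the functions regular at a point -/
  O : P → Subring K
  /-- a uniformizer at a point -/
  t : P → K
  const_mem : ∀ p s, c s ∈ O p
  t_mem : ∀ p, t p ∈ O p
  t_ne_zero : ∀ p, t p ≠ 0
  not_unit : ∀ p, ∀ y ∈ O p, t p * y ≠ 1
  residue : ∀ p, ∀ x ∈ O p, ∃ s, ∃ y ∈ O p, x - c s = t p * y
  global : ∀ x, (∀ p, x ∈ O p) → ∃ s, x = c s
  pole : ∀ p, ∃ f, (∀ q, q ≠ p → f ∈ O q) ∧ ∃ y ∈ O p, t p * f - 1 = t p * y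

namespace PoleCurve

variable {k K P : Type*} [Field k] [Field K] {c : k →+* K} (C : PoleCurve c P)

/-- `x` is regular at `p` and vanishes there. -/
def Vanish (p : P) (x : K) : Prop := ∃ y ∈ C.O p, x = C.t p * y

variable {C} {p q r : P} {x y : K}

theorem Vanish.mem (h : C.Vanish p x) : x ∈ C.O p := by
  obtain ⟨y, hy, rfl⟩ := h
  exact mul_mem (C.t_mem p) hy

theorem Vanish.add (h : C.Vanish p x) (h' : C.Vanish p y) : C.Vanish p (x + y) := by
  obtain ⟨a, ha, rfl⟩ := h
  obtain ⟨b, hb, rfl⟩ := h'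
  exact ⟨a + b, add_mem ha hb, by ring⟩

theorem Vanish.mul_right (h : C.Vanish p x) (hy : y ∈ C.O p) : C.Vanish p (x * y) := by
  obtain ⟨a, ha, rfl⟩ := h
  exact ⟨a * y, mul_mem ha hy, by ring⟩

theorem Vanish.neg (h : C.Vanish p x) : C.Vanish p (-x) := by
  obtain ⟨a, ha, rfl⟩ := h
  exact ⟨-a, neg_mem ha, by ring⟩

theorem Vanish.sub (h : C.Vanish p x) (h' : C.Vanish p y) : C.Vanish p (x - y) := by
  rw [sub_eq_add_neg]; exact h.add h'.neg

theorem Vanish.const {s : k} (h : C.Vanish p (c s)) : s = 0 := by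
  by_contra hs
  obtain ⟨a, ha, h⟩ := h
  refine C.not_unit p (a * c s⁻¹) (mul_mem ha (C.const_mem p _)) ?_
  rw [← mul_assoc, ← h, ← map_mul, mul_inv_cancel₀ hs, map_one]

theorem exists_vanish_sub (hx : x ∈ C.O p) : ∃ s, C.Vanish p (x - c s) := C.residue p x hx

/-- `f` has a simple pole at `p` (with residue normalized by the uniformizer) and is regular
elsewhere. -/
def HasPole (C : PoleCurve c P) (p : P) (f : K) : Prop :=
  (∀ q, q ≠ p → f ∈ C.O q) ∧ C.Vanish p (C.t p * f - 1)

theorem exists_hasPole (C : PoleCurve c P) (p : P) : ∃ f, C.HasPole p f := C.pole p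

theorem HasPole.sub_const {f : K} (hf : C.HasPole p f) (s : k) : C.HasPole p (f - c s) := by
  refine ⟨fun q hq => sub_mem (hf.1 q hq) (C.const_mem q s), ?_⟩
  have : C.Vanish p (C.t p * c s) := ⟨c s, C.const_mem p s, rfl⟩
  convert hf.2.sub this using 1
  ring

theorem HasPole.not_mem {f : K} (hf : C.HasPole p f) : f ∉ C.O p := by
  intro h
  have h1 : C.Vanish p (C.t p * f) := ⟨f, h, rfl⟩
  have : C.Vanish p (c 1) := by
    convert h1.sub hf.2 using 1
    rw [map_one]; ring
  exact one_ne_zero this.const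

theorem HasPole.uniformizer_mul_mem {f : K} (hf : C.HasPole p f) : C.t p * f ∈ C.O p := by
  rw [← sub_add_cancel (C.t p * f) 1]
  exact add_mem hf.2.mem (one_mem _)

theorem HasPole.ne_zero {f : K} (hf : C.HasPole p f) : f ≠ 0 := by
  rintro rfl
  exact hf.not_mem (zero_mem _)

/-- A function with a simple pole at `p` has at most one zero: if it vanishes at `x`, take `g`
with a simple pole at `x` and a zero at `p`; the product `F g` has no poles, so it is a nonzero
constant, and `F` vanishes at no further point. -/
theorem HasPole.not_vanish {F : K} {x y : P} (hF : C.HasPole p F) (hx : C.Vanish x F)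
    (hyx : y ≠ x) (hyp : y ≠ p) : ¬ C.Vanish y F := by
  intro hy
  have hxp : x ≠ p := by rintro rfl; exact hF.not_mem hx.mem
  obtain ⟨g, hg⟩ := C.exists_hasPole x
  obtain ⟨s, hs⟩ := exists_vanish_sub (hg.1 p hxp.symm)
  replace hg := hg.sub_const s
  set G := g - c s
  obtain ⟨e, he⟩ := C.global (F * G) fun q => by
    by_cases hqp : q = p
    · subst hqp
      obtain ⟨b, hb, hb'⟩ := hs
      rw [hb', show F * (C.t q * b) = C.t q * F * b by ring]
      exact mul_mem hF.uniformizer_mul_mem hb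
    by_cases hqx : q = x
    · subst hqx
      obtain ⟨b, hb, hb'⟩ := hx
      rw [hb', show C.t q * b * G = C.t q * G * b by ring]
      exact mul_mem hg.uniformizer_mul_mem hb
    exact mul_mem (hF.1 q hqp) (hg.1 q hqx)
  have h1 := hy.mul_right (hg.1 y hyx)
  rw [he] at h1
  rw [h1.const, map_zero] at he
  exact (mul_ne_zero hF.ne_zero hg.ne_zero) he

/-- An automorphism of the function field compatible with a permutation `σ` of the points fixes
every point as soon as it fixes three: fixing `p`, `q`, `r`, it fixes the function with a simple
pole at `p`, a zero at `q` and a given value at `r`, and this function separates the points. -/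
theorem perm_eq_self (C : PoleCurve c P) (σ : P → P) (hσ : Function.Injective σ)
    (s s' : K →+* K) (hs' : ∀ x, s (s' x) = x) (hsc : ∀ a, s (c a) = c a)
    (hO : ∀ q, ∀ x ∈ C.O (σ q), s x ∈ C.O q)
    (hM : ∀ q, C.Vanish q (s (C.t (σ q)))) (hM' : ∀ q, C.Vanish (σ q) (s' (C.t q)))
    {p q r : P} (hpq : p ≠ q) (hpr : p ≠ r) (hqr : q ≠ r) (hp : σ p = p) (hq : σ q = q)
    (hr : σ r = r) (y : P) : σ y = y := by
  have hV (q : P) (x : K) (hx : C.Vanish (σ q) x) : C.Vanish q (s x) := by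
    obtain ⟨a, ha, rfl⟩ := hx
    rw [map_mul]
    exact (hM q).mul_right (hO q a ha)
  obtain ⟨f, hf⟩ := C.exists_hasPole p
  obtain ⟨b, hb⟩ := exists_vanish_sub (hf.1 q hpq.symm)
  replace hf := hf.sub_const b
  set F := f - c b
  -- `s F` again has at most a simple pole at `p`, so `s F = a F + d` with constants `a`, `d`.
  have h1 : C.t p * s F ∈ C.O p := by
    obtain ⟨w, hw, hw'⟩ := hM' p
    rw [hp] at hw hw'
    have : C.t p = s (C.t p) * s w := by rw [← map_mul, ← hw', hs']
    rw [this, mul_right_comm, ← map_mul]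
    refine mul_mem (hO p _ ?_) (hO p _ ?_)
    · rw [hp]; exact hf.uniformizer_mul_mem
    · rwa [hp]
  obtain ⟨a, ha⟩ := exists_vanish_sub h1
  obtain ⟨d, hd⟩ := C.global (s F - c a * F) fun x => by
    by_cases hx : x = p
    · subst hx
      have h2 := ha.sub (hf.2.mul_right (C.const_mem x a))
      obtain ⟨w, hw, hw'⟩ := h2
      have : C.t x * (s F - c a * F) = C.t x * w := by rw [← hw']; ring
      rwa [mul_left_cancel₀ (C.t_ne_zero x) this]
    · refine sub_mem (hO x _ (hf.1 _ fun h => hx (hσ (h.trans hp.symm)))) ?_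
      exact mul_mem (C.const_mem x a) (hf.1 x hx)
  -- Both `F` and `s F` vanish at `q`, so `d = 0`.
  have hsF : s F = c a * F := by
    have h2 : C.Vanish q (s F) := hV q F (by rwa [hq])
    have h3 : C.Vanish q (F * c a) := hb.mul_right (C.const_mem q a)
    have h4 := h2.sub h3
    rw [mul_comm F, hd] at h4
    rwa [h4.const, map_zero, sub_eq_zero] at hd
  -- Both take the same nonzero value `e` at `r`, so `a = 1`.
  have hsF' : s F = F := by
    obtain ⟨e, he⟩ := exists_vanish_sub (hf.1 r hpr.symm)
    have he0 : e ≠ 0 := by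
      rintro rfl
      rw [map_zero, sub_zero] at he
      exact hf.not_vanish hb hqr.symm hpr.symm he
    have h2 : C.Vanish r (s (F - c e)) := hV r _ (by rwa [hr])
    rw [map_sub, hsc, hsF] at h2
    have h3 := h2.sub (he.mul_right (C.const_mem r a))
    have h4 : C.Vanish r (c ((a - 1) * e)) := by
      convert h3 using 1
      rw [map_mul, map_sub, map_one]; ring
    have h5 := (mul_eq_zero.1 h4.const).resolve_right he0
    rw [hsF, sub_eq_zero.1 h5, map_one, one_mul]
  by_cases hyp : y = p
  · rw [hyp, hp]
  -- As `s F = F`, the function `F` takes the same value at `y` and at `σ y`.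
  have hx : σ y ≠ p := fun h => hyp (hσ (h.trans hp.symm))
  obtain ⟨e, he⟩ := exists_vanish_sub (hf.1 (σ y) hx)
  have h2 := hV y _ he
  rw [map_sub, hsc, hsF'] at h2
  by_contra hne
  exact (hf.sub_const e).not_vanish he (fun h => hne h.symm) hyp h2

end PoleCurve

/-! ### Splitting functions on overlaps -/

/-- The free abelian presheaf on the terminal object is constant. Cohomology is defined as `Ext`
groups out of the constant sheaf, the Mayer–Vietoris sequence in terms of free sheaves. -/
def freeYonedaTopIso (T : Type u) [TopologicalSpace T] :
    (Functor.const (Opens T)ᵒᵖ).obj (AddCommGrpCat.of (ULift.{u} ℤ)) ≅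
      yoneda.obj (⊤ : Opens T) ⋙ AddCommGrpCat.free :=
  let i (U : (Opens T)ᵒᵖ) : U.unop ⟶ (⊤ : Opens T) := homOfLE le_top
  NatIso.ofComponents (fun U =>
    (AddEquiv.ulift.trans
      (haveI : Unique (U.unop ⟶ (⊤ : Opens T)) := ⟨⟨i U⟩, fun _ => Subsingleton.elim _ _⟩
       (FreeAbelianGroup.uniqueEquiv (U.unop ⟶ (⊤ : Opens T))).symm)).toAddCommGrpIso)
    (fun {U V} f => by
      ext x
      have h : (AddCommGrpCat.free.map ((yoneda.obj (⊤ : Opens T)).map f)).hom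
          (x.down • FreeAbelianGroup.of (i U)) = x.down • FreeAbelianGroup.of (i V) := by
        exact (map_zsmul (FreeAbelianGroup.map _) _ _).trans
          (congrArg (x.down • ·) (FreeAbelianGroup.map_of_apply _))
      exact h.symm)

namespace CategoryTheory.Sheaf

variable {C : Type u} [Category.{u} C] {J : GrothendieckTopology C}
  [HasSheafify J AddCommGrpCat.{u}] (F : CategoryTheory.Sheaf J AddCommGrpCat.{u})

/-- The free abelian sheaf on the sheaf represented by `U`. -/
abbrev freeSheafOn (J : GrothendieckTopology C) [HasSheafify J AddCommGrpCat.{u}] (U : C) :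
    CategoryTheory.Sheaf J AddCommGrpCat.{u} :=
  (presheafToSheaf J AddCommGrpCat.{u}).obj (yoneda.obj U ⋙ AddCommGrpCat.free)

/-- The section over `U` given by a map out of the free abelian sheaf on `U`. -/
def sectionOf {U : C} (φ : freeSheafOn J U ⟶ F) : F.obj.obj (op U) :=
  (((sheafificationAdjunction J AddCommGrpCat.{u}).homEquiv _ _ φ).app (op U)).hom
    (FreeAbelianGroup.of (𝟙 U))

theorem sectionOf_surjective {U : C} (s : F.obj.obj (op U)) :
    ∃ φ : freeSheafOn J U ⟶ F, sectionOf F φ = s := by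
  let g : yoneda.obj U ⟶ F.obj ⋙ forget AddCommGrpCat.{u} :=
    (yonedaEquiv (F := F.obj ⋙ forget AddCommGrpCat.{u})).symm s
  let ψ : yoneda.obj U ⋙ AddCommGrpCat.free ⟶ F.obj :=
    ((AddCommGrpCat.adj.whiskerRight Cᵒᵖ).homEquiv _ _).symm g
  refine ⟨((sheafificationAdjunction J AddCommGrpCat.{u}).homEquiv _ _).symm ψ, ?_⟩
  rw [sectionOf, Equiv.apply_symm_apply]
  have h : (AddCommGrpCat.adj.whiskerRight Cᵒᵖ).homEquiv _ _ ψ = g := Equiv.apply_symm_apply _ _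
  have h2 : yonedaEquiv (F := F.obj ⋙ forget AddCommGrpCat.{u}) g = s :=
    (yonedaEquiv (F := F.obj ⋙ forget AddCommGrpCat.{u})).apply_symm_apply s
  rw [← h] at h2
  exact h2

theorem sectionOf_add {U : C} (φ ψ : freeSheafOn J U ⟶ F) :
    sectionOf F (φ + ψ) = sectionOf F φ + sectionOf F ψ := by
  simp only [sectionOf, Adjunction.homEquiv_unit, Functor.map_add, Preadditive.comp_add]
  rfl

theorem sectionOf_neg {U : C} (φ : freeSheafOn J U ⟶ F) :
    sectionOf F (-φ) = - sectionOf F φ := by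
  simp only [sectionOf, Adjunction.homEquiv_unit, Functor.map_neg, Preadditive.comp_neg]
  rfl

theorem sectionOf_comp {U V : C} (f : V ⟶ U) (φ : freeSheafOn J U ⟶ F) :
    sectionOf F ((presheafToSheaf J AddCommGrpCat.{u}).map
      (Functor.whiskerRight (yoneda.map f) AddCommGrpCat.free) ≫ φ) =
      F.obj.map f.op (sectionOf F φ) := by
  simp only [sectionOf]
  rw [Adjunction.homEquiv_naturality_left]
  generalize (sheafificationAdjunction J AddCommGrpCat.{u}).homEquiv _ _ φ = ψ
  have h := congrArg (fun g => g.hom (FreeAbelianGroup.of (𝟙 U))) (ψ.naturality f.op)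
  refine Eq.trans ?_ h
  refine congrArg (ψ.app (op V)).hom ?_
  refine (FreeAbelianGroup.map_of_apply _).trans
    (Eq.trans ?_ (FreeAbelianGroup.map_of_apply _).symm)
  exact congrArg _ (by simp)

theorem biprod_lift_neg_comp {A : Type*} [Category A] [Preadditive A] {W X Y Z : A}
    [Limits.HasBinaryBiproduct X Y] (a : W ⟶ X) (b : W ⟶ Y) (ψ : X ⊞ Y ⟶ Z) :
    Limits.biprod.lift a (-b) ≫ ψ = a ≫ Limits.biprod.inl ≫ ψ - b ≫ Limits.biprod.inr ≫ ψ := by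
  rw [Limits.biprod.lift_eq]
  simp [sub_eq_add_neg]

theorem sectionOf_shortComplex_f_comp [HasWeakSheafify J (Type u)] (S : J.MayerVietorisSquare)
    (ψ : S.shortComplex.X₂ ⟶ F) :
    sectionOf F (U := S.X₁) (S.shortComplex.f ≫ ψ) =
      F.obj.map S.f₁₂.op (sectionOf F (U := S.X₂) (Limits.biprod.inl ≫ ψ)) -
      F.obj.map S.f₁₃.op (sectionOf F (U := S.X₃) (Limits.biprod.inr ≫ ψ)) := by
  rw [← sectionOf_comp, ← sectionOf_comp, sub_eq_add_neg, ← sectionOf_neg, ← sectionOf_add]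
  refine congrArg (sectionOf F) ?_
  rw [← sub_eq_add_neg]
  exact biprod_lift_neg_comp _ _ ψ

end CategoryTheory.Sheaf

/-- The beginning of the Mayer–Vietoris sequence: if `H¹(T, F) = 0`, then a section over `U ∩ V` is
a difference of sections over `U` and `V`, where `U ∪ V = T`. -/
theorem exists_sub_eq_of_subsingleton_H_one {T : Type u} [TopologicalSpace T]
    (F : Sheaf (Opens.grothendieckTopology T) AddCommGrpCat.{u}) (hF : Subsingleton (Sheaf.H F 1))
    (U V : Opens T) (hUV : U ⊔ V = ⊤) (s : F.obj.obj (op (U ⊓ V))) :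
    ∃ (a : F.obj.obj (op U)) (b : F.obj.obj (op V)),
      s = F.obj.map (homOfLE inf_le_left).op a - F.obj.map (homOfLE inf_le_right).op b := by
  let S := Opens.mayerVietorisSquare' (T := T)
    { X₁ := U ⊓ V
      X₂ := U
      X₃ := V
      X₄ := ⊤
      f₁₂ := homOfLE inf_le_left
      f₁₃ := homOfLE inf_le_right
      f₂₄ := homOfLE le_top
      f₃₄ := homOfLE le_top
      fac := Subsingleton.elim _ _ } hUV.symm rfl
  have e : (constantSheaf (Opens.grothendieckTopology T) AddCommGrpCat.{u}).obj
      (AddCommGrpCat.of (ULift ℤ)) ≅ S.shortComplex.X₃ :=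
    (presheafToSheaf _ _).mapIso (freeYonedaTopIso T)
  obtain ⟨φ, rfl⟩ := Sheaf.sectionOf_surjective F s
  -- The connecting homomorphism sends `φ` to a class in `H¹(T, F)`.
  have hz : S.shortComplex_shortExact.extClass.comp (Abelian.Ext.mk₀ φ) rfl = 0 := by
    generalize S.shortComplex_shortExact.extClass.comp (Abelian.Ext.mk₀ φ) rfl = x
    have h0 : (Abelian.Ext.mk₀ e.hom).comp x (zero_add 1) = 0 := Subsingleton.elim _ _
    have := congrArg (fun y => (Abelian.Ext.mk₀ e.inv).comp y (zero_add 1)) h0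
    simpa using this
  obtain ⟨x₂, hx₂⟩ := Abelian.Ext.contravariant_sequence_exact₁ S.shortComplex_shortExact F
    (Abelian.Ext.mk₀ φ) rfl hz
  obtain ⟨ψ, rfl⟩ := (Abelian.Ext.mk₀_bijective _ _).2 x₂
  rw [Abelian.Ext.mk₀_comp_mk₀] at hx₂
  have hφ := (Abelian.Ext.mk₀_bijective _ _).1 hx₂
  exact ⟨_, _, (congrArg (Sheaf.sectionOf F (U := U ⊓ V)) hφ).symm.trans
    (Sheaf.sectionOf_shortComplex_f_comp F S ψ)⟩

/-! ### Sections of quasi-coherent modules over basic open sets -/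

namespace AlgebraicGeometry.IsAffineOpen

variable {X : Scheme.{u}} {U : X.Opens}

theorem fromSpec_image_le (hU : IsAffineOpen U) (V : (Spec Γ(X, U)).Opens) : hU.fromSpec ''ᵁ V ≤ U :=
  (Scheme.Hom.image_le_opensRange _ _).trans hU.opensRange_fromSpec.le

theorem fromSpec_appIso_inv (hU : IsAffineOpen U) (V : (Spec Γ(X, U)).Opens) :
    (Scheme.ΓSpecIso Γ(X, U)).inv ≫ (Spec Γ(X, U)).presheaf.map V.leTop.op ≫
      (hU.fromSpec.appIso V).inv = X.presheaf.map (homOfLE (hU.fromSpec_image_le V)).op := by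
  rw [← Scheme.Hom.appLE_appIso_inv hU.fromSpec (U := U) (V := V)
    (by rw [hU.fromSpec_preimage_self]; exact le_top)]
  rw [Scheme.Hom.appLE, hU.fromSpec_app_self]
  simp only [Category.assoc, ← Functor.map_comp_assoc]
  rfl

variable (M : X.Modules)

theorem smul_restrict_fromSpec (hU : IsAffineOpen U) (V : (Spec Γ(X, U)).Opens) (r : Γ(X, U))
    (x : Γ(M.restrict hU.fromSpec, V)) :
    (M.restrictAppIso hU.fromSpec V).hom (r • x) =
      X.presheaf.map (homOfLE (hU.fromSpec_image_le V)).op r •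
        (M.restrictAppIso hU.fromSpec V).hom x := by
  rw [Scheme.Modules.smul_Spec_def, Scheme.Modules.smul_restrictAppIso_hom_apply,
    ← hU.fromSpec_appIso_inv]
  rfl

variable [hM : SheafOfModules.IsQuasicoherent (R := X.ringCatSheaf) M]

theorem isLocalizing_restrict (hU : IsAffineOpen U) (f : Γ(X, U)) :
    IsLocalizedModule (.powers f) ((modulesSpecToSheaf.obj (M.restrict hU.fromSpec)).obj.map
      (PrimeSpectrum.basicOpen f).leTop.op).hom := by
  have h1 : (M.restrict hU.fromSpec).IsQuasicoherent :=
    Scheme.Modules.isQuasicoherent_restrictFunctor hU.fromSpec M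
  have h2 : IsIso (M.restrict hU.fromSpec).fromTildeΓ :=
    Scheme.Modules.isIso_fromTildeΓ_of_isQuasicoherent _
  exact (isIso_fromTildeΓ_iff_isLocalizing _).1 h2 f

/-- A section over an affine open vanishing on `D(f)` is killed by a power of `f`. -/
theorem exists_pow_smul_eq_zero (hU : IsAffineOpen U) (f : Γ(X, U)) (t : Γ(M, U))
    (ht : M.presheaf.map (homOfLE (X.basicOpen_le f)).op t = 0) : ∃ n : ℕ, f ^ n • t = 0 := by
  have hloc := hU.isLocalizing_restrict M f
  let t' : Γ(M.restrict hU.fromSpec, ⊤) :=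
    (M.restrictAppIso hU.fromSpec ⊤).inv (M.presheaf.map (homOfLE (hU.fromSpec_image_le ⊤)).op t)
  have h0 : ((modulesSpecToSheaf.obj (M.restrict hU.fromSpec)).obj.map
      (PrimeSpectrum.basicOpen f).leTop.op).hom t' = 0 := by
    have h1 : M.presheaf.map (homOfLE ((hU.fromSpec_image_basicOpen f).le.trans
        (X.basicOpen_le f))).op t = 0 := by
      rw [← homOfLE_comp (hU.fromSpec_image_basicOpen f).le (X.basicOpen_le f), op_comp,
        M.presheaf.map_comp_apply, ht, map_zero]
    refine Eq.trans ?_ h1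
    change M.presheaf.map _ (M.presheaf.map _ t) = _
    rw [← M.presheaf.map_comp_apply]
    rfl
  obtain ⟨⟨_, n, rfl⟩, hn⟩ := (IsLocalizedModule.eq_zero_iff (.powers f) _).1 h0
  have hn' : f ^ n • t' = 0 := hn
  refine ⟨n, ?_⟩
  have h2 := congrArg (M.restrictAppIso hU.fromSpec ⊤).hom hn'
  rw [hU.smul_restrict_fromSpec, map_zero, Iso.inv_hom_id_apply, ← Scheme.Modules.map_smul] at h2
  have hle : U ≤ hU.fromSpec ''ᵁ ⊤ :=
    (hU.opensRange_fromSpec.symm.trans (Scheme.Hom.image_top_eq_opensRange _).symm).le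
  have h3 := congrArg (M.presheaf.map (homOfLE hle).op) h2
  rw [← M.presheaf.map_comp_apply, map_zero, ← op_comp, homOfLE_comp] at h3
  exact (congrArg (fun φ => φ (f ^ n • t)) (M.presheaf.map_id (op U))).symm.trans h3

/-- Up to a power of `f`, a section over `D(f)` extends to the affine open. -/
theorem exists_pow_smul_eq_map (hU : IsAffineOpen U) (f : Γ(X, U)) (s : Γ(M, X.basicOpen f)) :
    ∃ (n : ℕ) (t : Γ(M, U)), M.presheaf.map (homOfLE (X.basicOpen_le f)).op t =
      X.presheaf.map (homOfLE (X.basicOpen_le f)).op f ^ n • s := by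
  have hloc := hU.isLocalizing_restrict M f
  have hle : U ≤ hU.fromSpec ''ᵁ ⊤ :=
    (hU.opensRange_fromSpec.symm.trans (Scheme.Hom.image_top_eq_opensRange _).symm).le
  have hle' : X.basicOpen f ≤ hU.fromSpec ''ᵁ PrimeSpectrum.basicOpen f :=
    (hU.fromSpec_image_basicOpen f).ge
  let V : (Spec Γ(X, U)).Opens := PrimeSpectrum.basicOpen f
  let s' : Γ(M.restrict hU.fromSpec, V) :=
    (M.restrictAppIso hU.fromSpec _).inv
      (M.presheaf.map (homOfLE (hU.fromSpec_image_basicOpen f).le).op s)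
  obtain ⟨⟨t', ⟨_, n, rfl⟩⟩, hn⟩ := hloc.surj s'
  have hn' : f ^ n • s' = (M.restrict hU.fromSpec).presheaf.map
      (PrimeSpectrum.basicOpen f).leTop.op t' := hn
  refine ⟨n, M.presheaf.map (homOfLE hle).op ((M.restrictAppIso hU.fromSpec ⊤).hom t'), ?_⟩
  have h2 := congrArg (M.restrictAppIso hU.fromSpec _).hom hn'
  rw [hU.smul_restrict_fromSpec, Iso.inv_hom_id_apply] at h2
  have h3 := congrArg (M.presheaf.map (homOfLE hle').op) h2
  rw [Scheme.Modules.map_smul, ← M.presheaf.map_comp_apply, ← CommRingCat.comp_apply,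
    ← Functor.map_comp, ← op_comp, ← op_comp, homOfLE_comp, homOfLE_comp] at h3
  rw [← map_pow]
  have h4 : M.presheaf.map (homOfLE (hle'.trans (hU.fromSpec_image_basicOpen f).le)).op s = s :=
    congrArg (fun φ => φ s) (M.presheaf.map_id (op (X.basicOpen f)))
  rw [h4] at h3
  refine Eq.trans ?_ h3.symm
  rw [← M.presheaf.map_comp_apply]
  exact M.presheaf.map_comp_apply ((hU.fromSpec.opensFunctor.map
    (PrimeSpectrum.basicOpen f).leTop).op) (homOfLE hle').op
    ((M.restrictAppIso hU.fromSpec ⊤).hom t')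

end AlgebraicGeometry.IsAffineOpen

/-! ### Local structure of supercurves -/

namespace SuperScheme

variable {k : Type u} [Field k] {X : SuperScheme k}

/-- Restriction of odd functions. -/
abbrev oddRes (X : SuperScheme k) {U V : X.even.Opens} (h : V ≤ U) : Γ(X.odd, U) →+ Γ(X.odd, V) :=
  (X.odd.presheaf.map (homOfLE h).op).hom

/-- Restriction of even functions. -/
abbrev evenRes (X : SuperScheme k) {U V : X.even.Opens} (h : V ≤ U) :
    Γ(X.even, U) →+* Γ(X.even, V) :=
  (X.even.presheaf.map (homOfLE h).op).hom

theorem evenRes_evenRes {U V W : X.even.Opens} (h : V ≤ U) (h' : W ≤ V) (a : Γ(X.even, U)) :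
    X.evenRes h' (X.evenRes h a) = X.evenRes (h'.trans h) a := by
  change X.even.presheaf.map _ (X.even.presheaf.map _ a) = _
  rw [← CommRingCat.comp_apply, ← Functor.map_comp]
  rfl

theorem oddRes_oddRes {U V W : X.even.Opens} (h : V ≤ U) (h' : W ≤ V) (a : Γ(X.odd, U)) :
    X.oddRes h' (X.oddRes h a) = X.oddRes (h'.trans h) a :=
  X.odd_map_map h h' a

theorem oddRes_smul {U V : X.even.Opens} (h : V ≤ U) (r : Γ(X.even, U)) (a : Γ(X.odd, U)) :
    X.oddRes h (r • a) = X.evenRes h r • X.oddRes h a :=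
  Scheme.Modules.map_smul X.odd _ _ _

/-- Even functions agreeing near every point agree. -/
theorem even_ext {U : X.even.Opens} {a b : Γ(X.even, U)}
    (h : ∀ x ∈ U, ∃ (V : X.even.Opens) (hV : V ≤ U), x ∈ V ∧ X.evenRes hV a = X.evenRes hV b) :
    a = b := by
  choose V hV hx e using fun x : U => h x.1 x.2
  refine TopCat.Sheaf.eq_of_locally_eq' X.even.sheaf V U (fun i => homOfLE (hV i)) ?_ a b e
  exact fun x hxU => Opens.mem_iSup.2 ⟨⟨x, hxU⟩, hx _⟩

/-- Odd functions agreeing near every point agree. -/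
theorem odd_ext {U : X.even.Opens} {a b : Γ(X.odd, U)}
    (h : ∀ x ∈ U, ∃ (V : X.even.Opens) (hV : V ≤ U), x ∈ V ∧ X.oddRes hV a = X.oddRes hV b) :
    a = b := by
  choose V hV hx e using fun x : U => h x.1 x.2
  refine TopCat.Sheaf.eq_of_locally_eq' ⟨_, X.odd.isSheaf⟩ V U (fun i => homOfLE (hV i)) ?_ a b e
  exact fun x hxU => Opens.mem_iSup.2 ⟨⟨x, hxU⟩, hx _⟩

/-- `ζ` is an odd coordinate on `W`: on every open subset of `W`, the odd functions are freely
generated by `ζ` over the even functions. -/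
def IsOddCoord (X : SuperScheme k) {W : X.even.Opens} (ζ : Γ(X.odd, W)) : Prop :=
  ∀ (V : X.even.Opens) (h : V ≤ W),
    Function.Bijective fun r : Γ(X.even, V) => r • X.oddRes h ζ

theorem IsOddCoord.res {W V : X.even.Opens} {ζ : Γ(X.odd, W)} (hζ : X.IsOddCoord ζ) (h : V ≤ W) :
    X.IsOddCoord (X.oddRes h ζ) := fun V' h' => by
  simp only [oddRes_oddRes]
  exact hζ V' (h'.trans h)

/-- A basis of the odd functions on an affine open set remains one on basic open sets. -/
theorem bijective_smul_basicOpen {U : X.even.Opens} (hU : IsAffineOpen U) {ζ : Γ(X.odd, U)}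
    (hζ : Function.Bijective fun r : Γ(X.even, U) => r • ζ) (g : Γ(X.even, U)) :
    Function.Bijective fun r : Γ(X.even, X.even.basicOpen g) =>
      r • X.oddRes (X.even.basicOpen_le g) ζ := by
  have hqc := X.isQuasicoherent
  have hloc := hU.isLocalization_basicOpen g
  have hle := X.even.basicOpen_le g
  have hu : IsUnit (X.evenRes hle g) := IsLocalization.Away.algebraMap_isUnit (S := _) g
  constructor
  · refine (injective_iff_map_eq_zero (AddMonoidHom.mk'
      (fun r => r • X.oddRes hle ζ) fun a b => add_smul a b _)).2 fun a ha => ?_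
    replace ha : a • X.oddRes hle ζ = 0 := ha
    obtain ⟨n, r, hr⟩ := IsLocalization.Away.surj g a
    replace hr : a * X.evenRes hle g ^ n = X.evenRes hle r := hr
    obtain ⟨m, hm⟩ := hU.exists_pow_smul_eq_zero X.odd g (r • ζ) (by
      change X.oddRes hle (r • ζ) = 0
      rw [oddRes_smul, ← hr, mul_comm, mul_smul, ha, smul_zero])
    rw [← mul_smul] at hm
    have h0 : g ^ m * r = 0 := hζ.1 (hm.trans (zero_smul _ _).symm)
    have h1 := congrArg (X.evenRes hle) h0
    rw [map_mul, map_pow, map_zero, ← hr] at h1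
    have h2 := (hu.pow m).mul_right_eq_zero.1 h1
    exact (hu.pow n).mul_left_eq_zero.1 h2
  · intro s
    obtain ⟨n, t, ht⟩ := hU.exists_pow_smul_eq_map X.odd g s
    obtain ⟨r, rfl⟩ := hζ.2 t
    replace ht : X.oddRes hle (r • ζ) = X.evenRes hle g ^ n • s := ht
    obtain ⟨v, hv⟩ := hu.pow n
    refine ⟨(v⁻¹ : _ˣ).1 * X.evenRes hle r, ?_⟩
    simp only [mul_smul]
    rw [← oddRes_smul, ht, ← hv, ← mul_smul, Units.inv_mul, one_smul]

theorem isOddCoord_of_bijective {U : X.even.Opens} (hU : IsAffineOpen U) {ζ : Γ(X.odd, U)}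
    (hζ : Function.Bijective fun r : Γ(X.even, U) => r • ζ) : X.IsOddCoord ζ := by
  have hinj (V : X.even.Opens) (h : V ≤ U) :
      Function.Injective fun r : Γ(X.even, V) => r • X.oddRes h ζ := by
    intro a b hab
    refine even_ext fun x hx => ?_
    obtain ⟨g, hg, hxg⟩ := hU.exists_basicOpen_le ⟨x, hx⟩ (h hx)
    refine ⟨_, hg, hxg, (bijective_smul_basicOpen hU hζ g).1 ?_⟩
    have := congrArg (X.oddRes hg) hab
    simpa only [oddRes_smul, oddRes_oddRes] using this
  refine fun V h => ⟨hinj V h, fun s => ?_⟩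
  let ι := {g : Γ(X.even, U) // X.even.basicOpen g ≤ V}
  choose a ha using fun i : ι => (bijective_smul_basicOpen hU hζ i.1).2 (X.oddRes i.2 s)
  obtain ⟨b, hb⟩ : ∃ b : Γ(X.even, V), ∀ i : ι, X.evenRes i.2 b = a i :=
    (X.even.sheaf.existsUnique_gluing' (fun i : ι => X.even.basicOpen i.1) V
    (fun i => homOfLE i.2) (fun x hx => by
      obtain ⟨g, hg, hxg⟩ := hU.exists_basicOpen_le ⟨x, hx⟩ (h hx)
      exact Opens.mem_iSup.2 ⟨⟨g, hg⟩, hxg⟩) a (fun i j => by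
      apply hinj _ (inf_le_left.trans (X.even.basicOpen_le i.1))
      have h1 := congrArg (X.oddRes (inf_le_left : X.even.basicOpen i.1 ⊓ X.even.basicOpen j.1 ≤ _))
        (ha i)
      have h2 := congrArg (X.oddRes (inf_le_right : X.even.basicOpen i.1 ⊓ X.even.basicOpen j.1 ≤ _))
        (ha j)
      simp only [oddRes_smul, oddRes_oddRes] at h1 h2
      exact h1.trans h2.symm)).exists
  refine ⟨b, odd_ext fun x hx => ?_⟩
  obtain ⟨g, hg, hxg⟩ := hU.exists_basicOpen_le ⟨x, hx⟩ (h hx)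
  refine ⟨_, hg, hxg, ?_⟩
  simp only [oddRes_smul, oddRes_oddRes]
  rw [hb ⟨g, hg⟩]
  exact ha ⟨g, hg⟩

/-- A supercurve has an odd coordinate near every point. -/
theorem IsSupercurve.exists_isOddCoord (hX : X.IsSupercurve) (x : X.even) :
    ∃ (W : X.even.Opens) (_ : IsAffineOpen W) (ζ : Γ(X.odd, W)), x ∈ W ∧ X.IsOddCoord ζ ∧
      SuperRing.KaehlerFreeOneOne (X.const W) (X.oddMul W) := by
  obtain ⟨U, hU, hx, h⟩ := hX.smooth x
  have := hX.coherent U hU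
  obtain ⟨ζ, hζ⟩ := h.exists_basis
  exact ⟨U, hU, ζ, hx, isOddCoord_of_bijective hU hζ, h⟩

theorem IsSupercurve.oddMul_eq_zero (hX : X.IsSupercurve) (V : X.even.Opens) (a b : Γ(X.odd, V)) :
    (X.oddMul V).mul a b = 0 := by
  refine even_ext fun x hx => ?_
  obtain ⟨W, -, ζ, hxW, hζ, -⟩ := hX.exists_isOddCoord x
  refine ⟨V ⊓ W, inf_le_left, ⟨hx, hxW⟩, ?_⟩
  obtain ⟨r, hr⟩ := (hζ _ inf_le_right).2 (X.oddRes (inf_le_left : V ⊓ W ≤ V) a)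
  obtain ⟨s, hs⟩ := (hζ _ inf_le_right).2 (X.oddRes (inf_le_left : V ⊓ W ≤ V) b)
  have h := X.map_oddMul V (V ⊓ W) inf_le_left a b
  rw [map_zero]
  refine h.symm.trans ?_
  change (X.oddMul _).mul (X.oddRes inf_le_left a) (X.oddRes inf_le_left b) = 0
  rw [← hr, ← hs]
  simp [OddMul.mul_self]

theorem IsSupercurve.oddSq_eq_bot (hX : X.IsSupercurve) : X.oddSq = ⊥ := by
  rw [eq_bot_iff]
  intro U
  refine (Scheme.IdealSheafData.ideal_ofIdeals_le _ U).trans ?_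
  refine Ideal.span_le.2 ?_
  rintro _ ⟨a, b, rfl⟩
  rw [hX.oddMul_eq_zero]
  exact zero_mem _

theorem IsSupercurve.isIso_subschemeι (hX : X.IsSupercurve) : IsIso X.oddSq.subschemeι :=
  (Scheme.isIso_subschemeι_iff_eq_bot _).2 hX.oddSq_eq_bot

end SuperScheme

/-! ### Integrality of the even part -/

theorem isClosed_singleton_of_mem_of_finite {T : Type*} [TopologicalSpace T] [JacobsonSpace T]
    {Z : Set T} (hZ : IsClosed Z) (hf : Z.Finite) {x : T} (hx : x ∈ Z) : IsClosed {x} := by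
  have h : closure (Z ∩ closedPoints T) = Z := closure_inter_closedPoints hZ
  have h' : IsClosed (Z ∩ closedPoints T) := by
    rw [← Set.biUnion_of_singleton (Z ∩ closedPoints T)]
    exact (hf.subset Set.inter_subset_left).isClosed_biUnion fun y hy => hy.2
  rw [h'.closure_eq] at h
  rw [← h] at hx
  exact hx.2

/-- The closure of one of the irreducible open sets is open, hence everything. -/
theorem irreducibleSpace_of_forall_exists_isOpen {T : Type*} [TopologicalSpace T]
    [ConnectedSpace T]
    (h : ∀ x : T, ∃ U : Set T, IsOpen U ∧ x ∈ U ∧ IsPreirreducible U) : IrreducibleSpace T := by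
  obtain ⟨x⟩ := (inferInstance : Nonempty T)
  obtain ⟨U, hU, hxU, hirr⟩ := h x
  have hcl : IsOpen (closure U) := by
    refine isOpen_iff_mem_nhds.2 fun y hy => ?_
    obtain ⟨V, hV, hyV, hirrV⟩ := h y
    have : (V ∩ U).Nonempty := mem_closure_iff.1 hy V hV hyV
    refine Filter.mem_of_superset (hV.mem_nhds hyV) ?_
    refine (subset_closure_inter_of_isPreirreducible_of_isOpen hirrV hU this).trans ?_
    exact closure_mono Set.inter_subset_right
  have : closure U = Set.univ := IsClopen.eq_univ ⟨isClosed_closure, hcl⟩ ⟨x, subset_closure hxU⟩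
  have h2 := hirr.closure
  rw [this] at h2
  exact { isPreirreducible_univ := h2, toNonempty := ⟨x⟩ }

namespace SuperScheme

variable {k : Type u} [Field k] {X : SuperScheme k}

theorem germ_const (X : SuperScheme k) {U : X.even.Opens} {x : X.even} (hx : x ∈ U) (s : k) :
    X.even.presheaf.germ U x hx (X.const U s) = X.even.presheaf.germ ⊤ x trivial
      (X.toBase.appTop ((Scheme.ΓSpecIso (.of k)).inv s)) := by
  change X.even.presheaf.germ U x hx (X.toBase.appLE ⊤ U le_top _) = _
  dsimp only [Scheme.Hom.appLE]
  exact X.even.presheaf.germ_res_apply _ _ _ _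

/-- At a closed point every function agrees with a constant up to functions vanishing there. -/
theorem exists_germ_sub_const_mem [IsAlgClosed k] [LocallyOfFiniteType X.toBase] {x : X.even}
    (hx : IsClosed {x}) {U : X.even.Opens} (hxU : x ∈ U) (a : Γ(X.even, U)) :
    ∃ s, X.even.presheaf.germ U x hxU (a - X.const U s) ∈
      IsLocalRing.maximalIdeal (X.even.presheaf.stalk x) := by
  let i := (residueFieldIsoBase X.toBase x hx).inv
  have hi : Function.Bijective i := ConcreteCategory.bijective_of_isIso i
  have key (s : k) : X.even.residue x (X.even.presheaf.germ U x hxU (X.const U s)) = i s := by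
    have h1 : Spec.map i = Spec.map (X.even.residue x) ≫ X.even.fromSpecStalk x ≫ X.toBase := by
      rw [SpecMap_residueFieldIsoBase_inv]; rfl
    have h2 := congrArg Scheme.Hom.appTop h1
    rw [Scheme.Hom.comp_appTop, Scheme.Hom.comp_appTop, Scheme.fromSpecStalk_appTop] at h2
    have h3 : i = (Scheme.ΓSpecIso (.of k)).inv ≫ X.toBase.appTop ≫
        X.even.presheaf.germ ⊤ x trivial ≫ X.even.residue x := by
      rw [← cancel_mono (Scheme.ΓSpecIso _).inv, Scheme.ΓSpecIso_inv_naturality, h2]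
      simp [Scheme.ΓSpecIso_inv_naturality]
    rw [germ_const, h3]
    rfl
  obtain ⟨s, hs⟩ := hi.2 (X.even.residue x (X.even.presheaf.germ U x hxU a))
  refine ⟨s, ?_⟩
  rw [← IsLocalRing.residue_eq_zero_iff, map_sub, map_sub, sub_eq_zero]
  exact hs.symm.trans (key s).symm

theorem IsSupercurve.isLocallyNoetherian (hX : X.IsSupercurve) : IsLocallyNoetherian X.even := by
  have := hX.proper
  exact LocallyOfFiniteType.isLocallyNoetherian X.toBase

theorem IsSupercurve.jacobsonSpace (hX : X.IsSupercurve) : JacobsonSpace X.even := by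
  have := hX.proper
  exact LocallyOfFiniteType.jacobsonSpace X.toBase

variable [IsAlgClosed k] [CharZero k]

/-- The local rings of `(X, 𝒪_X⁺)` at closed points are domains with nonzero principal maximal
ideal. -/
theorem IsSupercurve.stalk_isDomain_and_principal (hX : X.IsSupercurve) {x : X.even}
    (hx : IsClosed {x}) : IsDomain (X.even.presheaf.stalk x) ∧
      ∃ t : X.even.presheaf.stalk x, t ≠ 0 ∧ IsLocalRing.maximalIdeal _ = Ideal.span {t} := by
  have := hX.proper
  have := hX.isLocallyNoetherian
  obtain ⟨U, hU, hxU, h⟩ := hX.smooth x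
  have : IsNoetherianRing Γ(X.even, U) := IsLocallyNoetherian.component_noetherian ⟨U, hU⟩
  let := TopCat.Presheaf.algebra_section_stalk X.even.presheaf ⟨x, hxU⟩
  have := hU.isLocalization_stalk ⟨x, hxU⟩
  refine h.isDomain_and_principal (fun a b => hX.oddMul_eq_zero U a b)
    (hU.primeIdealOf ⟨x, hxU⟩).asIdeal (fun r => ?_) _
  obtain ⟨s, hs⟩ := exists_germ_sub_const_mem hx hxU r
  refine ⟨s, ?_⟩
  rw [hU.primeIdealOf_eq_map_closedPoint]
  exact hs

theorem IsSupercurve.exists_isDomain (hX : X.IsSupercurve) (x : X.even) :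
    ∃ U : X.even.Opens, IsAffineOpen U ∧ x ∈ U ∧ IsDomain Γ(X.even, U) := by
  have := hX.jacobsonSpace
  have := hX.isLocallyNoetherian
  obtain ⟨y, hxy, hy⟩ := nonempty_inter_closedPoints (Z := closure {x})
    ⟨x, subset_closure rfl⟩ isClosed_closure.isLocallyClosed
  obtain ⟨U, hyU, hU, hinj⟩ := X.even.exists_germ_injective y
  have := (hX.stalk_isDomain_and_principal hy).1
  exact ⟨U, hU, (specializes_iff_mem_closure.2 hxy).mem_open U.2 hyU,
    hinj.isDomain (X.even.presheaf.germ U y hyU).hom⟩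

/-- The scheme `(X, 𝒪_X⁺)` is integral: it is covered by spectra of domains, as every point
specializes to a closed point, and it is connected. -/
theorem IsSupercurve.isIntegral (hX : X.IsSupercurve) : IsIntegral X.even := by
  have := hX.connected
  have : IsReduced X.even := by
    have (x : X.even) : _root_.IsReduced (X.even.presheaf.stalk x) := by
      obtain ⟨U, hU, hxU, h⟩ := hX.exists_isDomain x
      let := TopCat.Presheaf.algebra_section_stalk X.even.presheaf ⟨x, hxU⟩
      have := hU.isLocalization_stalk ⟨x, hxU⟩
      have := IsLocalization.isDomain_of_le_nonZeroDivisors (X.even.presheaf.stalk x)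
        (hU.primeIdealOf ⟨x, hxU⟩).asIdeal.primeCompl_le_nonZeroDivisors
      infer_instance
    exact isReduced_of_isReduced_stalk _
  have : IrreducibleSpace X.even := by
    refine irreducibleSpace_of_forall_exists_isOpen fun x => ?_
    obtain ⟨U, hU, hxU, h⟩ := hX.exists_isDomain x
    refine ⟨U, U.2, hxU, ?_⟩
    rw [← hU.range_fromSpec, ← Set.image_univ]
    exact (PreirreducibleSpace.isPreirreducible_univ (X := Spec Γ(X.even, U))).image _
      hU.fromSpec.continuous.continuousOn
  exact isIntegral_of_irreducibleSpace_of_isReduced _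

end SuperScheme

/-! ### Automorphisms of a curve of genus zero -/

namespace AlgebraicGeometry.Scheme

variable {C : Scheme.{u}} [IsIntegral C]

theorem genericPoint_mem {U : C.Opens} {x : C} (hx : x ∈ U) : genericPoint C ∈ U :=
  ((genericPoint_spec C).mem_open_set_iff U.isOpen).2 ⟨x, trivial, hx⟩

/-- The germ of a function at the generic point. -/
abbrev genericGerm {U : C.Opens} (h : genericPoint C ∈ U) : Γ(C, U) →+* C.functionField :=
  (C.presheaf.germ U (genericPoint C) h).hom

theorem genericGerm_injective {U : C.Opens} (h : genericPoint C ∈ U) :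
    Function.Injective (genericGerm h) :=
  germ_injective_of_isIntegral _ _ _

theorem genericGerm_res {U V : C.Opens} (h : genericPoint C ∈ U) (hUV : U ≤ V) (a : Γ(C, V)) :
    genericGerm h (C.presheaf.map (homOfLE hUV).op a) = genericGerm (hUV h) a :=
  C.presheaf.germ_res_apply _ _ _ _

theorem algebraMap_germ {U : C.Opens} {x : C} (hx : x ∈ U) (a : Γ(C, U)) :
    algebraMap (C.presheaf.stalk x) C.functionField (C.presheaf.germ U x hx a) =
      genericGerm (genericPoint_mem hx) a := by
  have : Nonempty U := ⟨⟨x, hx⟩⟩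
  exact C.algebraMap_germ_eq_germToFunctionField hx a

theorem algebraMap_stalk_injective (x : C) :
    Function.Injective (algebraMap (C.presheaf.stalk x) C.functionField) :=
  IsFractionRing.injective _ _

/-- A rational function which is regular at every point of `W` is a function on `W`. -/
theorem exists_genericGerm_eq {W : C.Opens} (hW : genericPoint C ∈ W) (x : C.functionField)
    (h : ∀ y ∈ W, ∃ (U : C.Opens) (hy : y ∈ U) (a : Γ(C, U)),
      genericGerm (genericPoint_mem hy) a = x) : ∃ a : Γ(C, W), genericGerm hW a = x := by
  choose U hU a ha using fun y : W => h y.1 y.2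
  obtain ⟨b, hb, -⟩ := C.sheaf.existsUnique_gluing' (fun y : W => U y ⊓ W) W
    (fun y => homOfLE inf_le_right) (fun y hy => Opens.mem_iSup.2 ⟨⟨y, hy⟩, hU _, hy⟩)
    (fun y => C.presheaf.map (homOfLE inf_le_left).op (a y)) (fun y z => by
      have hη : genericPoint C ∈ (U y ⊓ W) ⊓ (U z ⊓ W) :=
        ⟨⟨genericPoint_mem (hU y), hW⟩, genericPoint_mem (hU z), hW⟩
      apply genericGerm_injective hη
      refine (genericGerm_res hη _ _).trans (Eq.trans ?_ (genericGerm_res hη _ _).symm)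
      rw [genericGerm_res, genericGerm_res, ha, ha])
  refine ⟨b, ?_⟩
  have hη : genericPoint C ∈ U ⟨_, hW⟩ ⊓ W := ⟨genericPoint_mem (hU _), hW⟩
  rw [← genericGerm_res hη inf_le_right b]
  refine (congrArg _ (hb ⟨_, hW⟩)).trans ?_
  rw [genericGerm_res, ha]

/-- The map induced on the function field by an endomorphism fixing the generic point. -/
def fieldMap (σ : C ⟶ C) (h : σ (genericPoint C) = genericPoint C) :
    C.functionField →+* C.functionField :=
  (C.presheaf.stalkSpecializes (specializes_of_eq h) ≫ σ.stalkMap (genericPoint C)).hom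

theorem fieldMap_genericGerm (σ : C ⟶ C) (h : σ (genericPoint C) = genericPoint C) {U : C.Opens}
    (hU : genericPoint C ∈ U) (hU' : genericPoint C ∈ σ ⁻¹ᵁ U) (a : Γ(C, U)) :
    fieldMap σ h (genericGerm hU a) = genericGerm hU' (σ.app U a) := by
  have h1 := C.presheaf.germ_stalkSpecializes_apply hU (specializes_of_eq h) a
  change σ.stalkMap _ (C.presheaf.stalkSpecializes _ (C.presheaf.germ _ _ _ a)) = _
  rw [h1]
  exact σ.germ_stalkMap_apply U _ _ a

theorem fieldMap_id (σ : C ⟶ C) (h : σ (genericPoint C) = genericPoint C) (hσ : σ = 𝟙 C)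
    (x : C.functionField) : fieldMap σ h x = x := by
  subst hσ
  obtain ⟨U, hU, a, rfl⟩ := C.presheaf.exists_germ_eq x
  exact fieldMap_genericGerm _ h hU hU a

theorem fieldMap_fieldMap (σ τ : C ⟶ C) (h : σ (genericPoint C) = genericPoint C)
    (h' : τ (genericPoint C) = genericPoint C) (h'' : (σ ≫ τ) (genericPoint C) = genericPoint C)
    (x : C.functionField) : fieldMap σ h (fieldMap τ h' x) = fieldMap (σ ≫ τ) h'' x := by
  obtain ⟨U, hU, a, rfl⟩ := C.presheaf.exists_germ_eq x
  have h1 : genericPoint C ∈ τ ⁻¹ᵁ U := by rwa [← h'] at hU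
  have h2 : genericPoint C ∈ σ ⁻¹ᵁ τ ⁻¹ᵁ U := by rwa [← h] at h1
  erw [fieldMap_genericGerm τ h' hU h1, fieldMap_genericGerm σ h h1 h2,
    fieldMap_genericGerm _ h'' hU h2]
  rfl

theorem fieldMap_algebraMap (σ : C ⟶ C) (h : σ (genericPoint C) = genericPoint C) (q : C)
    (x : C.presheaf.stalk (σ q)) :
    fieldMap σ h (algebraMap _ C.functionField x) =
      algebraMap _ C.functionField (σ.stalkMap q x) := by
  obtain ⟨U, hU, a, rfl⟩ := C.presheaf.exists_germ_eq x
  have h1 : genericPoint C ∈ σ ⁻¹ᵁ U := by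
    change σ (genericPoint C) ∈ U
    rw [h]; exact genericPoint_mem hU
  rw [algebraMap_germ, fieldMap_genericGerm σ h _ h1, Scheme.Hom.germ_stalkMap_apply]
  exact (algebraMap_germ (U := σ ⁻¹ᵁ U) hU _).symm

end AlgebraicGeometry.Scheme

namespace AlgebraicGeometry

/-- A closed point whose local ring has principal maximal ideal has a neighbourhood on
which a uniformizer vanishes at that point only. -/
theorem exists_uniformizer {C : Scheme.{u}} [IsLocallyNoetherian C] {x : C}
    (hx : IsClosed {x}) {t : C.presheaf.stalk x}
    (ht : IsLocalRing.maximalIdeal (C.presheaf.stalk x) = Ideal.span {t}) :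
    ∃ (W : C.Opens) (hxW : x ∈ W) (τ : Γ(C, W)), C.presheaf.germ W x hxW τ = t ∧
      ∀ y ∈ W, y ≠ x → y ∈ C.basicOpen τ := by
  obtain ⟨U₀, hxU₀, τ₀, hτ₀⟩ := C.presheaf.exists_germ_eq t
  obtain ⟨_, ⟨U, hU, rfl⟩, hxU, hUU₀⟩ :=
    C.isBasis_affineOpens.exists_subset_of_mem_open hxU₀ U₀.2
  change U ≤ U₀ at hUU₀
  set τ : Γ(C, U) := C.presheaf.map (homOfLE hUU₀).op τ₀ with hτdef
  have hτ : C.presheaf.germ U x hxU τ = t := by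
    rw [← hτ₀]; exact C.presheaf.germ_res_apply _ _ _ _
  have : IsNoetherianRing Γ(C, U) := IsLocallyNoetherian.component_noetherian ⟨U, hU⟩
  let := TopCat.Presheaf.algebra_section_stalk C.presheaf ⟨x, hxU⟩
  have hloc := hU.isLocalization_stalk ⟨x, hxU⟩
  set m := (hU.primeIdealOf ⟨x, hxU⟩).asIdeal with hm
  have hmem (g : Γ(C, U)) : g ∈ m ↔ C.presheaf.germ U x hxU g ∈
      IsLocalRing.maximalIdeal (C.presheaf.stalk x) := by
    rw [hm, hU.primeIdealOf_eq_map_closedPoint]; rfl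
  -- Some `s ∉ m` satisfies `s m ⊆ (τ)`, because `m` is finitely generated.
  have key : ∀ I : Ideal Γ(C, U), I ≤ m → ∃ s ∉ m, ∀ g ∈ I, s * g ∈ Ideal.span {τ} := by
    intro I
    refine Submodule.fg_induction (R := Γ(C, U)) (M := Γ(C, U))
      (motive := fun I _ => I ≤ m → ∃ s ∉ m, ∀ g ∈ I, s * g ∈ Ideal.span {τ}) ?_ ?_ I
      (IsNoetherian.noetherian I)
    · intro g hg
      have h1 := (hmem g).1 (hg (Submodule.mem_span_singleton_self g))
      rw [ht, Ideal.mem_span_singleton'] at h1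
      obtain ⟨a, ha⟩ := h1
      obtain ⟨⟨b, s⟩, hb⟩ := IsLocalization.surj m.primeCompl a
      have h2 : algebraMap Γ(C, U) (C.presheaf.stalk x) (g * s) =
          algebraMap Γ(C, U) (C.presheaf.stalk x) (b * τ) := by
        rw [map_mul, map_mul, ← hb]
        change C.presheaf.germ U x hxU g * _ = _ * C.presheaf.germ U x hxU τ
        rw [← ha, hτ]; ring
      obtain ⟨c, hc⟩ := (IsLocalization.eq_iff_exists m.primeCompl _).1 h2
      refine ⟨c * s, (c * s).2, fun g' hg' => ?_⟩
      obtain ⟨r, rfl⟩ := Submodule.mem_span_singleton.1 hg'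
      refine Ideal.mem_span_singleton'.2 ⟨r * c * b, ?_⟩
      rw [smul_eq_mul]
      linear_combination -r * hc
    · intro I J _ _ hI hJ hIJ
      obtain ⟨s, hs, h1⟩ := hI (le_sup_left.trans hIJ)
      obtain ⟨s', hs', h2⟩ := hJ (le_sup_right.trans hIJ)
      refine ⟨s * s', fun h => (Ideal.IsPrime.mem_or_mem inferInstance h).elim hs hs', ?_⟩
      intro g hg
      obtain ⟨a, ha, b, hb, rfl⟩ := Submodule.mem_sup.1 hg
      have := add_mem (Ideal.mul_mem_left _ s' (h1 a ha)) (Ideal.mul_mem_left _ s (h2 b hb))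
      convert this using 1
      ring
  obtain ⟨s, hs, hsm⟩ := key m le_rfl
  have hxs : x ∈ C.basicOpen s := by
    rw [Scheme.mem_basicOpen _ _ _ hxU]
    by_contra h
    exact hs ((hmem s).2 h)
  refine ⟨C.basicOpen s, hxs, C.presheaf.map (homOfLE (C.basicOpen_le s)).op τ, ?_, ?_⟩
  · rw [← hτ]; exact C.presheaf.germ_res_apply _ _ _ _
  · intro y hy hyx
    rw [Scheme.basicOpen_res]
    refine ⟨hy, ?_⟩
    have hyU : y ∈ U := C.basicOpen_le s hy
    by_contra hyτ
    replace hyτ : y ∉ C.basicOpen τ := hyτ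
    rw [Scheme.mem_basicOpen _ _ _ hyU] at hy hyτ
    have hmax := hU.primeIdealOf_isMaximal_of_isClosed ⟨x, hxU⟩ hx
    have hmemy (g : Γ(C, U)) : g ∈ (hU.primeIdealOf ⟨y, hyU⟩).asIdeal ↔
        ¬ IsUnit (C.presheaf.germ U y hyU g) := by
      rw [hU.primeIdealOf_eq_map_closedPoint]; rfl
    have hle : m ≤ (hU.primeIdealOf ⟨y, hyU⟩).asIdeal := by
      intro g hg
      have h1 : s * g ∈ (hU.primeIdealOf ⟨y, hyU⟩).asIdeal :=
        (Ideal.span_singleton_le_iff_mem _).2 ((hmemy τ).2 hyτ) (hsm g hg)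
      exact (Ideal.IsPrime.mem_or_mem inferInstance h1).resolve_left fun h => (hmemy s).1 h hy
    have h2 := hmax.eq_of_le (Ideal.IsPrime.ne_top inferInstance) hle
    have h3 := congrArg hU.fromSpec (PrimeSpectrum.ext h2)
    rw [hU.fromSpec_primeIdealOf, hU.fromSpec_primeIdealOf] at h3
    exact hyx h3.symm

theorem isClosed_singleton_apply {C : Scheme.{u}} {σ σ' : C ⟶ C} (h : σ ≫ σ' = 𝟙 C)
    (h' : σ' ≫ σ = 𝟙 C) {x : C} (hx : IsClosed {x}) : IsClosed {σ x} := by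
  have e : {σ x} = σ' ⁻¹' {x} := by
    ext y
    constructor
    · rintro rfl
      change σ' (σ x) = x
      rw [← Scheme.Hom.comp_apply, h]; rfl
    · rintro (rfl : σ' y = x)
      change y = σ (σ' y)
      rw [← Scheme.Hom.comp_apply, h']; rfl
  rw [e]
  exact hx.preimage σ'.continuous

end AlgebraicGeometry

namespace SuperScheme

variable {k : Type u} [Field k] {X : SuperScheme k}

/-- On a supercurve of genus zero, every function on the intersection of two open sets covering
the curve is a difference of functions on these open sets. As odd functions multiply to zero, the
bosonic reduction is `(X, 𝒪_X⁺)` itself. -/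
theorem IsSupercurve.exists_evenRes_sub (hX : X.IsSupercurve) (hg : X.IsGenusZero)
    {U V : X.even.Opens} (hUV : U ⊔ V = ⊤) (s : Γ(X.even, U ⊓ V)) :
    ∃ (a : Γ(X.even, U)) (b : Γ(X.even, V)),
      s = X.evenRes inf_le_left a - X.evenRes inf_le_right b := by
  let i : X.bos ⟶ X.even := X.oddSq.subschemeι
  have : IsIso i := hX.isIso_subschemeι
  have htop : i ⁻¹ᵁ U ⊔ i ⁻¹ᵁ V = ⊤ := by
    rw [← Scheme.Hom.preimage_sup, hUV]; rfl
  obtain ⟨a, b, hab⟩ := exists_sub_eq_of_subsingleton_H_one (structureAbSheaf X.bos) hg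
    (i ⁻¹ᵁ U) (i ⁻¹ᵁ V) htop (i.app (U ⊓ V) s)
  obtain ⟨a, rfl⟩ := (ConcreteCategory.bijective_of_isIso (i.app U)).2 a
  obtain ⟨b, rfl⟩ := (ConcreteCategory.bijective_of_isIso (i.app V)).2 b
  refine ⟨a, b, (ConcreteCategory.bijective_of_isIso (i.app (U ⊓ V))).1 (hab.trans ?_)⟩
  rw [map_sub]
  have e1 := ConcreteCategory.congr_hom (i.naturality (homOfLE (inf_le_left : U ⊓ V ≤ U)).op) a
  have e2 := ConcreteCategory.congr_hom (i.naturality (homOfLE (inf_le_right : U ⊓ V ≤ V)).op) b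
  exact (congrArg₂ (· - ·) e1 e2).symm

theorem appLE_const {σ : X.even ⟶ X.even} (hσ : σ ≫ X.toBase = X.toBase) {U V : X.even.Opens}
    (h : V ≤ σ ⁻¹ᵁ U) (s : k) : σ.appLE U V h (X.const U s) = X.const V s := by
  have h1 := Scheme.Hom.appLE_comp_appLE σ X.toBase ⊤ U V le_top h
  have h2 := ConcreteCategory.congr_hom h1 ((Scheme.ΓSpecIso (.of k)).inv s)
  refine h2.trans ?_
  change _ = X.toBase.appLE ⊤ V le_top _
  simp only [hσ]

variable [IsAlgClosed k] [CharZero k]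

/-- The only global functions on a supercurve are the constants. -/
theorem IsSupercurve.exists_const_eq (hX : X.IsSupercurve) (a : Γ(X.even, ⊤)) :
    ∃ s, X.const ⊤ s = a := by
  have := hX.proper
  have := hX.isIntegral
  have hfin := finite_appTop_of_universallyClosed k X.toBase
  have hc : X.const ⊤ = X.toBase.appTop.hom.comp (Scheme.ΓSpecIso (.of k)).inv.hom := by
    refine RingHom.ext fun s => ?_
    exact (ConcreteCategory.congr_hom (Scheme.Hom.app_eq_appLE X.toBase (U := ⊤)) _).symm
  have hint : (X.const ⊤).IsIntegral := by
    rw [hc]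
    exact RingHom.IsIntegral.trans _ _ (RingHom.isIntegral_of_surjective _
      (ConcreteCategory.bijective_of_isIso (Scheme.ΓSpecIso (.of k)).inv).2) hfin.to_isIntegral
  exact (IsAlgClosed.ringHom_bijective_of_isIntegral _ hint).2 a

/-- A uniformizer at a closed point of a supercurve. -/
def IsSupercurve.uniformizer (hX : X.IsSupercurve) (p : {x : X.even // IsClosed {x}}) :
    X.even.presheaf.stalk p.1 :=
  (hX.stalk_isDomain_and_principal p.2).2.choose

theorem IsSupercurve.uniformizer_ne_zero (hX : X.IsSupercurve)
    (p : {x : X.even // IsClosed {x}}) : hX.uniformizer p ≠ 0 :=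
  (hX.stalk_isDomain_and_principal p.2).2.choose_spec.1

theorem IsSupercurve.maximalIdeal_eq (hX : X.IsSupercurve) (p : {x : X.even // IsClosed {x}}) :
    IsLocalRing.maximalIdeal (X.even.presheaf.stalk p.1) = Ideal.span {hX.uniformizer p} :=
  (hX.stalk_isDomain_and_principal p.2).2.choose_spec.2

open Scheme in
/-- The function field of a supercurve of genus zero, with the local rings at the closed
points. A function with a simple pole at `p` arises by writing the inverse of a uniformizer at `p`,
on a punctured neighbourhood `W ∖ {p}`, as a difference `a - b` of functions `a` on `W` and `b` on
the complement of `p`; it is `-b`. -/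
def IsSupercurve.poleCurve (hX : X.IsSupercurve) (hg : X.IsGenusZero) [IsIntegral X.even] :
    PoleCurve (K := X.even.functionField)
      ((genericGerm (C := X.even) (U := ⊤) trivial).comp (X.const ⊤))
      {x : X.even // IsClosed {x}} where
  O p := (algebraMap (X.even.presheaf.stalk p.1) X.even.functionField).range
  t p := algebraMap (X.even.presheaf.stalk p.1) X.even.functionField (hX.uniformizer p)
  const_mem p s := ⟨X.even.presheaf.germ ⊤ p.1 trivial (X.const ⊤ s),
    algebraMap_germ (U := ⊤) trivial _⟩
  t_mem p := ⟨_, rfl⟩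
  t_ne_zero p := (map_ne_zero_iff _ (algebraMap_stalk_injective _)).2 (hX.uniformizer_ne_zero p)
  not_unit := by
    rintro p _ ⟨y, rfl⟩ h
    rw [← map_mul, ← map_one (algebraMap (X.even.presheaf.stalk p.1) _)] at h
    have h1 := algebraMap_stalk_injective _ h
    have h2 : hX.uniformizer p ∈ IsLocalRing.maximalIdeal (X.even.presheaf.stalk p.1) := by
      rw [hX.maximalIdeal_eq]
      exact Ideal.mem_span_singleton_self _
    exact h2 (IsUnit.of_mul_eq_one _ h1)
  residue := by
    rintro p _ ⟨x, rfl⟩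
    have := hX.proper
    obtain ⟨U, hU, a, rfl⟩ := X.even.presheaf.exists_germ_eq x
    obtain ⟨s, hs⟩ := exists_germ_sub_const_mem p.2 hU a
    rw [hX.maximalIdeal_eq p, Ideal.mem_span_singleton'] at hs
    obtain ⟨y, hy⟩ := hs
    refine ⟨s, _, ⟨y, rfl⟩, ?_⟩
    rw [← map_mul, mul_comm, hy, map_sub, map_sub, algebraMap_germ, algebraMap_germ]
    congr 1
    rw [← algebraMap_germ hU, germ_const, ← germ_const X (U := ⊤) trivial]
    exact (algebraMap_germ (C := X.even) (U := ⊤) trivial _).symm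
  global := by
    intro x hx
    have := hX.jacobsonSpace
    have hreg : ∀ y ∈ (⊤ : X.even.Opens), ∃ (U : X.even.Opens) (hy : y ∈ U) (a : Γ(X.even, U)),
        genericGerm (C := X.even) (genericPoint_mem hy) a = x := by
      intro y _
      obtain ⟨z, hyz, hz⟩ := nonempty_inter_closedPoints (Z := closure {y})
        ⟨y, subset_closure rfl⟩ isClosed_closure.isLocallyClosed
      obtain ⟨b, hb⟩ := hx ⟨z, hz⟩
      obtain ⟨U, hU, a, rfl⟩ := X.even.presheaf.exists_germ_eq b
      refine ⟨U, (specializes_iff_mem_closure.2 hyz).mem_open U.2 hU, a, ?_⟩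
      rw [← hb]
      exact (algebraMap_germ hU a).symm
    obtain ⟨a, ha⟩ := exists_genericGerm_eq (C := X.even) (W := ⊤) trivial x hreg
    obtain ⟨s, rfl⟩ := hX.exists_const_eq a
    exact ⟨s, ha.symm⟩
  pole := by
    intro p
    have := hX.isLocallyNoetherian
    obtain ⟨W, hpW, τ, hτ, hW⟩ := exists_uniformizer p.2 (hX.maximalIdeal_eq p)
    let V : X.even.Opens := ⟨{p.1}ᶜ, p.2.isOpen_compl⟩
    have hWV : W ⊔ V = ⊤ := by
      refine eq_top_iff.2 fun y _ => ?_
      by_cases hy : y = p.1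
      · exact Or.inl (hy ▸ hpW)
      · exact Or.inr hy
    have hle : W ⊓ V ≤ X.even.basicOpen τ := fun y hy => hW y hy.1 hy.2
    have hu : IsUnit (X.evenRes (inf_le_left : W ⊓ V ≤ W) τ) := by
      have h := (RingedSpace.isUnit_res_basicOpen X.even.toRingedSpace τ).map (X.evenRes hle)
      exact (X.evenRes_evenRes _ hle τ) ▸ h
    obtain ⟨v, hv⟩ := hu.exists_right_inv
    obtain ⟨a, b, hab⟩ := hX.exists_evenRes_sub hg hWV v
    have hη : genericPoint X.even ∈ V := by
      intro h
      refine hX.uniformizer_ne_zero p ?_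
      have h1 : genericPoint X.even = p.1 := h
      have h2 : IsField (X.even.presheaf.stalk p.1) := by
        rw [← h1]
        exact Field.toIsField X.even.functionField
      rw [← Ideal.span_singleton_eq_bot, ← hX.maximalIdeal_eq p]
      exact IsLocalRing.isField_iff_maximalIdeal_eq.1 h2
    have hηW : genericPoint X.even ∈ W := genericPoint_mem hpW
    have hηWV : genericPoint X.even ∈ W ⊓ V := ⟨hηW, hη⟩
    have e1 := congrArg (genericGerm hηWV) hv
    have e2 := congrArg (genericGerm hηWV) hab
    rw [map_mul, map_one] at e1
    rw [map_sub] at e2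
    change genericGerm hηWV (X.even.presheaf.map (homOfLE inf_le_left).op τ) * _ = _ at e1
    change _ = genericGerm hηWV (X.even.presheaf.map (homOfLE inf_le_left).op a) -
      genericGerm hηWV (X.even.presheaf.map (homOfLE inf_le_right).op b) at e2
    rw [genericGerm_res] at e1
    rw [genericGerm_res, genericGerm_res] at e2
    refine ⟨-genericGerm hη b, fun q hq => neg_mem ?_, -genericGerm hηW a, neg_mem ?_, ?_⟩
    · have hqV : q.1 ∈ V := fun h => hq (Subtype.ext h)
      exact ⟨X.even.presheaf.germ V q.1 hqV b, algebraMap_germ hqV b⟩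
    · exact ⟨X.even.presheaf.germ W p.1 hpW a, algebraMap_germ hpW a⟩
    · rw [← hτ, algebraMap_germ]
      linear_combination e1 - genericGerm hηW τ * e2


open Scheme in
/-- An automorphism of a curve of genus zero that fixes three closed points fixes all closed points,
hence is the identity. -/
theorem IsSupercurve.eq_id_of_fixed (hX : X.IsSupercurve) (hg : X.IsGenusZero)
    {σ σ' : X.even ⟶ X.even} (h : σ ≫ σ' = 𝟙 _) (h' : σ' ≫ σ = 𝟙 _)
    (hσ : σ ≫ X.toBase = X.toBase) {p q r : X.even} (hp : IsClosed {p}) (hq : IsClosed {q})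
    (hr : IsClosed {r}) (hpq : p ≠ q) (hpr : p ≠ r) (hqr : q ≠ r) (hσp : σ p = p) (hσq : σ q = q)
    (hσr : σ r = r) : σ = 𝟙 _ := by
  have := hX.proper
  have := hX.isIntegral
  have : IsIso σ := ⟨σ', h, h'⟩
  have : IsIso σ' := ⟨σ, h', h⟩
  have hη := genericPoint_eq_of_isOpenImmersion σ
  have hη' := genericPoint_eq_of_isOpenImmersion σ'
  let C := hX.poleCurve hg
  have hinj : Function.Injective σ := by
    intro x y hxy
    have := congrArg σ' hxy
    rwa [← Scheme.Hom.comp_apply, ← Scheme.Hom.comp_apply, h] at this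
  -- The field automorphism maps a uniformizer at `τ a` into the maximal ideal at `a`.
  have hvan (τ : X.even ⟶ X.even) (hτ : τ (genericPoint X.even) = genericPoint X.even)
      (a b : {x : X.even // IsClosed {x}}) (hab : τ a.1 = b.1) :
      C.Vanish a (fieldMap τ hτ (C.t b)) := by
    obtain ⟨b, hb⟩ := b
    subst hab
    have h1 : τ.stalkMap a.1 (hX.uniformizer ⟨τ a.1, hb⟩) ∈
        IsLocalRing.maximalIdeal (X.even.presheaf.stalk a.1) := by
      have h2 : hX.uniformizer ⟨τ a.1, hb⟩ ∈
          IsLocalRing.maximalIdeal (X.even.presheaf.stalk (τ a.1)) := by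
        rw [hX.maximalIdeal_eq ⟨τ a.1, hb⟩]
        exact Ideal.mem_span_singleton_self _
      exact fun hu => h2 (isUnit_of_map_unit (τ.stalkMap a.1).hom _ hu)
    rw [hX.maximalIdeal_eq a, Ideal.mem_span_singleton'] at h1
    obtain ⟨y, hy⟩ := h1
    refine ⟨_, ⟨y, rfl⟩, ?_⟩
    refine (fieldMap_algebraMap τ hτ a.1 _).trans ?_
    rw [← hy, map_mul, mul_comm]
    rfl
  have key := C.perm_eq_self (fun x => ⟨σ x.1, isClosed_singleton_apply h h' x.2⟩)
    (fun x y hxy => Subtype.ext (hinj (congrArg Subtype.val hxy)))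
    (fieldMap σ hη) (fieldMap σ' hη')
    (fun x => (fieldMap_fieldMap σ σ' hη hη' (by rw [h]; rfl) x).trans (fieldMap_id _ _ h x))
    (fun a => by
      refine (fieldMap_genericGerm (U := ⊤) σ hη trivial trivial _).trans ?_
      refine congrArg (genericGerm (C := X.even) (U := ⊤) trivial) ?_
      have e := appLE_const hσ (U := ⊤) (V := ⊤) le_top a
      exact (ConcreteCategory.congr_hom (Scheme.Hom.app_eq_appLE σ (U := ⊤)) _).trans e)
    (by
      rintro ⟨q, hq⟩ _ ⟨x, rfl⟩
      exact ⟨_, (fieldMap_algebraMap σ hη q x).symm⟩)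
    (fun q => hvan σ hη _ _ rfl)
    (fun q => hvan σ' hη' _ _ (by
      change σ' (σ q.1) = q.1
      rw [← Scheme.Hom.comp_apply, h]; rfl))
    (p := ⟨p, hp⟩) (q := ⟨q, hq⟩) (r := ⟨r, hr⟩) (fun e => hpq (congrArg Subtype.val e))
    (fun e => hpr (congrArg Subtype.val e)) (fun e => hqr (congrArg Subtype.val e))
    (Subtype.ext hσp) (Subtype.ext hσq) (Subtype.ext hσr)
  have : LocallyOfFiniteType (σ ≫ X.toBase) := by rw [hσ]; infer_instance
  exact ext_of_apply_eq X.toBase Set.univ isClosed_univ.isLocallyClosed dense_univ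
    (fun x _ hx => congrArg Subtype.val (key ⟨x, hx⟩)) (by rw [hσ, Category.id_comp])

end SuperScheme

/-! ### Odd and even derivations -/

namespace SuperRing

variable {R M : Type*} [CommRing R] [AddCommGroup M] [Module R M] {μ : OddMul R M}

/-- The inclusion of the odd part. -/
def ofOdd (μ : OddMul R M) : M →+ SuperRing μ where
  toFun m := ⟨0, m⟩
  map_zero' := rfl
  map_add' a b := by ext <;> simp

@[simp] theorem ofEven_ev (r : R) : (ofEven μ r).ev = r := rfl
@[simp] theorem ofEven_od (r : R) : (ofEven μ r).od = 0 := rfl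
@[simp] theorem ofOdd_ev (m : M) : (ofOdd μ m).ev = 0 := rfl
@[simp] theorem ofOdd_od (m : M) : (ofOdd μ m).od = m := rfl
@[simp] theorem parity_ev (a : SuperRing μ) : (parity μ a).ev = a.ev := rfl
@[simp] theorem parity_od (a : SuperRing μ) : (parity μ a).od = -a.od := rfl
@[simp] theorem sub_ev (a b : SuperRing μ) : (a - b).ev = a.ev - b.ev := by
  rw [sub_eq_add_neg, sub_eq_add_neg]; rfl

theorem parity_ofEven (r : R) : parity μ (ofEven μ r) = ofEven μ r := by ext <;> simp
theorem parity_ofOdd (m : M) : parity μ (ofOdd μ m) = -ofOdd μ m := by ext <;> simp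
theorem parity_parity (a : SuperRing μ) : parity μ (parity μ a) = a := by ext <;> simp

theorem ofOdd_smul (r : R) (m : M) : ofOdd μ (r • m) = ofEven μ r * ofOdd μ m := by
  ext <;> simp

theorem ofEven_add_ofOdd (a : SuperRing μ) : ofEven μ a.ev + ofOdd μ a.od = a := by
  ext <;> simp

theorem eq_zero_of_eq_neg (h2 : IsUnit (2 : R)) {m : M} (h : m = -m) : m = 0 := by
  have h1 : (2 : R) • m = 0 := by
    rw [two_smul]; nth_rewrite 2 [h]; exact add_neg_cancel m
  obtain ⟨v, hv⟩ := h2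
  rw [← hv] at h1
  exact (smul_eq_zero_iff_eq v).1 h1

section Odd

variable {D : SuperRing μ →+ SuperRing μ}

theorem odd_apply_ofEven_ev (hD : ∀ a, D (parity μ a) = -parity μ (D a)) (h2 : IsUnit (2 : R))
    (r : R) : (D (ofEven μ r)).ev = 0 := by
  refine eq_zero_of_eq_neg h2 ?_
  have := congrArg SuperRing.ev (hD (ofEven μ r))
  rwa [parity_ofEven] at this

theorem odd_apply_ofOdd_od (hD : ∀ a, D (parity μ a) = -parity μ (D a)) (h2 : IsUnit (2 : R))
    (m : M) : (D (ofOdd μ m)).od = 0 := by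
  refine eq_zero_of_eq_neg h2 ?_
  have := congrArg SuperRing.od (hD (ofOdd μ m))
  rw [parity_ofOdd, map_neg] at this
  simpa using this.symm

theorem odd_apply_smul_ev (hμ : ∀ x y, μ.mul x y = 0)
    (hl : ∀ a b, D (a * b) = D a * b + parity μ a * D b) (r : R) (m : M) :
    (D (ofOdd μ (r • m))).ev = r * (D (ofOdd μ m)).ev := by
  rw [ofOdd_smul, hl]
  simp [hμ]

end Odd

section Even

variable {E : SuperRing μ →+ SuperRing μ}

theorem even_apply_ofEven_od (hE : ∀ a, E (parity μ a) = parity μ (E a)) (h2 : IsUnit (2 : R))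
    (r : R) : (E (ofEven μ r)).od = 0 := by
  refine eq_zero_of_eq_neg h2 ?_
  have := congrArg SuperRing.od (hE (ofEven μ r))
  rwa [parity_ofEven] at this

theorem even_apply_ofOdd_ev (hE : ∀ a, E (parity μ a) = parity μ (E a)) (h2 : IsUnit (2 : R))
    (m : M) : (E (ofOdd μ m)).ev = 0 := by
  refine eq_zero_of_eq_neg h2 ?_
  have := congrArg SuperRing.ev (hE (ofOdd μ m))
  rw [parity_ofOdd, map_neg] at this
  exact this.symm

theorem even_apply_smul_od
    (hl : ∀ a b, E (a * b) = E a * b + a * E b) (r : R) (m : M) :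
    (E (ofOdd μ (r • m))).od = (E (ofEven μ r)).ev • m + r • (E (ofOdd μ m)).od := by
  rw [ofOdd_smul, hl]
  simp

end Even

/-- If `[D, D] ≡ g E` modulo the multiples of the odd derivation `D = h ∂_ζ + d ζ`, then
`2 h d = g E` on even functions. -/
theorem two_mul_eq_of_bracket {D E : SuperRing μ →+ SuperRing μ} (hμ : ∀ x y, μ.mul x y = 0)
    (h2 : IsUnit (2 : R)) (hD : ∀ a, D (parity μ a) = -parity μ (D a))
    (hl : ∀ a b, D (a * b) = D a * b + parity μ a * D b) {g : R} {a : SuperRing μ} {ζ : M}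
    {r d : R} (hr : (D (ofEven μ r)).od = d • ζ)
    (h : D (D (ofEven μ r)) + D (D (ofEven μ r)) - ofEven μ g * E (ofEven μ r) =
      a * D (ofEven μ r)) :
    2 * ((D (ofOdd μ ζ)).ev * d) = g * (E (ofEven μ r)).ev := by
  have e : D (ofEven μ r) = ofOdd μ (d • ζ) := by
    ext
    · exact odd_apply_ofEven_ev hD h2 r
    · exact hr
  have := congrArg SuperRing.ev h
  rw [e] at this
  simp only [sub_ev, add_ev, mul_ev, odd_apply_smul_ev hμ hl, hμ, ofEven_ev, ofOdd_ev] at this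
  linear_combination this

end SuperRing

namespace SuperScheme

variable {k : Type u} [Field k] {X : SuperScheme k}

theorem res_ofEven {U V : X.even.Opens} (h : V ≤ U) (r : Γ(X.even, U)) :
    X.res h (SuperRing.ofEven _ r) = SuperRing.ofEven _ (X.evenRes h r) := by
  rw [res_apply]
  ext
  · rfl
  · exact map_zero (X.oddRes h)

theorem res_ofOdd {U V : X.even.Opens} (h : V ≤ U) (m : Γ(X.odd, U)) :
    X.res h (SuperRing.ofOdd _ m) = SuperRing.ofOdd _ (X.oddRes h m) := by
  rw [res_apply]
  ext
  · exact map_zero (X.evenRes h)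
  · rfl

theorem res_parity {U V : X.even.Opens} (h : V ≤ U) (a : X.Fun U) :
    X.res h (SuperRing.parity _ a) = SuperRing.parity _ (X.res h a) := by
  rw [res_apply, res_apply]
  ext
  · rfl
  · exact map_neg (X.oddRes h) _

theorem isUnit_two [CharZero k] (U : X.even.Opens) : IsUnit (2 : Γ(X.even, U)) := by
  have := (isUnit_iff_ne_zero.2 (two_ne_zero (α := k))).map (X.const U)
  rwa [map_ofNat] at this

theorem IsFrame.restrict {U V : X.even.Opens} {E D : SheafEnd X U} (h : X.IsFrame E D)
    (hV : V ≤ U) : X.IsFrame (E.restrict hV) (D.restrict hV) where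
  even := ⟨fun W _ => h.even.const W _, fun W _ => h.even.parity W _,
    fun W _ => h.even.leibniz W _⟩
  odd := ⟨fun W _ => h.odd.const W _, fun W _ => h.odd.parity W _,
    fun W _ => h.odd.leibniz W _⟩
  basis W hW δ hδ := h.basis W (hW.trans hV) δ hδ

theorem zero_mem_tangent (U : X.even.Opens) : (0 : SheafEnd X U) ∈ X.tangent U :=
  ⟨0, 0, ⟨by simp, by simp, by simp⟩, ⟨by simp, by simp, by simp⟩, by simp⟩

theorem SheafEnd.app_ofOdd_oddRes {V W : X.even.Opens} (δ : SheafEnd X V) (hW : W ≤ V)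
    (m : Γ(X.odd, V)) : δ.app W hW (SuperRing.ofOdd _ (X.oddRes hW m)) =
      X.res hW (δ.app V le_rfl (SuperRing.ofOdd _ m)) := by
  rw [δ.res_app V W le_rfl hW, res_ofOdd]

/-- The even component of the value of an odd vector field, in terms of an odd coordinate. -/
theorem SheafEnd.IsOddField.app_ev [CharZero k] (hμ : ∀ V a b, (X.oddMul V).mul a b = 0)
    {V W : X.even.Opens} {D : SheafEnd X V} (hD : D.IsOddField) (hW : W ≤ V) {ζ : Γ(X.odd, V)}
    {a : X.Fun W} {s : Γ(X.even, W)} (hs : s • X.oddRes hW ζ = a.od) :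
    (D.app W hW a).ev = s * X.evenRes hW (D.app V le_rfl (SuperRing.ofOdd _ ζ)).ev := by
  conv_lhs => rw [← SuperRing.ofEven_add_ofOdd a, map_add, ← hs]
  rw [SuperRing.add_ev, SuperRing.odd_apply_ofEven_ev (hD.parity W hW) (isUnit_two W),
    SuperRing.odd_apply_smul_ev (hμ W) (hD.leibniz W hW), D.app_ofOdd_oddRes, zero_add, res_apply]

/-- An even vector field killing all even functions is determined by its value at an odd
coordinate. -/
theorem SheafEnd.IsEvenField.app_eq_of_forall_eq_zero [CharZero k] {V W : X.even.Opens}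
    {E : SheafEnd X V} (hE : E.IsEvenField) (hW : W ≤ V)
    (h0 : ∀ r, (E.app W hW (SuperRing.ofEven _ r)).ev = 0) {ζ : Γ(X.odd, V)}
    {a : X.Fun W} {s : Γ(X.even, W)} (hs : s • X.oddRes hW ζ = a.od) :
    E.app W hW a =
      SuperRing.ofOdd _ (s • X.oddRes hW (E.app V le_rfl (SuperRing.ofOdd _ ζ)).od) := by
  have e1 : E.app W hW (SuperRing.ofEven _ a.ev) = 0 := by
    ext
    · exact h0 a.ev
    · exact SuperRing.even_apply_ofEven_od (hE.parity W hW) (isUnit_two W) _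
  conv_lhs => rw [← SuperRing.ofEven_add_ofOdd a, map_add, e1, zero_add, ← hs]
  ext
  · exact SuperRing.even_apply_ofOdd_ev (hE.parity W hW) (isUnit_two W) _
  · rw [SuperRing.even_apply_smul_od (hE.leibniz W hW), h0 s, E.app_ofOdd_oddRes, zero_smul,
      zero_add, res_apply]
    rfl

/-- If the even field `E` kills all even functions, then `h E = E(ζ) D` for any odd field
`D = h ∂_ζ + d ζ`. -/
theorem SheafEnd.IsEvenField.smul_eq_smul [CharZero k] (hμ : ∀ V a b, (X.oddMul V).mul a b = 0)
    {V : X.even.Opens} {E D : SheafEnd X V} (hE : E.IsEvenField) (hD : D.IsOddField)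
    (h0 : ∀ W hW r, (E.app W hW (SuperRing.ofEven _ r)).ev = 0) {ζ : Γ(X.odd, V)}
    (hζ : X.IsOddCoord ζ) :
    SuperRing.ofEven (X.oddMul V) (D.app V le_rfl (SuperRing.ofOdd _ ζ)).ev • E =
      SuperRing.ofOdd (X.oddMul V) (E.app V le_rfl (SuperRing.ofOdd _ ζ)).od • D := by
  ext W hW a : 4
  obtain ⟨s, hs⟩ := (hζ W hW).2 a.od
  rw [SheafEnd.smul_app, SheafEnd.smul_app, hE.app_eq_of_forall_eq_zero hW (h0 W hW) hs,
    res_ofEven, res_ofOdd]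
  ext
  · simp [hμ]
  · rw [SuperRing.mul_od, SuperRing.mul_od, hD.app_ev hμ hW hs]
    simp only [SuperRing.ofEven_ev, SuperRing.ofEven_od, SuperRing.ofOdd_ev, SuperRing.ofOdd_od,
      zero_smul, smul_zero, add_zero, zero_add]
    rw [mul_smul, smul_comm]

/-- The even member `E` of a frame does not kill all even functions: otherwise `h E = E(ζ) D`, hence
`E(ζ) = 0` by independence of `E` and `D`, so that `E = 0`. -/
theorem IsFrame.exists_ne_zero [CharZero k] (hμ : ∀ V a b, (X.oddMul V).mul a b = 0)
    {V : X.even.Opens} {E D : SheafEnd X V} (h : X.IsFrame E D) {ζ : Γ(X.odd, V)}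
    (hζ : X.IsOddCoord ζ) [Nontrivial Γ(X.even, V)] :
    ∃ (W : X.even.Opens) (hW : W ≤ V) (r : Γ(X.even, W)),
      (E.app W hW (SuperRing.ofEven _ r)).ev ≠ 0 := by
  by_contra! h0
  have key := h.even.smul_eq_smul hμ h.odd h0 hζ
  obtain ⟨p, -, hp'⟩ := h.basis V le_rfl 0 (zero_mem_tangent V)
  have hp (q : X.Fun V × X.Fun V) (hq : 0 = q.1 • E + q.2 • D) : q = p := hp' q hq
  have e0 := hp (0, 0) (by rw [zero_smul, zero_smul, add_zero])
  have e1 := hp (SuperRing.ofEven (X.oddMul V) (D.app V le_rfl (SuperRing.ofOdd _ ζ)).ev,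
    -SuperRing.ofOdd (X.oddMul V) (E.app V le_rfl (SuperRing.ofOdd _ ζ)).od) (by
      rw [neg_smul]
      exact (add_neg_eq_zero.2 key).symm)
  have hm0 : (E.app V le_rfl (SuperRing.ofOdd _ ζ)).od = 0 := by
    have := congrArg (fun q => q.2.od) (e1.trans e0.symm)
    exact neg_eq_zero.1 this
  have e2 := hp (1, 0) (by
    rw [one_smul, zero_smul, add_zero]
    ext W hW a : 4
    obtain ⟨s, hs⟩ := (hζ W hW).2 a.od
    refine Eq.trans ?_ (h.even.app_eq_of_forall_eq_zero hW (h0 W hW) hs).symm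
    rw [hm0, map_zero, smul_zero, map_zero]
    rfl)
  exact one_ne_zero (α := Γ(X.even, V)) (congrArg (fun q => q.1.ev) (e2.trans e0.symm))

end SuperScheme

/-! ### Automorphisms over the identity of the even part -/

theorem AlgebraicGeometry.Scheme.le_preimage_of_eq_id {C : Scheme.{u}} {σ : C ⟶ C} (h : σ = 𝟙 C)
    {U V : C.Opens} (hV : V ≤ U) : V ≤ σ ⁻¹ᵁ U := by
  subst h; exact hV

theorem AlgebraicGeometry.Scheme.preimage_of_eq_id {C : Scheme.{u}} {σ : C ⟶ C} (h : σ = 𝟙 C)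
    (U : C.Opens) : σ ⁻¹ᵁ U = U := by
  subst h; rfl

namespace SuperScheme

variable {k : Type u} [Field k] {X : SuperScheme k}

theorem appLE_of_eq_id {σ : X.even ⟶ X.even} (h : σ = 𝟙 _) {U V : X.even.Opens} (hV : V ≤ U)
    (hV' : V ≤ σ ⁻¹ᵁ U) (r : Γ(X.even, U)) : σ.appLE U V hV' r = X.evenRes hV r := by
  subst h
  simp only [Scheme.Hom.appLE, Scheme.Hom.id_app]
  rfl

/-- Conjugating a vector field by an automorphism `φ` that is the identity on the underlying scheme:
`(φ^* δ) ∘ φ^# = φ^# ∘ δ`. -/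
theorem pullField_app_pull {φ : Aut X} (hφ : φ.hom.base = 𝟙 _) (hφ' : φ.inv.base = 𝟙 _)
    {U : X.even.Opens} (δ : SheafEnd X U) (W : X.even.Opens) (hW : W ≤ φ.hom.base ⁻¹ᵁ U)
    (hW' : W ≤ U) (h : W ≤ φ.hom.base ⁻¹ᵁ W) (a : X.Fun W) :
    (pullField φ δ).app W hW (Hom.pull φ.hom W W h a) = Hom.pull φ.hom W W h (δ.app W hW' a) := by
  have key (W' : X.even.Opens) (e : W' = W) (h₁ : W ≤ φ.hom.base ⁻¹ᵁ W') (h₂ : W' ≤ U)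
      (h₃ : W' ≤ φ.inv.base ⁻¹ᵁ W) :
      Hom.pull φ.hom W' W h₁ (δ.app W' h₂ (Hom.pull φ.inv W W' h₃ (Hom.pull φ.hom W W h a))) =
        Hom.pull φ.hom W W h (δ.app W hW' a) := by
    subst e
    have e₁ := Hom.pull_comp φ.inv φ.hom h h₃ (Scheme.le_preimage_of_eq_id (by
      change φ.inv.base ≫ φ.hom.base = _
      rw [hφ, hφ', Category.id_comp]) le_rfl) a
    have e₂ := Hom.pull_congr (U := W') (V := W') φ.inv_hom_id (Scheme.le_preimage_of_eq_id (by
      change φ.inv.base ≫ φ.hom.base = _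
      rw [hφ, hφ', Category.id_comp]) le_rfl) (le_refl W') a
    have e₃ := e₁.trans (e₂.trans (X.res_self le_rfl a))
    exact congrArg (fun b => Hom.pull φ.hom W' W' h (δ.app W' hW' b)) e₃
  have e := Scheme.preimage_of_eq_id hφ' W
  exact key _ e _ (e.le.trans hW') _

theorem even_map_injective [IsIntegral X.even] {U V : X.even.Opens} (h : V ≤ U) [Nonempty V] :
    Function.Injective (X.evenRes h) :=
  map_injective_of_isIntegral X.even (homOfLE h)

/-- An ideal sheaf on an integral scheme which is nonzero on one affine neighbourhood of a point is
nonzero on all of them. -/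
theorem ideal_ne_bot {C : Scheme.{u}} [IsIntegral C] (I : C.IdealSheafData)
    {U U' : C.Opens} (hU : IsAffineOpen U) (hU' : IsAffineOpen U') {x : C} (hx : x ∈ U)
    (hx' : x ∈ U') (h' : I.ideal ⟨U', hU'⟩ ≠ ⊥) : I.ideal ⟨U, hU⟩ ≠ ⊥ := by
  intro h
  obtain ⟨_, ⟨W, hW, rfl⟩, hxW, hWU⟩ :=
    C.isBasis_affineOpens.exists_subset_of_mem_open (show x ∈ U ⊓ U' from ⟨hx, hx'⟩) (U ⊓ U').2
  have hWU1 : (⟨W, hW⟩ : C.affineOpens) ≤ ⟨U, hU⟩ := fun y hy => (hWU hy).1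
  have hWU2 : (⟨W, hW⟩ : C.affineOpens) ≤ ⟨U', hU'⟩ := fun y hy => (hWU hy).2
  have e1 := I.map_ideal hWU1
  have e2 := I.map_ideal hWU2
  rw [h, Ideal.map_bot] at e1
  rw [← e1] at e2
  have : Nonempty W := ⟨⟨x, hxW⟩⟩
  exact h' ((Ideal.map_eq_bot_iff_of_injective
    (map_injective_of_isIntegral C (homOfLE (show W ≤ U' from hWU2)))).1 e2)

variable [CharZero k]

/-- Let `(E, D)` be a frame with `[D, D] ≡ g E` modulo `D`, where `g ≠ 0`, and let `φ` be an
automorphism over the identity of the even part such that `φ^* D` is a multiple of `D`. Then `φ` is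
`1` or `-1` on odd functions.

Write `φ(ζ) = l ζ` and `D = h ∂_ζ + d ζ`, with `h` an even function and `d` a derivation of the even
functions. Then `φ^* D = l⁻¹ h ∂_ζ + l d ζ`, so `l² = 1` once `h` and `d` are nonzero; and they are
nonzero because `2 h d = g E` on even functions, where `E` does not vanish. -/
theorem eq_or_neg_of_preserved (hμ : ∀ V a b, (X.oddMul V).mul a b = 0) [IsIntegral X.even]
    {φ : Aut X} (hφ : φ.hom.base = 𝟙 _) (hφ' : φ.inv.base = 𝟙 _)
    {U : X.even.Opens} {x : X.even} (hx : x ∈ U) {E D : SheafEnd X U} (hED : X.IsFrame E D)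
    {ζ : Γ(X.odd, U)} (hζ : X.IsOddCoord ζ) {g : Γ(X.even, U)} (hg : g ≠ 0) {b : X.Fun U}
    (hbr : D.oddBracket D - SuperRing.ofEven (X.oddMul U) g • E = b • D)
    (hpres : ∀ (V : X.even.Opens) (hV : V ≤ U), ∃ (h : V ≤ φ.hom.base ⁻¹ᵁ V) (a : X.Fun V),
      ∀ c, (pullField φ (D.restrict hV)).app V h c = a * D.app V hV c) :
    (∀ (V : X.even.Opens) (_ : V ≤ U) (h : V ≤ φ.hom.base ⁻¹ᵁ V) (m : Γ(X.odd, V)),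
      φ.hom.odd V V h m = m) ∨
    (∀ (V : X.even.Opens) (_ : V ≤ U) (h : V ≤ φ.hom.base ⁻¹ᵁ V) (m : Γ(X.odd, V)),
      φ.hom.odd V V h m = -m) := by
  have : Nonempty U := ⟨⟨x, hx⟩⟩
  obtain ⟨l, hl⟩ := (hζ U le_rfl).2 (φ.hom.odd U U (Scheme.le_preimage_of_eq_id hφ le_rfl) ζ)
  replace hl : l • ζ = φ.hom.odd U U (Scheme.le_preimage_of_eq_id hφ le_rfl) ζ := by
    rw [← hl]
    exact congrArg (l • ·) (X.odd_map_self le_rfl ζ).symm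
  have hΦζ (V : X.even.Opens) (hV : V ≤ U) (h : V ≤ φ.hom.base ⁻¹ᵁ V) :
      φ.hom.odd V V h (X.oddRes hV ζ) = X.evenRes hV l • X.oddRes hV ζ := by
    rw [← oddRes_smul, hl]
    refine (φ.hom.odd_map V U V h hV ζ).trans ?_
    exact (φ.hom.map_odd U U V _ hV ζ).symm
  have hΦ (V : X.even.Opens) (hV : V ≤ U) (h : V ≤ φ.hom.base ⁻¹ᵁ V) (s : Γ(X.even, V)) :
      φ.hom.odd V V h (s • X.oddRes hV ζ) = X.evenRes hV l • (s • X.oddRes hV ζ) := by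
    rw [φ.hom.odd_smul, hΦζ V hV h, appLE_of_eq_id hφ le_rfl, smul_comm]
    congr 2
    exact ConcreteCategory.congr_hom (X.even.presheaf.map_id (op V)) s
  -- Near a point where `E` does not vanish the equation `l² = 1` holds, hence everywhere.
  suffices hll : l = 1 ∨ l = -1 by
    refine hll.imp (fun h1 V hV h m => ?_) (fun h1 V hV h m => ?_)
    all_goals
      obtain ⟨s, rfl⟩ := (hζ V hV).2 m
      refine (hΦ V hV h s).trans ?_
      simp [h1]
  obtain ⟨V, hV, r, hr⟩ := hED.exists_ne_zero hμ hζ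
  have hVne : Nonempty V := by
    by_contra hne
    have hbot : V = ⊥ := by
      ext y
      exact ⟨fun hy => (hne ⟨y, hy⟩).elim, fun hy => hy.elim⟩
    subst hbot
    exact hr (Subsingleton.elim _ _)
  obtain ⟨hφV, a, ha⟩ := hpres V hV
  obtain ⟨d, hd⟩ := (hζ V hV).2 (D.app V hV (SuperRing.ofEven _ r)).od
  replace hd : d • X.oddRes hV ζ = (D.app V hV (SuperRing.ofEven _ r)).od := hd
  set ζ' := X.oddRes hV ζ with hζ'
  set l' := X.evenRes hV l with hl'
  set h := (D.app V hV (SuperRing.ofOdd _ ζ')).ev with hh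
  have hDr : D.app V hV (SuperRing.ofEven _ r) = SuperRing.ofOdd _ (d • ζ') := by
    ext
    · exact SuperRing.odd_apply_ofEven_ev (hED.odd.parity V hV) (isUnit_two V) r
    · exact hd.symm
  have hhd : 2 * (h * d) = X.evenRes hV g * (E.app V hV (SuperRing.ofEven _ r)).ev := by
    refine SuperRing.two_mul_eq_of_bracket (hμ V) (isUnit_two V) (hED.odd.parity V hV)
      (hED.odd.leibniz V hV) hd.symm (a := X.res hV b) ?_
    have := congrArg (fun δ : SheafEnd X U => δ.app V hV (SuperRing.ofEven _ r)) hbr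
    rw [sub_eq_add_neg] at this ⊢
    rw [← res_ofEven]
    exact this
  have hne : h * d ≠ 0 := by
    intro h0
    rw [h0, mul_zero] at hhd
    rcases mul_eq_zero.1 hhd.symm with h1 | h1
    · exact hg ((even_map_injective hV) (h1.trans (map_zero _).symm))
    · exact hr h1
  have hh0 := left_ne_zero_of_mul hne
  have hd0 := right_ne_zero_of_mul hne
  have hpull0 (s : Γ(X.even, V)) : Hom.pull φ.hom V V hφV (SuperRing.ofEven _ s) =
      SuperRing.ofEven _ s := by
    ext
    · refine (appLE_of_eq_id hφ le_rfl _ _).trans ?_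
      exact ConcreteCategory.congr_hom (X.even.presheaf.map_id (op V)) s
    · exact map_zero _
  have hpull1 (s : Γ(X.even, V)) : Hom.pull φ.hom V V hφV (SuperRing.ofOdd _ (s • ζ')) =
      SuperRing.ofOdd _ (l' • (s • ζ')) := by
    ext
    · exact map_zero _
    · exact hΦ V hV hφV s
  have e1 : a.ev = l' := by
    have e := (ha _).symm.trans (pullField_app_pull hφ hφ' (D.restrict hV) V hφV le_rfl hφV
      (SuperRing.ofEven _ r))
    have e' : (D.restrict hV).app V le_rfl (SuperRing.ofEven _ r) =
      SuperRing.ofOdd _ (d • ζ') := hDr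
    rw [hpull0, hDr, e', hpull1] at e
    have e2 := congrArg SuperRing.od e
    simp only [SuperRing.mul_od, SuperRing.ofOdd_od, SuperRing.ofOdd_ev, zero_smul, add_zero,
      ← mul_smul] at e2
    exact mul_right_cancel₀ hd0 ((hζ V hV).1 e2)
  have e2 : a.ev * (l' * h) = h := by
    have e := (ha _).symm.trans (pullField_app_pull hφ hφ' (D.restrict hV) V hφV le_rfl hφV
      (SuperRing.ofOdd _ ζ'))
    have h1 := hpull1 1
    rw [one_smul] at h1
    have e' : (D.restrict hV).app V le_rfl (SuperRing.ofOdd _ ζ') = SuperRing.ofEven _ h := by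
      ext
      · rfl
      · exact SuperRing.odd_apply_ofOdd_od (hED.odd.parity V hV) (isUnit_two V) _
    rw [h1, e', hpull0] at e
    have e2 := congrArg SuperRing.ev e
    rw [SuperRing.mul_ev, hμ, add_zero,
      SuperRing.odd_apply_smul_ev (hμ V) (hED.odd.leibniz V hV)] at e2
    exact e2
  have e3 : l' * l' = 1 := by
    rw [e1, ← mul_assoc] at e2
    exact mul_right_cancel₀ hh0 (e2.trans (one_mul h).symm)
  rcases mul_self_eq_one_iff.1 e3 with h1 | h1
  · exact Or.inl (even_map_injective hV (h1.trans (map_one _).symm))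
  · refine Or.inr (even_map_injective hV (h1.trans ?_))
    rw [map_neg, map_one]

end SuperScheme

/-! ### The parity automorphism -/

namespace SuperScheme

variable {k : Type u} [Field k] {X : SuperScheme k}

/-- Conjugation of a vector field by the parity involution. -/
def SheafEnd.parityConj {U : X.even.Opens} (δ : SheafEnd X U) : SheafEnd X U where
  app V h := ((SuperRing.parity (X.oddMul V)).toAddMonoidHom.comp (δ.app V h)).comp
    (SuperRing.parity (X.oddMul V)).toAddMonoidHom
  res_app V W hV hW a := by
    change X.res hW (SuperRing.parity _ (δ.app V hV (SuperRing.parity _ a))) =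
      SuperRing.parity _ (δ.app W _ (SuperRing.parity _ (X.res hW a)))
    rw [res_parity, δ.res_app, res_parity]

theorem SheafEnd.parityConj_app {U : X.even.Opens} (δ : SheafEnd X U) {V : X.even.Opens}
    (h : V ≤ U) (a : X.Fun V) :
    δ.parityConj.app V h a = SuperRing.parity _ (δ.app V h (SuperRing.parity _ a)) := rfl

theorem SheafEnd.parityConj_parityConj {U : X.even.Opens} (δ : SheafEnd X U) :
    δ.parityConj.parityConj = δ := by
  ext V h a : 4
  rw [parityConj_app, parityConj_app, SuperRing.parity_parity, SuperRing.parity_parity]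

theorem SheafEnd.parityConj_mem_tangent {U : X.even.Opens} {δ : SheafEnd X U}
    (h : δ ∈ X.tangent U) : δ.parityConj ∈ X.tangent U := by
  obtain ⟨δ₀, δ₁, h₀, h₁, rfl⟩ := h
  refine ⟨δ₀, -δ₁, h₀, ⟨fun V hV t => ?_, fun V hV a => ?_, fun V hV a b => ?_⟩, ?_⟩
  · rw [SheafEnd.neg_app, AddMonoidHom.neg_apply, h₁.const, neg_zero]
  · rw [SheafEnd.neg_app, AddMonoidHom.neg_apply, AddMonoidHom.neg_apply, h₁.parity, map_neg]
  · simp only [SheafEnd.neg_app, AddMonoidHom.neg_apply, h₁.leibniz]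
    rw [neg_mul, mul_neg, neg_add]
  · ext V hV a : 4
    rw [parityConj_app, SheafEnd.add_app, SheafEnd.add_app, AddMonoidHom.add_apply,
      AddMonoidHom.add_apply, h₀.parity, h₁.parity, map_add, map_neg, SuperRing.parity_parity,
      SuperRing.parity_parity]
    rfl

/-- If `δ = c D` with `D` odd, its conjugate is `-γ(c) D`, where `γ` is the parity involution. -/
theorem OddDistribution.parityConj_mem (𝒟 : X.OddDistribution) {U : X.even.Opens}
    {δ : SheafEnd X U} (h : δ ∈ 𝒟.sections U) : δ.parityConj ∈ 𝒟.sections U := by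
  refine 𝒟.mem_of_local U _ (SheafEnd.parityConj_mem_tangent (𝒟.le_tangent U δ h)) fun x hx => ?_
  obtain ⟨V, hxV, E, D, hED, hgen⟩ := 𝒟.locally_generated x
  refine ⟨U ⊓ V, inf_le_left, ⟨hx, hxV⟩, ?_⟩
  have h1 := 𝒟.restrict_mem U (U ⊓ V) inf_le_left δ h
  rw [hgen _ inf_le_right, Submodule.mem_span_singleton] at h1 ⊢
  obtain ⟨c, hc⟩ := h1
  refine ⟨-SuperRing.parity _ c, ?_⟩
  ext W hW a : 4
  have h2 := congrArg (fun ε : SheafEnd X (U ⊓ V) =>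
    SuperRing.parity _ (ε.app W hW (SuperRing.parity _ a))) hc
  refine Eq.trans ?_ h2
  change X.res hW (-SuperRing.parity _ c) * D.app W _ a =
    SuperRing.parity _ (X.res hW c * D.app W _ (SuperRing.parity _ a))
  rw [hED.odd.parity, map_mul, map_neg, map_neg, SuperRing.parity_parity, res_parity, neg_mul,
    mul_neg]

theorem pull_parityHom {V W : X.even.Opens} (h : W ≤ X.parityHom.base ⁻¹ᵁ V) (h' : W ≤ V)
    (a : X.Fun V) : Hom.pull X.parityHom V W h a = SuperRing.parity _ (X.res h' a) := by
  rw [res_apply]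
  ext
  · exact appLE_of_eq_id (σ := X.parityHom.base) rfl h' h a.ev
  · rfl

theorem OddDistribution.isPreservedBy_parityAut (𝒟 : X.OddDistribution) :
    𝒟.IsPreservedBy X.parityAut := by
  intro U δ
  have e : pullField X.parityAut δ = δ.parityConj := by
    ext W hW a : 4
    have h1 := pull_parityHom (X := X) (V := W) (W := W) le_rfl le_rfl a
    refine (pull_parityHom (X := X) (V := W) (W := W) le_rfl le_rfl _).trans ?_
    refine congrArg (SuperRing.parity _) ((X.res_self le_rfl _).trans ?_)
    exact congrArg (δ.app W hW) (h1.trans (congrArg _ (X.res_self le_rfl a)))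
  rw [e]
  refine ⟨𝒟.parityConj_mem, fun h => ?_⟩
  rw [← δ.parityConj_parityConj]
  exact 𝒟.parityConj_mem h

theorem oddRes_ne_neg [CharZero k] [IsIntegral X.even] {W V : X.even.Opens}
    {ζ : Γ(X.odd, W)} (hζ : X.IsOddCoord ζ) (hV : V ≤ W) [Nonempty V] :
    X.oddRes hV ζ ≠ -X.oddRes hV ζ := by
  intro h
  have h1 := SuperRing.eq_zero_of_eq_neg (isUnit_two V) h
  have h2 : (1 : Γ(X.even, V)) = 0 := (hζ V hV).1 (by
    change (1 : Γ(X.even, V)) • X.oddRes hV ζ = (0 : Γ(X.even, V)) • X.oddRes hV ζ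
    rw [h1, smul_zero, smul_zero])
  exact one_ne_zero h2

theorem parityAut_ne_one [CharZero k] (hX : X.IsSupercurve) [IsIntegral X.even] :
    X.parityAut ≠ 1 := by
  intro h
  obtain ⟨W, -, ζ, hx, hζ, -⟩ := hX.exists_isOddCoord (genericPoint X.even)
  have : Nonempty W := ⟨⟨_, hx⟩⟩
  have e : X.parityHom = 𝟙 X := congrArg Iso.hom h
  have e' := congrArg SuperRing.od (Hom.pull_congr e (U := W) (V := W) le_rfl le_rfl
    (SuperRing.ofOdd _ ζ))
  exact oddRes_ne_neg hζ le_rfl (Eq.symm e')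

/-- An automorphism which is the identity on even functions and locally `±1` on odd functions is
the identity or the parity automorphism: the curve being irreducible, the sign is determined at the
generic point. -/
theorem eq_one_or_eq_parityAut [CharZero k] (hX : X.IsSupercurve) [IsIntegral X.even] {φ : Aut X}
    (hφ : φ.hom.base = 𝟙 _)
    (h : ∀ x : X.even, ∃ U : X.even.Opens, x ∈ U ∧
      ((∀ (V : X.even.Opens) (_ : V ≤ U) (h : V ≤ φ.hom.base ⁻¹ᵁ V) (m : Γ(X.odd, V)),
        φ.hom.odd V V h m = m) ∨
      (∀ (V : X.even.Opens) (_ : V ≤ U) (h : V ≤ φ.hom.base ⁻¹ᵁ V) (m : Γ(X.odd, V)),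
        φ.hom.odd V V h m = -m))) : φ = 1 ∨ φ = X.parityAut := by
  have hloc (U V W : X.even.Opens) (hV : V ≤ φ.hom.base ⁻¹ᵁ U) (hVU : V ≤ U) (hW : W ≤ V)
      (m : Γ(X.odd, U)) : X.oddRes hW (φ.hom.odd U V hV m) =
        φ.hom.odd W W (Scheme.le_preimage_of_eq_id hφ le_rfl) (X.oddRes (hW.trans hVU) m) :=
    (φ.hom.map_odd U V W hV hW m).trans
      (φ.hom.odd_map W U W (Scheme.le_preimage_of_eq_id hφ le_rfl) (hW.trans hVU) m).symm
  have hbase (U V : X.even.Opens) (hV : V ≤ φ.hom.base ⁻¹ᵁ U) : V ≤ U :=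
    hV.trans (Scheme.preimage_of_eq_id hφ U).le
  obtain ⟨U₀, hU₀, h₀⟩ := h (genericPoint X.even)
  refine h₀.imp (fun h₀ => ?_) (fun h₀ => ?_)
  all_goals
    refine Iso.ext (Hom.ext hφ fun U V hV hV' m => odd_ext fun x hx => ?_)
    obtain ⟨U₁, hxU₁, h₁⟩ := h x
    obtain ⟨W, -, ζ, hxW, hζ, -⟩ := hX.exists_isOddCoord x
    have hη (Z : X.even.Opens) (hZ : x ∈ Z) : genericPoint X.even ∈ Z := Scheme.genericPoint_mem hZ
    let Z := U₁ ⊓ (W ⊓ U₀)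
    have : Nonempty Z := ⟨⟨_, hη _ hxU₁, hη _ hxW, hU₀⟩⟩
    have hZ₁ : Z ≤ U₁ := inf_le_left
    have hZW : Z ≤ W := inf_le_right.trans inf_le_left
    have hZ₀ : Z ≤ U₀ := inf_le_right.trans inf_le_right
    have hZ := Scheme.le_preimage_of_eq_id hφ (le_refl Z)
    refine ⟨V ⊓ U₁, inf_le_left, ⟨hx, hxU₁⟩, ?_⟩
    rw [hloc U V _ hV (hbase U V hV)]
  · have h₂ := h₁.resolve_right fun h₁ => oddRes_ne_neg hζ hZW
      ((h₀ Z hZ₀ hZ _).symm.trans (h₁ Z hZ₁ hZ _))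
    rw [h₂ _ inf_le_right]
    exact (X.oddRes_oddRes _ _ _).symm
  · have h₂ := h₁.resolve_left fun h₁ => oddRes_ne_neg hζ hZW
      ((h₁ Z hZ₁ hZ _).symm.trans (h₀ Z hZ₀ hZ _))
    rw [h₂ _ inf_le_right]
    refine Eq.trans ?_ (map_neg (X.oddRes _) _).symm
    exact congrArg Neg.neg (X.oddRes_oddRes _ _ _).symm

end SuperScheme

/-! ### Automorphisms of super Riemann surfaces -/

namespace SuperRiemannSurface

variable {k : Type u} [Field k] {n : ℕ} (S : SuperRiemannSurface k n)

theorem parityAut_mem_autGroup : S.X.parityAut ∈ S.autGroup :=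
  ⟨Scheme.IdealSheafData.comap_id _, fun _ => rfl, S.distribution.isPreservedBy_parityAut⟩

/-- The Ramond punctures form a finite closed subset of a Jacobson space. -/
theorem isClosed_puncture (i : Fin n) : IsClosed {S.puncture i} := by
  have := S.isSupercurve.jacobsonSpace
  refine isClosed_singleton_of_mem_of_finite (Z := Set.range S.puncture) ?_
    (Set.finite_range _) ⟨i, rfl⟩
  rw [S.range_puncture]
  exact S.ramond.support.isClosed

variable [IsAlgClosed k] [CharZero k]

/-- An automorphism fixing three punctures is the identity on the underlying scheme, and then
preserving the distribution makes it `1` or `-1` on odd functions. -/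
theorem eq_one_or_eq_parityAut (hn : 3 ≤ n) (hS : S.IsGenusZero) {φ : Aut S.X}
    (hφ : φ ∈ S.autGroup) : φ = 1 ∨ φ = S.X.parityAut := by
  have hX := S.isSupercurve
  have := hX.isIntegral
  have e : φ.hom.base ≫ φ.inv.base = 𝟙 _ := congrArg SuperScheme.Hom.base φ.hom_inv_id
  have e' : φ.inv.base ≫ φ.hom.base = 𝟙 _ := congrArg SuperScheme.Hom.base φ.inv_hom_id
  have hne (i j : Fin n) (hij : i ≠ j) : S.puncture i ≠ S.puncture j :=
    fun h => hij (S.puncture_injective h)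
  have hb : φ.hom.base = 𝟙 _ :=
    hX.eq_id_of_fixed hS e e' φ.hom.base_toBase (S.isClosed_puncture ⟨0, by omega⟩)
      (S.isClosed_puncture ⟨1, by omega⟩) (S.isClosed_puncture ⟨2, by omega⟩)
      (hne _ _ (by simp)) (hne _ _ (by simp)) (hne _ _ (by simp)) (hφ.2.1 _) (hφ.2.1 _) (hφ.2.1 _)
  have hb' : φ.inv.base = 𝟙 _ := by rw [hb, Category.id_comp] at e; exact e
  refine SuperScheme.eq_one_or_eq_parityAut hX hb fun x => ?_
  obtain ⟨U, hU, hxU, E, D, hED, hgen, f, v, hf, hbr⟩ := S.commutator x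
  obtain ⟨U', hU', hxU', f', hf', hreg, -⟩ := S.cartier x
  obtain ⟨W, -, ζ, hxW, hζ, -⟩ := hX.exists_isOddCoord x
  have : Nonempty U := ⟨⟨x, hxU⟩⟩
  have : Nonempty U' := ⟨⟨x, hxU'⟩⟩
  have hf0 : f ≠ 0 := by
    have h1 : S.ramond.ideal ⟨U', hU'⟩ ≠ ⊥ := by
      rw [hf', Ne, Ideal.span_singleton_eq_bot]
      rintro rfl
      exact one_ne_zero (hreg 1 (zero_mul 1))
    have h2 := SuperScheme.ideal_ne_bot S.ramond hU hU' hxU hxU' h1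
    rwa [hf, Ne, Ideal.span_singleton_eq_bot] at h2
  have hVU : U ⊓ W ≤ U := inf_le_left
  have : Nonempty (U ⊓ W : S.X.even.Opens) := ⟨⟨x, hxU, hxW⟩⟩
  rw [hgen U le_rfl, Submodule.mem_span_singleton] at hbr
  obtain ⟨b, hb₁⟩ := hbr
  refine ⟨U ⊓ W, ⟨hxU, hxW⟩, SuperScheme.eq_or_neg_of_preserved
    (fun V a b => hX.oddMul_eq_zero V a b) hb hb' ⟨hxU, hxW⟩ (hED.restrict hVU)
    (hζ.res inf_le_right) (g := S.X.evenRes hVU (v * f)) (b := S.X.res hVU b) ?_ ?_ ?_⟩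
  · refine (map_ne_zero_iff _ (SuperScheme.even_map_injective hVU)).2 ?_
    exact mul_ne_zero v.ne_zero hf0
  · ext V hV a : 4
    have h1 := congrArg (fun δ : SuperScheme.SheafEnd S.X U => δ.app V (hV.trans hVU) a) hb₁
    rw [sub_eq_add_neg] at h1 ⊢
    rw [← SuperScheme.res_ofEven]
    change _ + -(S.X.res hV (S.X.res hVU _) * _) = S.X.res hV (S.X.res hVU b) * _
    rw [SuperScheme.res_res, SuperScheme.res_res]
    exact h1.symm
  · intro V hV
    have hφV := Scheme.le_preimage_of_eq_id hb (le_refl V)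
    have hφU : φ.hom.base ⁻¹ᵁ V ≤ U :=
      (Scheme.preimage_of_eq_id hb V).le.trans (hV.trans hVU)
    have hmem : D.restrict (hV.trans hVU) ∈ S.distribution.sections V := by
      rw [hgen V (hV.trans hVU)]
      exact Submodule.mem_span_singleton_self _
    rw [hφ.2.2 V, hgen _ hφU, Submodule.mem_span_singleton] at hmem
    obtain ⟨a, ha⟩ := hmem
    refine ⟨hφV, S.X.res hφV a, fun c => ?_⟩
    exact (congrArg
      (fun δ : SuperScheme.SheafEnd S.X (φ.hom.base ⁻¹ᵁ V) => δ.app V hφV c) ha).symm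

end SuperRiemannSurface

end

theorem mainTheorem8 {k : Type u} [Field k] [IsAlgClosed k] [CharZero k] (n : ℕ) (hn : 4 ≤ n)
    (S : SuperRiemannSurface k n) (hS : S.IsGenusZero) :
    Nonempty (S.autGroup ≃* Multiplicative (ZMod 2)) ∧
      S.X.parityAut ∈ S.autGroup ∧ S.X.parityAut ≠ 1 ∧
      ∀ φ ∈ S.autGroup, φ ≠ 1 → φ = S.X.parityAut := by
  have := S.isSupercurve.isIntegral
  have hne : S.X.parityAut ≠ 1 := SuperScheme.parityAut_ne_one S.isSupercurve
  have heq (φ) (hφ : φ ∈ S.autGroup) : φ = 1 ∨ φ = S.X.parityAut :=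
    S.eq_one_or_eq_parityAut (by omega) hS hφ
  refine ⟨⟨?_⟩, S.parityAut_mem_autGroup, hne, fun φ hφ h => (heq φ hφ).resolve_left h⟩
  have hcard : Nat.card S.autGroup = 2 := by
    refine Nat.card_eq_two_iff.2 ⟨1, ⟨_, S.parityAut_mem_autGroup⟩, fun h => ?_, ?_⟩
    · exact hne (congrArg Subtype.val h).symm
    · refine Set.eq_univ_of_forall fun φ => ?_
      exact (heq φ.1 φ.2).imp Subtype.ext Subtype.ext
  exact mulEquivOfPrimeCardEq hcard (by simp)
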